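/- Let $k\ge 1$, $n=2k+1$, and let $\lambda_j\neq\mu_j$ ($j=1,\dots,4$) be complex numbers with $(k+1)\sum_j\lambda_j+k\sum_j\mu_j=0$. Suppose that $\sum_{j=1}^4\lambda_j=0$ is the only non-genericity relation, i.e. it holds (hence so does $\sum_j\mu_j=0$), and if $\Phi_1,\dots,\Phi_4$ are sets of indices of eigenvalues (the eigenvalues being $\lambda_j$ repeated $k+1$ times and $\mu_j$ repeated $k$ times), all with the same number $m$ of elements, $0<m<n$, and the sum of all the eigenvalues chosen in $\Phi_1,\dots,\Phi_4$ is $0$, then this equality is of the form $a\sum_j\lambda_j+b\sum_j\mu_j=0$ (the number of indices of $\lambda_j$ in $\Phi_j$ does not depend on $j$). Let $\mathcal V$ be the set of quadruples $(A_1,\dots,A_4)$ of complex $n\times n$ matrices with $A_1+\dots+A_4=0$, where $A_j$ is diagonalizable with eigenvalues $\lambda_j,\mu_j$ of multiplicities $k+1,k$. A quadruple of diagonalizable $2\times 2$ matrices with eigenvalues $\lambda_j,\mu_j$ and zero sum is of type $B$ if it has no non-trivial common invariant subspace. A quadruple of upper-triangular diagonalizable $(2l+1)\times(2l+1)$ matrices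 ($l\ge 0$) with eigenvalues $\lambda_j,\mu_j$ of multiplicities $l+1,l$ and with zero sum is of type $H_{2l+1}$ if only scalar matrices commute with all four matrices. In each diagonal position of such a quadruple stand either $(\lambda_1,\dots,\lambda_4)$ or $(\mu_1,\dots,\mu_4)$; the resulting sequence is called the order of the quadruple. For $0\le s\le k$, a stratum of type $HB_s$ is a non-empty set consisting of all the quadruples in $\mathcal V$ which are simultaneously conjugate to block-diagonal ones, with $s$ pairwise non-equivalent (not simultaneously conjugate) blocks of type $B$ and one block of type $H_{n-2s}$ of a given order. Then strata of type $HB_s$ exist, and for each of them: 1) it is locally (in the Zariski topology of the affine space of quadruples of $n\times n$ matrices) a smooth algebraic variety of dimension $n^2+s-1$, which is $s$ more than the expected dimension $1-\kappa+n^2$, where $\kappa=2n^2-d_1-\dots-d_4$ and $d_j$ is the dimension of the conjugacy class of $A_j$; 2) it is connected (in the classical topology). -/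

import Mathlib

namespace DSP

/-- Quadruples of complex `n × n` matrices. -/
abbrev Quad (n : ℕ) : Type := Fin 4 → Matrix (Fin n) (Fin n) ℂ

/-- `M` is diagonalizable with eigenvalues `α`, `β` of multiplicities `a`, `b`. -/
def IsDiagWith {n : ℕ} (M : Matrix (Fin n) (Fin n) ℂ) (α β : ℂ) (a b : ℕ) : Prop :=
  ∃ (P : GL (Fin n) ℂ) (d : Fin n → ℂ),
    (P⁻¹).val * M * P.val = Matrix.diagonal d ∧
    (∀ i, d i = α ∨ d i = β) ∧
    (Finset.univ.filter (fun i => d i = α)).card = a ∧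
    (Finset.univ.filter (fun i => d i = β)).card = b

/-- The quadruples with zero sum whose `j`-th matrix is diagonalizable with eigenvalues
`lam j`, `mu j` of multiplicities `a`, `b`. -/
def variety (n a b : ℕ) (lam mu : Fin 4 → ℂ) : Set (Quad n) :=
  {A | (∀ j, IsDiagWith (A j) (lam j) (mu j) a b) ∧ ∑ j, A j = 0}

/-- The list of eigenvalues, repeated with multiplicities: `α` is repeated `k + 1` times and
`β` is repeated `k` times. -/
noncomputable def eigenvalueList (k : ℕ) (α β : ℂ) : Fin (2 * k + 1) → ℂ :=
  fun i => if i.val < k + 1 then α else β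

/-- `∑ lam j = 0` is the only non-genericity relation: it holds, and if some
index sets `Φ j`, all of the same cardinality `m` with `0 < m < n`, give a vanishing sum of
eigenvalues, then this equality has the form `a ∑ lam j + b ∑ mu j = 0`, i.e. it is one of the
equalities implied by `∑ lam j = 0` (and by the vanishing of the sum of all eigenvalues). -/
def OnlyRelation (k : ℕ) (lam mu : Fin 4 → ℂ) : Prop :=
  ∑ j, lam j = 0 ∧
  ∀ (m : ℕ) (Φ : Fin 4 → Finset (Fin (2 * k + 1))),
    0 < m → m < 2 * k + 1 → (∀ j, (Φ j).card = m) →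
    ∑ j, ∑ i ∈ Φ j, eigenvalueList k (lam j) (mu j) i = 0 →
    ∀ j j', ((Φ j).filter (fun i => i.val < k + 1)).card =
      ((Φ j').filter (fun i => i.val < k + 1)).card

/-- No non-trivial common invariant subspace. -/
def IsIrreducibleQuad {n : ℕ} (A : Quad n) : Prop :=
  0 < n ∧ ∀ W : Submodule ℂ (Fin n → ℂ),
    (∀ j, ∀ v ∈ W, (A j).mulVec v ∈ W) → W = ⊥ ∨ W = ⊤

/-- Only scalar matrices commute with all four matrices. -/
def HasTrivialCentralizer {n : ℕ} (A : Quad n) : Prop :=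
  ∀ Z : Matrix (Fin n) (Fin n) ℂ, (∀ j, Z * A j = A j * Z) → ∃ c : ℂ, Z = c • 1

/-- Simultaneous conjugacy, i.e. equivalence of the representations. -/
def AreEquivalent {n : ℕ} (A B : Quad n) : Prop :=
  ∃ g : GL (Fin n) ℂ, ∀ j, B j = g.val * A j * (g⁻¹).val

/-- Type `B`: irreducible quadruples of diagonalizable `2 × 2` matrices with eigenvalues
`lam j`, `mu j` and with zero sum. -/
def IsTypeB (lam mu : Fin 4 → ℂ) (B : Quad 2) : Prop :=
  B ∈ variety 2 1 1 lam mu ∧ IsIrreducibleQuad B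

/-- Type `H` of size `2 * l + 1`: upper-triangular quadruples with zero sum, with trivial
centralizer, of diagonalizable matrices with eigenvalues `lam j`, `mu j` of multiplicities
`l + 1`, `l`. The function `o` records the order in which the eigenvalues stand
on the diagonal: in position `i` stand the `lam j` if `o i = true` and the `mu j` otherwise. -/
def IsTypeH (lam mu : Fin 4 → ℂ) (l : ℕ) (o : Fin (2 * l + 1) → Bool)
    (H : Quad (2 * l + 1)) : Prop :=
  H ∈ variety (2 * l + 1) (l + 1) l lam mu ∧
  (∀ j, (H j).BlockTriangular id) ∧
  HasTrivialCentralizer H ∧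
  ∀ j i, H j i i = if o i = true then lam j else mu j

/-- The quadruples of `(2k+1) × (2k+1)` matrices which are, up to conjugacy, block-diagonal with
`s` pairwise non-equivalent blocks of type `B` and with one block of type `H` of size
`2 * (k - s) + 1`, with order `o` of the eigenvalues on the diagonal of the last block. -/
def setHB (k s : ℕ) (lam mu : Fin 4 → ℂ) (o : Fin (2 * (k - s) + 1) → Bool) :
    Set (Quad (2 * k + 1)) :=
  {A | A ∈ variety (2 * k + 1) (k + 1) k lam mu ∧
    ∃ (B : Fin s → Quad 2) (H : Quad (2 * (k - s) + 1))
      (e : (Fin 2 × Fin s) ⊕ Fin (2 * (k - s) + 1) ≃ Fin (2 * k + 1))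
      (g : GL (Fin (2 * k + 1)) ℂ),
      (∀ i, IsTypeB lam mu (B i)) ∧
      (∀ i i', i ≠ i' → ¬ AreEquivalent (B i) (B i')) ∧
      IsTypeH lam mu (k - s) o H ∧
      ∀ j, A j = g.val *
        Matrix.reindex e e
          (Matrix.fromBlocks (Matrix.blockDiagonal (fun i => B i j)) 0 0 (H j)) *
        (g⁻¹).val}

/-- A stratum of type `HB_s`. -/
def IsStratumHB (k s : ℕ) (lam mu : Fin 4 → ℂ) (S : Set (Quad (2 * k + 1))) : Prop :=
  S.Nonempty ∧ ∃ o : Fin (2 * (k - s) + 1) → Bool, S = setHB k s lam mu o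

/-- `S` is locally, in the Zariski topology of affine space, a smooth algebraic variety of
dimension `d`: each point has a principal Zariski-open neighbourhood `h ≠ 0` in which `S` is the
zero set of `card ι - d` polynomials whose differentials at the point are linearly
independent. -/
def IsLocallySmoothVariety {ι : Type} [Fintype ι] (S : Set (ι → ℂ)) (d : ℕ) : Prop :=
  ∀ x ∈ S, ∃ (c : ℕ) (h : MvPolynomial ι ℂ) (f : Fin c → MvPolynomial ι ℂ),
    c + d = Fintype.card ι ∧
    MvPolynomial.eval x h ≠ 0 ∧
    (∀ y, MvPolynomial.eval y h ≠ 0 → (y ∈ S ↔ ∀ i, MvPolynomial.eval y (f i) = 0)) ∧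
    LinearIndependent ℂ
      (fun (i : Fin c) (v : ι) => MvPolynomial.eval x (MvPolynomial.pderiv v (f i)))

/-- The matrix entries of a quadruple, as coordinates in affine space. -/
def coords {n : ℕ} (A : Quad n) : Fin 4 × Fin n × Fin n → ℂ :=
  fun p => A p.1 p.2.1 p.2.2

/-- The dimension of the conjugacy class of `M`, as the dimension of its tangent space at `M`,
which is the space of all commutators `M * X - X * M`. -/
noncomputable def classDim {n : ℕ} (M : Matrix (Fin n) (Fin n) ℂ) : ℕ :=
  Module.finrank ℂ (LinearMap.range (LinearMap.mulLeft ℂ M - LinearMap.mulRight ℂ M))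

/-- The index of rigidity of the quadruple of conjugacy classes of the matrices `A j`. -/
noncomputable def rigidityIndex {n : ℕ} (A : Quad n) : ℤ :=
  2 * (n : ℤ) ^ 2 - ∑ j, (classDim (A j) : ℤ)

/-- The expected dimension `1 - κ + n ^ 2`, where `κ` is the index of rigidity. -/
noncomputable def expectedDim {n : ℕ} (A : Quad n) : ℤ :=
  1 - rigidityIndex A + (n : ℤ) ^ 2

end DSP

/-!
# Strata of type `HB` of quadruples of matrices with two eigenvalues

Write each matrix `A j`, with the eigenvalues `lam j` and `mu j`, as an affine function of an
involution `r j`. The condition that the sum of the `A j` is zero becomes `∑ j, c j • r j = 0` with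
`c j = mu j - lam j` (`ReflRel`), and the only non-genericity relation says that no proper subfamily
of the `c j` has sum zero (`NoSubsum`). The point is that in the algebra generated by four such
involutions the anticommutators `r i * r j + r j * r i` and the elements
`r i * r j * r k - r k * r j * r i` are central. Hence they act by scalars on a family with only
scalar endomorphisms (a brick), and these scalars determine it. If some anticommutator is not
`± 2`, the brick is two-dimensional, irreducible, and given by `normalForm`. Otherwise genericity
forces all anticommutators to be `2`; after splitting along the eigenspaces of `r 0` the family
becomes a pair of matrices with only scalar endomorphisms, hence (by a count of equations,
`exists_pair_hom`) it is the standard pair or its transpose. Therefore all blocks of type `H` with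
the same first eigenvalue in their order are equivalent, and a stratum is the set of quadruples
equivalent to a direct sum of `s` inequivalent irreducible `2 × 2` families and one fixed family
(`IsHB`, `mem_setHB_iff`).

**Smoothness.** At a point of the stratum a generic linear combination `z` of the central elements
has different eigenvalues on the `s + 1` blocks, and the centralizer has dimension `s + 1`. Three
conditions that are open in the Zariski topology hold: the Gram matrix of the powers
`z ^ a`, `a ≤ s`, for the trace form is invertible, the centralizer has dimension at most `s + 1`,
and the four matrices have no common eigenvector of the kind excluded for the block of type `H`.
Conversely they force a solution of the equations to lie in the stratum: the centralizer contains no non-zero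
nilpotent matrices, so `z` splits the family into `s + 1` bricks, which are as required by a count
of dimensions (`isHB_of_gram`). So the stratum is locally the set of all solutions of the equations
(`exists_forall_isHB`). The tangent space defined by the linearized equations has dimension
`n ^ 2 + s - 1`, by duality for the trace form between the image of the derivative and the
centralizer (`finrank_tangent`), and it consists of velocities of curves of solutions: up to
commutators a tangent vector is block-diagonal, because the central elements still exist over the
dual numbers, and for a brick the equations have a derivative of maximal rank
(`IsHB.hasCurve`). An algebraic set with this property is smooth
(`exists_local_equations`): equations with independent differentials generate the others up to terms
of arbitrarily high order, hence in the local ring by Krull's intersection theorem.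

**Connectedness.** A two-dimensional family for which `(c 0 • r 0 + c 1 • r 1) ^ 2` is a scalar `y`
outside a finite set is given by two parameters, a square root `τ` of `y` and a non-zero number `q`
(`chart`). The corresponding points of the stratum are the image of the complement of a hypersurface
in an affine space, which is connected. They are dense in the stratum, since every irreducible
two-dimensional family can be deformed so that `y` moves with an arbitrary velocity
(`Irred.exists_deformation`).
-/

/-! ### Central elements of the algebra generated by four involutions with weighted sum zero -/

namespace DSP

/-- Four involutions `r j` of a complex algebra with `∑ c j • r j = 0`. A matrix with the two
eigenvalues `lam j`, `mu j` is an affine function of an involution, and for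
`c j = mu j - lam j` the condition that the sum of the matrices is zero takes this form. -/
structure ReflRel {R : Type*} [Ring R] [Algebra ℂ R] (c : Fin 4 → ℂ) (r : Fin 4 → R) : Prop where
  sq : ∀ j, r j * r j = 1
  sum : ∑ j, c j • r j = 0

/-- No proper non-empty subfamily of the `c j` has sum zero. -/
def NoSubsum (c : Fin 4 → ℂ) : Prop :=
  ∑ j, c j = 0 ∧ ∀ J : Finset (Fin 4), ∑ j ∈ J, c j = 0 → J = ∅ ∨ J = Finset.univ

theorem NoSubsum.ne_zero {c : Fin 4 → ℂ} (hc : NoSubsum c) (j : Fin 4) : c j ≠ 0 := by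
  intro h
  rcases hc.2 {j} (by simpa using h) with h | h
  · simp at h
  · have := congrArg Finset.card h
    simp at this

/-- The anticommutators of the `r j`. -/
def acomm {R : Type*} [Ring R] (r : Fin 4 → R) (i j : Fin 4) : R := r i * r j + r j * r i

/-- The antisymmetrized triple products of the `r j`. -/
def tri {R : Type*} [Ring R] (r : Fin 4 → R) (i j k : Fin 4) : R :=
  r i * r j * r k - r k * r j * r i

theorem univ_eq_of_distinct : ∀ {i j k l : Fin 4}, i ≠ j → i ≠ k → i ≠ l → j ≠ k → j ≠ l → k ≠ l →
    (Finset.univ : Finset (Fin 4)) = {i, j, k, l} := by decide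

theorem sum_eq_of_distinct {M : Type*} [AddCommMonoid M] (f : Fin 4 → M) {i j k l : Fin 4}
    (hij : i ≠ j) (hik : i ≠ k) (hil : i ≠ l) (hjk : j ≠ k) (hjl : j ≠ l) (hkl : k ≠ l) :
    ∑ x, f x = f i + f j + f k + f l := by
  rw [univ_eq_of_distinct hij hik hil hjk hjl hkl]
  simp [*, add_assoc]

theorem exists_fourth : ∀ {i j k : Fin 4}, i ≠ j → i ≠ k → j ≠ k →
    ∃ l, i ≠ l ∧ j ≠ l ∧ k ≠ l ∧ ∀ x, x = i ∨ x = j ∨ x = k ∨ x = l := by decide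

section Central

variable {R : Type*} [Ring R] [Algebra ℂ R] {c : Fin 4 → ℂ} {r : Fin 4 → R}

theorem ReflRel.map {R' : Type*} [Ring R'] [Algebra ℂ R'] (h : ReflRel c r) (f : R →ₐ[ℂ] R') :
    ReflRel c (fun j => f (r j)) := by
  refine ⟨fun j => by rw [← map_mul, h.sq, map_one], ?_⟩
  have := congrArg f h.sum
  simpa using this

theorem acomm_comm {R : Type*} [Ring R] (r : Fin 4 → R) (i j : Fin 4) : acomm r i j = acomm r j i :=
  add_comm _ _

theorem ReflRel.acomm_self (h : ReflRel c r) (i : Fin 4) : acomm r i i = 2 := by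
  rw [acomm, h.sq, one_add_one_eq_two]

theorem ReflRel.commute_acomm_left (h : ReflRel c r) (i j : Fin 4) :
    Commute (acomm r i j) (r i) := by
  rw [Commute, SemiconjBy, acomm, add_mul, mul_add, mul_assoc (r j), h.sq, mul_one,
    ← mul_assoc (r i) (r i), h.sq, one_mul, mul_assoc, add_comm]

theorem ReflRel.commute_acomm_right (h : ReflRel c r) (i j : Fin 4) :
    Commute (acomm r i j) (r j) := by
  rw [acomm_comm]
  exact h.commute_acomm_left j i

/-- The anticommutators are central: up to scalars, the square of `c i • r i + c j • r j`, the
opposite of the sum of the other two terms, is both `acomm r i j` and `acomm r k l`. -/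
theorem ReflRel.commute_acomm (h : ReflRel c r) (hc : ∀ j, c j ≠ 0) (i j k : Fin 4) :
    Commute (acomm r i j) (r k) := by
  by_cases hij : i = j
  · subst hij
    rw [h.acomm_self]
    exact Nat.cast_commute 2 _
  by_cases hik : i = k
  · subst hik
    exact h.commute_acomm_left i j
  by_cases hjk : j = k
  · subst hjk
    exact h.commute_acomm_right i j
  obtain ⟨l, hil, hjl, hkl, -⟩ := exists_fourth hij hik hjk
  have hsum := h.sum
  rw [sum_eq_of_distinct _ hij hik hil hjk hjl hkl] at hsum
  have hX : c i • r i + c j • r j = -(c k • r k + c l • r l) := by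
    rw [eq_neg_iff_add_eq_zero, ← hsum]; abel
  have hsq : ∀ a b : Fin 4, (c a • r a + c b • r b) * (c a • r a + c b • r b) =
      (c a * c b) • acomm r a b + (c a * c a + c b * c b) • 1 := by
    intro a b
    simp only [mul_add, add_mul, smul_mul_smul_comm, h.sq, acomm, smul_add, add_smul,
      mul_comm (c b) (c a)]
    abel
  have h1 : (c i * c j) • acomm r i j = (c k * c l) • acomm r k l +
      (c k * c k + c l * c l - (c i * c i + c j * c j)) • 1 := by
    rw [sub_smul, ← add_sub_assoc, eq_sub_iff_add_eq, ← hsq, ← hsq, hX, neg_mul_neg]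
  have h2 : Commute ((c i * c j) • acomm r i j) (r k) := by
    rw [h1]
    exact ((h.commute_acomm_left k l).smul_left _).add_left ((Commute.one_left _).smul_left _)
  have h3 := h2.smul_left (c i * c j)⁻¹
  rwa [smul_smul, inv_mul_cancel₀ (mul_ne_zero (hc i) (hc j)), one_smul] at h3

/-- The triple products commute with their factors, hence with all the `r x` by the linear
relation. -/
theorem ReflRel.commute_tri (h : ReflRel c r) (hc : ∀ j, c j ≠ 0) (i j k x : Fin 4) :
    Commute (tri r i j k) (r x) := by
  by_cases hij : i = j
  · subst hij
    rw [tri, h.sq, mul_assoc, h.sq, one_mul, mul_one, sub_self]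
    exact Commute.zero_left _
  by_cases hjk : j = k
  · subst hjk
    rw [tri, h.sq, mul_assoc, h.sq, one_mul, mul_one, sub_self]
    exact Commute.zero_left _
  by_cases hik : i = k
  · subst hik
    rw [tri, sub_self]
    exact Commute.zero_left _
  have hs : ∀ a b d : Fin 4, (r a * r b + r b * r a) * r d = r d * (r a * r b + r b * r a) :=
    fun a b d => h.commute_acomm hc a b d
  have hi : Commute (tri r i j k) (r i) := by
    have e : tri r i j k * r i - r i * tri r i j k = r i * ((r j * r k + r k * r j) * r i) -
        r k * r j * (r i * r i) - r i * r i * (r j * r k) := by rw [tri]; noncomm_ring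
    rw [hs j k i, ← mul_assoc, h.sq, one_mul, mul_one, one_mul] at e
    exact sub_eq_zero.1 (by rw [e]; abel)
  have hk : Commute (tri r i j k) (r k) := by
    have e : tri r i j k * r k - r k * tri r i j k = r i * r j * (r k * r k) + 
        r k * r k * (r j * r i) - r k * ((r i * r j + r j * r i) * r k) := by
      rw [tri]; noncomm_ring
    rw [hs i j k, ← mul_assoc (r k) (r k) (_ + _), h.sq, one_mul, mul_one, one_mul, sub_self] at e
    exact sub_eq_zero.1 e
  have hj : Commute (tri r i j k) (r j) := by
    rw [Commute, SemiconjBy, tri]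
    have h1 := h.sq j
    have h2 := hs i j k
    have h3 := hs j k i
    have h4 : r j * r i * r j = (r i * r j + r j * r i) * r j - r i := by
      rw [add_mul, mul_assoc (r i), h1]; noncomm_ring
    have h5 : r j * r k * r j = (r j * r k + r k * r j) * r j - r k := by
      rw [add_mul, mul_assoc (r k), h1]; noncomm_ring
    have h6 := hs i j j
    have h7 := hs j k j
    set s := r i * r j + r j * r i with hsdef
    set t := r j * r k + r k * r j with htdef
    have e1 : r i * r j * r k * r j = r i * (t * r j - r k) := by rw [← h5]; noncomm_ring
    have e2 : r k * r j * r i * r j = r k * (s * r j - r i) := by rw [← h4]; noncomm_ring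
    have e3 : r j * (r i * r j * r k) = (s * r j - r i) * r k := by rw [← h4]; noncomm_ring
    have e4 : r j * (r k * r j * r i) = (t * r j - r k) * r i := by rw [← h5]; noncomm_ring
    rw [sub_mul, mul_sub, e1, e2, e3, e4]
    have f1 : r i * (t * r j) = t * (r i * r j) := by rw [← mul_assoc, ← h3, mul_assoc]
    have f2 : r k * (s * r j) = s * (r k * r j) := by rw [← mul_assoc, ← h2, mul_assoc]
    have f3 : t * (r i * r j) + t * (r j * r i) = s * (r j * r k) + s * (r k * r j) := by
      rw [← mul_add, ← mul_add, ← hsdef, ← htdef]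
      have : Commute t s := (h.commute_acomm hc j k i).mul_right (h.commute_acomm hc j k j) |>.add_right
        ((h.commute_acomm hc j k j).mul_right (h.commute_acomm hc j k i))
      exact this
    rw [mul_sub, mul_sub, sub_mul, sub_mul, f1, f2, mul_assoc s, mul_assoc t]
    have f4 := f3
    rw [← sub_eq_zero] at f3 ⊢
    rw [← f3]
    abel
  obtain ⟨l, hil, hjl, hkl, hx⟩ := exists_fourth hij hik hjk
  rcases hx x with rfl | rfl | rfl | rfl
  · exact hi
  · exact hj
  · exact hk
  · have hsum := h.sum
    rw [sum_eq_of_distinct _ hij hik hil hjk hjl hkl] at hsum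
    have h1 : c x • r x = -(c i • r i + c j • r j + c k • r k) := by
      rw [eq_neg_iff_add_eq_zero, ← hsum]; abel
    have h2 : Commute (tri r i j k) (c x • r x) := by
      rw [h1]
      exact (((hi.smul_right _).add_right (hj.smul_right _)).add_right (hk.smul_right _)).neg_right
    have h3 := h2.smul_right (c x)⁻¹
    rwa [smul_smul, inv_mul_cancel₀ (hc x), one_smul] at h3

/-- The linear combination of the central elements `acomm r i j`, `tri r i j k` with given
coefficients. -/
def centralElt (p : Fin 4 → Fin 4 → ℂ) (q : Fin 4 → Fin 4 → Fin 4 → ℂ) (r : Fin 4 → R) : R :=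
  ∑ i, ∑ j, p i j • acomm r i j + ∑ i, ∑ j, ∑ k, q i j k • tri r i j k

theorem ReflRel.commute_centralElt (h : ReflRel c r) (hc : ∀ j, c j ≠ 0)
    (p : Fin 4 → Fin 4 → ℂ) (q : Fin 4 → Fin 4 → Fin 4 → ℂ) (x : Fin 4) :
    Commute (centralElt p q r) (r x) := by
  refine Commute.add_left ?_ ?_
  · refine Commute.sum_left _ _ _ fun i _ => Commute.sum_left _ _ _ fun j _ => ?_
    exact (h.commute_acomm hc i j x).smul_left _
  · refine Commute.sum_left _ _ _ fun i _ => Commute.sum_left _ _ _ fun j _ =>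
      Commute.sum_left _ _ _ fun k _ => ?_
    exact (h.commute_tri hc i j k x).smul_left _

theorem map_centralElt {R' : Type*} [Ring R'] [Algebra ℂ R'] (f : R →ₐ[ℂ] R')
    (p : Fin 4 → Fin 4 → ℂ) (q : Fin 4 → Fin 4 → Fin 4 → ℂ) (r : Fin 4 → R) :
    f (centralElt p q r) = centralElt p q (fun j => f (r j)) := by
  simp [centralElt, acomm, tri]

end Central
end DSP

/-! ### Equivalence of families of matrices and diagonalization of involutions -/

namespace DSP

open Matrix

/-- Equivalence of families of square matrices, possibly indexed by different types: there is an
invertible matrix `P`, with inverse `Q`, that intertwines them. -/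
def Similar {ι κ : Type*} [Fintype ι] [Fintype κ] [DecidableEq ι] [DecidableEq κ]
    (A : Fin 4 → Matrix ι ι ℂ) (B : Fin 4 → Matrix κ κ ℂ) : Prop :=
  ∃ (P : Matrix ι κ ℂ) (Q : Matrix κ ι ℂ), P * Q = 1 ∧ Q * P = 1 ∧ ∀ j, A j * P = P * B j

section Similar

variable {ι κ τ : Type*} [Fintype ι] [Fintype κ] [Fintype τ] [DecidableEq ι] [DecidableEq κ]
  [DecidableEq τ]

theorem Similar.refl (A : Fin 4 → Matrix ι ι ℂ) : Similar A A :=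
  ⟨1, 1, by simp, by simp, by simp⟩

theorem Similar.symm {A : Fin 4 → Matrix ι ι ℂ} {B : Fin 4 → Matrix κ κ ℂ} (h : Similar A B) :
    Similar B A := by
  obtain ⟨P, Q, h1, h2, h3⟩ := h
  refine ⟨Q, P, h2, h1, fun j => ?_⟩
  calc B j * Q = Q * P * B j * Q := by rw [h2, Matrix.one_mul]
    _ = Q * (P * B j) * Q := by simp only [Matrix.mul_assoc]
    _ = Q * A j * (P * Q) := by rw [← h3]; simp only [Matrix.mul_assoc]
    _ = Q * A j := by rw [h1, Matrix.mul_one]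

theorem Similar.trans {A : Fin 4 → Matrix ι ι ℂ} {B : Fin 4 → Matrix κ κ ℂ}
    {C : Fin 4 → Matrix τ τ ℂ} (h : Similar A B) (h' : Similar B C) : Similar A C := by
  obtain ⟨P, Q, h1, h2, h3⟩ := h
  obtain ⟨P', Q', h1', h2', h3'⟩ := h'
  refine ⟨P * P', Q' * Q, ?_, ?_, fun j => ?_⟩
  · rw [Matrix.mul_assoc, ← Matrix.mul_assoc P', h1', Matrix.one_mul, h1]
  · rw [Matrix.mul_assoc, ← Matrix.mul_assoc Q, h2, Matrix.one_mul, h2']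
  · rw [← Matrix.mul_assoc, h3, Matrix.mul_assoc, h3', Matrix.mul_assoc]

theorem Similar.eq_mul {ι κ : Type*} [Fintype ι] [Fintype κ] [DecidableEq ι]
    {A : Fin 4 → Matrix ι ι ℂ} {B : Fin 4 → Matrix κ κ ℂ}
    {P : Matrix ι κ ℂ} {Q : Matrix κ ι ℂ} (h1 : P * Q = 1) (h3 : ∀ j, A j * P = P * B j)
    (j : Fin 4) : A j = P * B j * Q := by
  rw [← h3, Matrix.mul_assoc, h1, Matrix.mul_one]

theorem Similar.transpose {A : Fin 4 → Matrix ι ι ℂ} {B : Fin 4 → Matrix κ κ ℂ}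
    (h : Similar A B) : Similar (fun j => (A j)ᵀ) (fun j => (B j)ᵀ) := by
  obtain ⟨P, Q, h1, h2, h3⟩ := h.symm
  refine ⟨Pᵀ, Qᵀ, ?_, ?_, fun j => ?_⟩
  · rw [← Matrix.transpose_mul, h2, Matrix.transpose_one]
  · rw [← Matrix.transpose_mul, h1, Matrix.transpose_one]
  · rw [← Matrix.transpose_mul, ← h3, Matrix.transpose_mul]

theorem Similar.trace_eq {A : Fin 4 → Matrix ι ι ℂ} {B : Fin 4 → Matrix κ κ ℂ} (h : Similar A B)
    (j : Fin 4) : (A j).trace = (B j).trace := by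
  obtain ⟨P, Q, h1, h2, h3⟩ := h
  rw [Similar.eq_mul h1 h3, Matrix.trace_mul_comm, ← Matrix.mul_assoc, h2, Matrix.one_mul]

theorem Similar.reindex (A : Fin 4 → Matrix ι ι ℂ) (e : ι ≃ κ) :
    Similar A (fun j => Matrix.reindex e e (A j)) := by
  refine ⟨(1 : Matrix ι ι ℂ).submatrix id e.symm, (1 : Matrix ι ι ℂ).submatrix e.symm id,
    ?_, ?_, fun j => ?_⟩
  · rw [← Matrix.submatrix_mul _ _ _ _ _ e.symm.bijective]; simp
  · rw [← Matrix.submatrix_mul _ _ _ _ _ Function.bijective_id]; simp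
  · have h1 : A j * (1 : Matrix ι ι ℂ).submatrix id e.symm = (A j).submatrix id e.symm := by
      rw [← (A j).submatrix_id_id, Matrix.submatrix_submatrix,
        ← Matrix.submatrix_mul _ _ _ _ _ Function.bijective_id, Matrix.mul_one]
      rfl
    have h2 : (1 : Matrix ι ι ℂ).submatrix id e.symm * (A j).submatrix e.symm e.symm =
        (A j).submatrix id e.symm := by
      rw [← Matrix.submatrix_mul _ _ _ _ _ e.symm.bijective, Matrix.one_mul]
    rw [h1, ← h2]
    rfl

/-- Conjugation by an invertible, possibly rectangular, matrix as an algebra isomorphism. -/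
def conjAlg (P : Matrix ι κ ℂ) (Q : Matrix κ ι ℂ) (h1 : P * Q = 1) (h2 : Q * P = 1) :
    Matrix κ κ ℂ ≃ₐ[ℂ] Matrix ι ι ℂ :=
  AlgEquiv.ofAlgHom
    (AlgHom.ofLinearMap
      { toFun := fun B => P * B * Q
        map_add' := fun x y => by rw [Matrix.mul_add, Matrix.add_mul]
        map_smul' := fun x y => by simp } (by simp [h1])
      (fun x y => by
        change P * (x * y) * Q = P * x * Q * (P * y * Q)
        rw [show P * x * Q * (P * y * Q) = P * x * (Q * P) * y * Q by
          simp only [Matrix.mul_assoc], h2, Matrix.mul_one]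
        simp only [Matrix.mul_assoc]))
    (AlgHom.ofLinearMap
      { toFun := fun B => Q * B * P
        map_add' := fun x y => by rw [Matrix.mul_add, Matrix.add_mul]
        map_smul' := fun x y => by simp } (by simp [h2])
      (fun x y => by
        change Q * (x * y) * P = Q * x * P * (Q * y * P)
        rw [show Q * x * P * (Q * y * P) = Q * x * (P * Q) * y * P by
          simp only [Matrix.mul_assoc], h1, Matrix.mul_one]
        simp only [Matrix.mul_assoc]))
    (by
      ext1 x
      change P * (Q * x * P) * Q = x
      rw [show P * (Q * x * P) * Q = (P * Q) * x * (P * Q) by simp only [Matrix.mul_assoc], h1,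
        Matrix.one_mul, Matrix.mul_one])
    (by
      ext1 x
      change Q * (P * x * Q) * P = x
      rw [show Q * (P * x * Q) * P = (Q * P) * x * (Q * P) by simp only [Matrix.mul_assoc], h2,
        Matrix.one_mul, Matrix.mul_one])

theorem conjAlg_apply (P : Matrix ι κ ℂ) (Q : Matrix κ ι ℂ) (h1 : P * Q = 1) (h2 : Q * P = 1)
    (B : Matrix κ κ ℂ) : conjAlg P Q h1 h2 B = P * B * Q := rfl

theorem Similar.exists_algEquiv {A : Fin 4 → Matrix ι ι ℂ} {B : Fin 4 → Matrix κ κ ℂ}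
    (h : Similar A B) : ∃ f : Matrix κ κ ℂ ≃ₐ[ℂ] Matrix ι ι ℂ, ∀ j, f (B j) = A j := by
  obtain ⟨P, Q, h1, h2, h3⟩ := h
  exact ⟨conjAlg P Q h1 h2, fun j => by rw [conjAlg_apply, ← Similar.eq_mul h1 h3]⟩

theorem Similar.reflRel {c : Fin 4 → ℂ} {A : Fin 4 → Matrix ι ι ℂ} {B : Fin 4 → Matrix κ κ ℂ}
    (h : Similar A B) (hB : ReflRel c B) : ReflRel c A := by
  obtain ⟨f, hf⟩ := h.exists_algEquiv
  rw [← funext hf]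
  exact hB.map f.toAlgHom

/-- Only scalar matrices commute with all the matrices of the family. -/
def Brick (r : Fin 4 → Matrix ι ι ℂ) : Prop :=
  ∀ Z : Matrix ι ι ℂ, (∀ j, Commute Z (r j)) → ∃ a : ℂ, Z = a • 1

theorem Similar.brick {A : Fin 4 → Matrix ι ι ℂ} {B : Fin 4 → Matrix κ κ ℂ} (h : Similar A B)
    (hB : Brick B) : Brick A := by
  obtain ⟨f, hf⟩ := h.exists_algEquiv
  intro Z hZ
  obtain ⟨a, ha⟩ := hB (f.symm Z) (fun j => by
    have := (hZ j).map f.symm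
    rwa [← hf, f.symm_apply_apply] at this)
  refine ⟨a, ?_⟩
  rw [← f.apply_symm_apply Z, ha, map_smul, map_one]

theorem Brick.transpose {r : Fin 4 → Matrix ι ι ℂ} (h : Brick r) : Brick fun j => (r j)ᵀ := by
  intro Z hZ
  obtain ⟨a, ha⟩ := h Zᵀ (fun j => by
    have := congrArg Matrix.transpose (hZ j).eq
    rw [Matrix.transpose_mul, Matrix.transpose_mul, Matrix.transpose_transpose] at this
    exact this.symm)
  exact ⟨a, by rw [← Matrix.transpose_transpose Z, ha]; simp⟩

theorem ReflRel.transpose {c : Fin 4 → ℂ} {r : Fin 4 → Matrix ι ι ℂ} (h : ReflRel c r) :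
    ReflRel c fun j => (r j)ᵀ := by
  refine ⟨fun j => by rw [← Matrix.transpose_mul, h.sq, Matrix.transpose_one], ?_⟩
  have := congrArg Matrix.transpose h.sum
  rw [Matrix.transpose_sum] at this
  simpa using this

/-- A matrix whose eigenvectors span the space is diagonalizable. -/
theorem exists_diagonalization (M : Matrix ι ι ℂ)
    (h : Submodule.span ℂ {v : ι → ℂ | ∃ a : ℂ, M *ᵥ v = a • v} = ⊤) :
    ∃ (P Q : Matrix ι ι ℂ) (d : ι → ℂ), P * Q = 1 ∧ Q * P = 1 ∧ M * P = P * diagonal d := by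
  let b := Module.Basis.ofSpan h.ge
  have hcard : Module.finrank ℂ (ι → ℂ) = Fintype.card ι := by simp
  have := Module.Finite.finite_basis b
  have := Fintype.ofFinite
    ↑((linearIndepOn_empty ℂ id).extend (Set.empty_subset {v : ι → ℂ | ∃ a : ℂ, M *ᵥ v = a • v}))
  have hc : Fintype.card
      ↑((linearIndepOn_empty ℂ id).extend (Set.empty_subset {v : ι → ℂ | ∃ a : ℂ, M *ᵥ v = a • v}))
      = Fintype.card ι := by
    rw [← hcard, Module.finrank_eq_card_basis b]
  let b' := b.reindex (Fintype.equivOfCardEq hc)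
  have hb : ∀ i, ∃ a : ℂ, M *ᵥ b' i = a • b' i := by
    intro i
    have h1 : b' i ∈ Set.range b := by
      simp only [b', Module.Basis.reindex_apply]
      exact ⟨_, rfl⟩
    exact Module.Basis.ofSpan_subset h.ge h1
  choose d hd using hb
  have h2 : b'.toMatrix (Pi.basisFun ℂ ι) * (Pi.basisFun ℂ ι).toMatrix b' = 1 :=
    b'.toMatrix_mul_toMatrix_flip _
  have h1 : (Pi.basisFun ℂ ι).toMatrix b' * b'.toMatrix (Pi.basisFun ℂ ι) = 1 :=
    (Pi.basisFun ℂ ι).toMatrix_mul_toMatrix_flip b'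
  refine ⟨_, _, d, h1, h2, ?_⟩
  ext i j
  have := congrFun (hd j) i
  simp only [Matrix.mulVec, dotProduct, Pi.smul_apply, smul_eq_mul] at this
  rw [Matrix.mul_diagonal, Matrix.mul_apply]
  simp only [Module.Basis.toMatrix_apply, Pi.basisFun_repr]
  rw [this, mul_comm]

/-- An involution is diagonalizable with eigenvalues `1` and `-1`. -/
theorem exists_diagonalization_of_sq_eq_one {M : Matrix ι ι ℂ} (h : M * M = 1) :
    ∃ (P Q : Matrix ι ι ℂ) (d : ι → ℂ), P * Q = 1 ∧ Q * P = 1 ∧ M * P = P * diagonal d ∧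
      ∀ i, d i = 1 ∨ d i = -1 := by
  obtain ⟨P, Q, d, h1, h2, h3⟩ := exists_diagonalization M (by
    rw [eq_top_iff]
    intro v _
    have e : v = (2⁻¹ : ℂ) • (v + M *ᵥ v) + (2⁻¹ : ℂ) • (v - M *ᵥ v) := by
      rw [← smul_add]
      have : v + M *ᵥ v + (v - M *ᵥ v) = (2 : ℂ) • v := by rw [two_smul]; abel
      rw [this, smul_smul]
      norm_num
    rw [e]
    refine Submodule.add_mem _ (Submodule.smul_mem _ _ (Submodule.subset_span ⟨1, ?_⟩))
      (Submodule.smul_mem _ _ (Submodule.subset_span ⟨-1, ?_⟩))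
    · rw [Matrix.mulVec_add, Matrix.mulVec_mulVec, h, Matrix.one_mulVec, one_smul, add_comm]
    · rw [Matrix.mulVec_sub, Matrix.mulVec_mulVec, h, Matrix.one_mulVec, neg_smul, one_smul,
        neg_sub])
  refine ⟨P, Q, d, h1, h2, h3, fun i => ?_⟩
  have e : diagonal d * diagonal d = 1 := by
    have hd : diagonal d = Q * M * P := by
      rw [Matrix.mul_assoc, h3, ← Matrix.mul_assoc, h2, Matrix.one_mul]
    rw [hd, show Q * M * P * (Q * M * P) = Q * M * (P * Q) * M * P by
      simp only [Matrix.mul_assoc], h1, Matrix.mul_one, Matrix.mul_assoc Q, h, Matrix.mul_one, h2]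
  rw [Matrix.diagonal_mul_diagonal] at e
  have := congrFun (congrFun e i) i
  simp only [Matrix.diagonal_apply_eq, Matrix.one_apply_eq] at this
  exact mul_self_eq_one_iff.1 this

/-- An involution with eigenvalue `-1` of multiplicity `p` and eigenvalue `1` of multiplicity
`q` in block form. -/
theorem exists_block_form_of_sq_eq_one {M : Matrix ι ι ℂ} (h : M * M = 1) {p q : ℕ}
    (hcard : Fintype.card ι = p + q) (htr : M.trace = (q : ℂ) - p) :
    ∃ (P : Matrix ι (Fin p ⊕ Fin q) ℂ) (Q : Matrix (Fin p ⊕ Fin q) ι ℂ), P * Q = 1 ∧ Q * P = 1 ∧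
      M * P = P * (fromBlocks (-1) 0 0 1 : Matrix (Fin p ⊕ Fin q) (Fin p ⊕ Fin q) ℂ) := by
  obtain ⟨P, Q, d, h1, h2, h3, hd⟩ := exists_diagonalization_of_sq_eq_one h
  have hne : (1 : ℂ) ≠ -1 := by norm_num
  have ht : M.trace = ∑ i, d i := by
    have : M = P * diagonal d * Q := by rw [← h3, Matrix.mul_assoc, h1, Matrix.mul_one]
    rw [this, Matrix.trace_mul_comm, ← Matrix.mul_assoc, h2, Matrix.one_mul, Matrix.trace_diagonal]
  have hs : ∑ i, d i = (Fintype.card {i // ¬ d i = -1} : ℂ) - Fintype.card {i // d i = -1} := by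
    rw [Fintype.card_subtype, Fintype.card_subtype, Finset.card_eq_sum_ones, Finset.card_eq_sum_ones,
      Finset.sum_filter, Finset.sum_filter]
    push_cast
    rw [← Finset.sum_sub_distrib]
    refine Finset.sum_congr rfl fun i _ => ?_
    rcases hd i with h | h <;> simp [h, hne]
  have hc : Fintype.card {i // d i = -1} + Fintype.card {i // ¬ d i = -1} = p + q := by
    rw [← hcard]
    exact (Fintype.card_congr (Equiv.sumCompl fun i => d i = -1)).symm ▸ (Fintype.card_sum).symm
  rw [ht, hs] at htr
  have hc' : ((Fintype.card {i // d i = -1} : ℕ) : ℂ) + (Fintype.card {i // ¬ d i = -1} : ℕ)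
    = p + q := by exact_mod_cast hc
  have hp : Fintype.card {i // d i = -1} = Fintype.card (Fin p) := by
    rw [Fintype.card_fin]
    have : ((Fintype.card {i // d i = -1} : ℕ) : ℂ) = p := by linear_combination (hc' - htr) / 2
    exact_mod_cast this
  have hq : Fintype.card {i // ¬ d i = -1} = Fintype.card (Fin q) := by
    rw [Fintype.card_fin] at hp ⊢
    omega
  let e : Fin p ⊕ Fin q ≃ ι := (Equiv.sumCongr (Fintype.equivOfCardEq hp.symm)
    (Fintype.equivOfCardEq hq.symm)).trans (Equiv.sumCompl fun i => d i = -1)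
  refine ⟨P.submatrix id e, Q.submatrix e id, ?_, ?_, ?_⟩
  · rw [← Matrix.submatrix_mul _ _ _ _ _ e.bijective, h1]; simp
  · rw [← Matrix.submatrix_mul _ _ _ _ _ Function.bijective_id, h2]; simp
  · have hdiag : (fromBlocks (-1) 0 0 1 : Matrix (Fin p ⊕ Fin q) (Fin p ⊕ Fin q) ℂ) =
        diagonal (fun x => d (e x)) := by
      rw [show (-1 : Matrix (Fin p) (Fin p) ℂ) = diagonal (fun _ => -1) by
        ext a b; by_cases h : a = b <;> simp [h], ← Matrix.diagonal_one,
        Matrix.fromBlocks_diagonal]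
      congr 1
      ext x
      rcases x with x | x
      · simpa [e] using (Subtype.prop (Fintype.equivOfCardEq hp.symm x)).symm
      · have := (hd (e (Sum.inr x))).resolve_right (by
          simpa [e] using (Subtype.prop (Fintype.equivOfCardEq hq.symm x)))
        simpa using this.symm
    rw [hdiag, ← Function.comp_def d e, ← Matrix.submatrix_diagonal_equiv,
      Matrix.submatrix_mul_equiv, ← h3, ← Matrix.submatrix_mul_equiv _ _ _ (Equiv.refl ι)]
    rfl

end Similar
end DSP

/-! ### Normal form of two-dimensional families, and Schur's lemma -/

namespace DSP

open Matrix

section CliffordIdentities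

variable {R : Type*} [Ring R] [Algebra ℂ R] {a b d : R} {s y v w : ℂ}

theorem commutator_sq (ha : a * a = 1) (hb : b * b = 1) (hab : a * b + b * a = (2 * s) • 1) :
    (a * b - b * a) * (a * b - b * a) = (4 * (s ^ 2 - 1)) • 1 := by
  have e : (a * b - b * a) * (a * b - b * a) = (a * b + b * a) * (a * b + b * a) -
      2 * (a * (b * b) * a) - 2 * (b * (a * a) * b) := by noncomm_ring
  rw [e, hab, ha, hb, mul_one, mul_one, ha, hb, smul_mul_smul_comm, mul_one, mul_one,
    show (2 : R) = (2 : ℂ) • 1 by rw [two_smul, one_add_one_eq_two], ← sub_smul, ← sub_smul]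
  congr 1
  ring

theorem mul_commutator {R : Type*} [Ring R] {a b : R} (ha : a * a = 1) :
    a * (a * b - b * a) = -((a * b - b * a) * a) := by
  have e : a * (a * b - b * a) + (a * b - b * a) * a = a * a * b - b * (a * a) := by noncomm_ring
  rw [ha, one_mul, mul_one, sub_self] at e
  exact eq_neg_of_add_eq_zero_left e

theorem eq_smul_add_smul_mul_commutator (ha : a * a = 1) (hab : a * b + b * a = (2 * s) • 1) :
    b = s • a + (2⁻¹ : ℂ) • (a * (a * b - b * a)) := by
  have e : a * (a * b - b * a) = a * a * b + a * a * b - a * (a * b + b * a) := by noncomm_ring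
  rw [e, ha, hab, one_mul, mul_smul_comm, mul_one, ← two_smul ℂ b, smul_sub, smul_smul, smul_smul,
    inv_mul_cancel₀ two_ne_zero, inv_mul_cancel_left₀ two_ne_zero, one_smul, add_sub_cancel]

theorem commutator_mul (hab : a * d + d * a = (2 * y) • 1)
    (hbd : b * d + d * b = (2 * v) • 1) (hw : a * b * d - d * b * a = w • 1) :
    (a * b - b * a) * d = w • 1 + (2 * v) • a - (2 * y) • b := by
  have e : (a * b - b * a) * d = (a * b * d - d * b * a) + (b * d + d * b) * a -
      b * (a * d + d * a) := by noncomm_ring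
  rw [e, hw, hbd, hab, smul_mul_assoc, one_mul, mul_smul_comm, mul_one]

end CliffordIdentities

/-- The central elements act on the family `r` by the scalars `2 * s i j` and `w i j k`. -/
structure HasChar {ι : Type*} [Fintype ι] [DecidableEq ι] (r : Fin 4 → Matrix ι ι ℂ)
    (s : Fin 4 → Fin 4 → ℂ) (w : Fin 4 → Fin 4 → Fin 4 → ℂ) : Prop where
  acomm_eq : ∀ i j, acomm r i j = (2 * s i j) • (1 : Matrix ι ι ℂ)
  tri_eq : ∀ i j k, tri r i j k = w i j k • (1 : Matrix ι ι ℂ)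

/-- The columns `u` and `u'` as a matrix. -/
def twoCols {ι : Type*} (u u' : ι → ℂ) : Matrix ι (Fin 2) ℂ := (Matrix.of ![u, u'])ᵀ

/-- The rows `u` and `u'` as a matrix. -/
def twoRows {ι : Type*} (u u' : ι → ℂ) : Matrix (Fin 2) ι ℂ := Matrix.of ![u, u']

section TwoDim

variable {ι κ : Type*} [Fintype ι] [DecidableEq ι] [Fintype κ] [DecidableEq κ]

theorem mul_twoCols {ι : Type*} [Fintype ι] {M : Matrix ι ι ℂ} {u u' : ι → ℂ} {α β γ δ : ℂ}
    (h : M *ᵥ u = α • u + β • u') (h' : M *ᵥ u' = γ • u + δ • u') :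
    M * twoCols u u' = twoCols u u' * !![α, γ; β, δ] := by
  ext x y
  fin_cases y
  · have := congrFun h x
    simp only [Matrix.mulVec, dotProduct] at this
    simp [twoCols, Matrix.mul_apply, this, mul_comm]
  · have := congrFun h' x
    simp only [Matrix.mulVec, dotProduct] at this
    simp [twoCols, Matrix.mul_apply, this, mul_comm]

theorem twoRows_mul {ι : Type*} [Fintype ι] {M : Matrix ι ι ℂ} {u u' : ι → ℂ} {α β γ δ : ℂ}
    (h : u ᵥ* M = α • u + γ • u') (h' : u' ᵥ* M = β • u + δ • u') :
    twoRows u u' * M = !![α, γ; β, δ] * twoRows u u' := by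
  ext x y
  fin_cases x
  · have := congrFun h y
    simp only [Matrix.vecMul, dotProduct] at this
    simp [twoRows, Matrix.mul_apply, this]
  · have := congrFun h' y
    simp only [Matrix.vecMul, dotProduct] at this
    simp [twoRows, Matrix.mul_apply, this]

variable {c : Fin 4 → ℂ} {r : Fin 4 → Matrix ι ι ℂ} {s : Fin 4 → Fin 4 → ℂ}
  {w : Fin 4 → Fin 4 → Fin 4 → ℂ}

theorem smul_one_injective {ι : Type*} [DecidableEq ι] [Nonempty ι] {a b : ℂ}
    (h : a • (1 : Matrix ι ι ℂ) = b • (1 : Matrix ι ι ℂ)) : a = b := by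
  obtain ⟨x⟩ := ‹Nonempty ι›
  simpa using congrFun (congrFun h x) x

theorem Brick.exists_hasChar (hb : Brick r) (h : ReflRel c r) (hc : ∀ j, c j ≠ 0) :
    ∃ s w, HasChar r s w := by
  have h1 := fun i j => hb (acomm r i j) (fun k => h.commute_acomm hc i j k)
  have h2 := fun i j k => hb (tri r i j k) (fun x => h.commute_tri hc i j k x)
  choose s hs using h1
  choose w hw using h2
  refine ⟨fun i j => s i j / 2, w, fun i j => ?_, hw⟩
  rw [hs, mul_div_cancel₀ _ two_ne_zero]

theorem HasChar.self_eq_one [Nonempty ι] (hχ : HasChar r s w) (h : ReflRel c r) (i : Fin 4) :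
    s i i = 1 := by
  have := hχ.acomm_eq i i
  rw [h.acomm_self, show (2 : Matrix ι ι ℂ) = (2 : ℂ) • 1 by
    rw [two_smul, one_add_one_eq_two]] at this
  have := smul_one_injective this
  linear_combination -this / 2

theorem HasChar.symm [Nonempty ι] (hχ : HasChar r s w) (i j : Fin 4) : s i j = s j i := by
  have h1 := hχ.acomm_eq i j
  rw [acomm_comm, hχ.acomm_eq] at h1
  have := smul_one_injective h1
  linear_combination -this / 2

theorem HasChar.sum_eq_zero [Nonempty ι] (hχ : HasChar r s w) (h : ReflRel c r) (i : Fin 4) :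
    ∑ j, c j * s i j = 0 := by
  have h1 : ∑ j, c j • acomm r i j = 0 := by
    have : ∑ j, c j • acomm r i j = r i * ∑ j, c j • r j + (∑ j, c j • r j) * r i := by
      simp only [acomm, Finset.mul_sum, Finset.sum_mul, smul_add, Finset.sum_add_distrib,
        mul_smul_comm, smul_mul_assoc]
    rw [this, h.sum, mul_zero, zero_mul, add_zero]
  simp only [hχ.acomm_eq, smul_smul, ← Finset.sum_smul] at h1
  have h2 : (∑ j, c j * (2 * s i j)) = 0 := by
    refine smul_one_injective (ι := ι) ?_
    rw [h1, zero_smul]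
  have h3 : (∑ j, c j * (2 * s i j)) = 2 * ∑ j, c j * s i j := by
    rw [Finset.mul_sum]
    exact Finset.sum_congr rfl fun j _ => by ring
  rw [h3] at h2
  simpa using h2

/-- If all anticommutators are `2` or `-2`, they are all `2`: the signs in the relation obtained by
taking anticommutators with `r i` cannot vary, by genericity. -/
theorem HasChar.dichotomy [Nonempty ι] (hχ : HasChar r s w) (h : ReflRel c r) (hc : NoSubsum c) :
    (∀ i j, s i j = 1) ∨ ∃ i j, s i j ^ 2 ≠ 1 := by
  by_cases hs : ∃ i j, s i j ^ 2 ≠ 1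
  · exact Or.inr hs
  push Not at hs
  left
  intro i
  have h1 := hχ.sum_eq_zero h i
  have h2 : ∑ j with s i j = 1, c j = 0 := by
    have : ∑ j, c j * s i j + ∑ j, c j = 2 * ∑ j with s i j = 1, c j := by
      rw [Finset.sum_filter, ← Finset.sum_add_distrib, Finset.mul_sum]
      refine Finset.sum_congr rfl fun j _ => ?_
      rcases sq_eq_one_iff.1 (hs i j) with e | e
      · simp [e]; ring
      · rw [e, if_neg (by norm_num)]; ring
    rw [h1, hc.1, add_zero] at this
    simpa using this.symm
  rcases hc.2 _ h2 with e | e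
  · have : i ∈ (Finset.univ.filter fun j => s i j = 1) := by simp [hχ.self_eq_one h i]
    rw [e] at this
    simp at this
  · intro j
    have : j ∈ (Finset.univ.filter fun j => s i j = 1) := by rw [e]; simp
    simpa using this

/-- The two-dimensional family with the given values of the central elements, in a basis adapted to
the member of index `i` and its commutator with the one of index `j`. -/
noncomputable def normalForm (c : Fin 4 → ℂ) (s : Fin 4 → Fin 4 → ℂ)
    (w : Fin 4 → Fin 4 → Fin 4 → ℂ) (i j k : Fin 4) : Fin 4 → Matrix (Fin 2) (Fin 2) ℂ :=
  let a : Matrix (Fin 2) (Fin 2) ℂ := !![1, 0; 0, -1]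
  let K : Matrix (Fin 2) (Fin 2) ℂ := !![0, 4 * (s i j ^ 2 - 1); 1, 0]
  let b := s i j • a + (2⁻¹ : ℂ) • (a * K)
  let d := (4 * (s i j ^ 2 - 1))⁻¹ • (K * (w i j k • 1 + (2 * s j k) • a - (2 * s i k) • b))
  fun x => if x = i then a else if x = j then b else if x = k then d else
    -(c x)⁻¹ • (c i • a + c j • b + c k • d)

theorem trace_normalForm (c : Fin 4 → ℂ) (s : Fin 4 → Fin 4 → ℂ)
    (w : Fin 4 → Fin 4 → Fin 4 → ℂ) (i j k x : Fin 4) : (normalForm c s w i j k x).trace = 0 := by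
  simp only [normalForm]
  split_ifs
  · simp [Matrix.trace_fin_two]
  · simp [Matrix.trace_fin_two]
  · simp [Matrix.trace_fin_two, Matrix.one_fin_two]
    ring
  · simp [Matrix.trace_fin_two, Matrix.one_fin_two]
    ring

theorem exists_eigenvector_one {M : Matrix ι ι ℂ} (h : M * M = 1) (hM : M ≠ -1) :
    ∃ u : ι → ℂ, u ≠ 0 ∧ M *ᵥ u = u := by
  by_contra! H
  refine hM (Matrix.ext_of_mulVec_single fun x => ?_)
  generalize (Pi.single x 1 : ι → ℂ) = v
  have h1 : M *ᵥ (v + M *ᵥ v) = v + M *ᵥ v := by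
    rw [Matrix.mulVec_add, Matrix.mulVec_mulVec, h, Matrix.one_mulVec, add_comm]
  have h2 : v + M *ᵥ v = 0 := by
    by_contra h3
    exact H _ h3 h1
  rw [Matrix.neg_mulVec, Matrix.one_mulVec]
  exact (neg_eq_of_add_eq_zero_right h2).symm

/-- A family with trivial centralizer, or of size two, for which some anticommutator is not `± 2` is
determined by the values of the central elements. -/
theorem HasChar.similar_normalForm (hχ : HasChar r s w) (h : ReflRel c r) (hc : ∀ j, c j ≠ 0)
    (hb : Brick r ∨ Fintype.card ι = 2) [Nonempty ι] {i j k : Fin 4}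
    (hij : i ≠ j) (hik : i ≠ k) (hjk : j ≠ k) (hs : s i j ^ 2 ≠ 1) :
    Similar r (normalForm c s w i j k) := by
  obtain ⟨l, hil, hjl, hkl, hx⟩ := exists_fourth hij hik hjk
  set κ : ℂ := 4 * (s i j ^ 2 - 1) with hκ
  have hκ0 : κ ≠ 0 := mul_ne_zero (by norm_num) (sub_ne_zero.2 hs)
  set a := r i with ha
  set b := r j with hb'
  set d := r k with hd
  set K := a * b - b * a with hK
  have haa : a * a = 1 := h.sq i
  have hbb : b * b = 1 := h.sq j
  have hab : a * b + b * a = (2 * s i j) • 1 := hχ.acomm_eq i j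
  have hKK : K * K = κ • 1 := commutator_sq haa hbb hab
  have haK : a * K = -(K * a) := mul_commutator haa
  have hbK : b = s i j • a + (2⁻¹ : ℂ) • (a * K) := eq_smul_add_smul_mul_commutator haa hab
  have hdK : d = κ⁻¹ • (K * (w i j k • 1 + (2 * s j k) • a - (2 * s i k) • b)) := by
    rw [← commutator_mul (hχ.acomm_eq i k) (hχ.acomm_eq j k) (hχ.tri_eq i j k), ← mul_assoc, hKK,
      smul_mul_assoc, one_mul, smul_smul, inv_mul_cancel₀ hκ0, one_smul]
  have hl : r l = -(c l)⁻¹ • (c i • a + c j • b + c k • d) := by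
    have hsum := h.sum
    rw [sum_eq_of_distinct _ hij hik hil hjk hjl hkl] at hsum
    rw [eq_neg_of_add_eq_zero_left hsum, neg_smul_neg, smul_smul, inv_mul_cancel₀ (hc l), one_smul]
  obtain ⟨u, hu0, hu⟩ := exists_eigenvector_one haa (by
    intro e
    rw [e] at hK
    have : K = 0 := by rw [hK]; noncomm_ring
    rw [this, zero_mul] at hKK
    exact hκ0 (smul_one_injective (ι := ι) (by rw [← hKK, zero_smul])))
  clear_value K
  obtain ⟨x, hxu⟩ := Function.ne_iff.1 hu0
  have hxu : u x ≠ 0 := hxu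
  -- a functional on the `1`-eigenspace of `a` with value `1` at `u`
  let f : ι → ℂ := (2 * u x)⁻¹ • (Pi.single x 1 ᵥ* (1 + a))
  have hfa : f ᵥ* a = f := by
    simp only [f, Matrix.smul_vecMul, Matrix.vecMul_vecMul, add_mul, haa, one_mul]
    rw [add_comm]
  have hfu : f ⬝ᵥ u = 1 := by
    simp only [f, smul_dotProduct, ← Matrix.dotProduct_mulVec, Matrix.add_mulVec, hu,
      Matrix.one_mulVec]
    simp
    field_simp
    norm_num
  have hKu : a *ᵥ (K *ᵥ u) = -(K *ᵥ u) := by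
    rw [Matrix.mulVec_mulVec, haK, Matrix.neg_mulVec, ← Matrix.mulVec_mulVec, hu]
  have hfK : (f ᵥ* K) ᵥ* a = -(f ᵥ* K) := by
    have : K * a = -(a * K) := by rw [haK, neg_neg]
    rw [Matrix.vecMul_vecMul, this, Matrix.vecMul_neg, ← Matrix.vecMul_vecMul, hfa]
  have hfKu : f ⬝ᵥ (K *ᵥ u) = 0 := by
    have h1 : f ⬝ᵥ (K *ᵥ u) = -(f ⬝ᵥ (K *ᵥ u)) := by
      conv_lhs => rw [← hfa, ← Matrix.dotProduct_mulVec, hKu, dotProduct_neg]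
    exact self_eq_neg.1 h1
  let P := twoCols u (K *ᵥ u)
  let Q := twoRows f (κ⁻¹ • (f ᵥ* K))
  have hQP : Q * P = 1 := by
    have e1 : ∀ x y : ι → ℂ, ∀ x' y' : ι → ℂ, twoRows x y * twoCols x' y' =
        !![x ⬝ᵥ x', x ⬝ᵥ y'; y ⬝ᵥ x', y ⬝ᵥ y'] := by
      intro x y x' y'
      ext p q
      fin_cases p <;> fin_cases q <;> simp [twoRows, twoCols, Matrix.mul_apply, dotProduct]
    simp only [P, Q]
    rw [e1, hfu, hfKu, smul_dotProduct, smul_dotProduct, ← Matrix.dotProduct_mulVec, hfKu,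
      ← Matrix.dotProduct_mulVec, Matrix.mulVec_mulVec, hKK, Matrix.smul_mulVec, Matrix.one_mulVec,
      dotProduct_smul, hfu, smul_zero, smul_eq_mul, smul_eq_mul, mul_one, inv_mul_cancel₀ hκ0,
      Matrix.one_fin_two]
  have haP : a * P = P * (!![1, 0; 0, -1] : Matrix (Fin 2) (Fin 2) ℂ) :=
    mul_twoCols (by simpa using hu) (by simpa using hKu)
  have hKP : K * P = P * (!![0, κ; 1, 0] : Matrix (Fin 2) (Fin 2) ℂ) :=
    mul_twoCols (by simp) (by
      rw [Matrix.mulVec_mulVec, hKK, Matrix.smul_mulVec, Matrix.one_mulVec]; simp)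
  have hQa : Q * a = (!![1, 0; 0, -1] : Matrix (Fin 2) (Fin 2) ℂ) * Q :=
    twoRows_mul (by simpa using hfa) (by simp [Matrix.smul_vecMul, hfK])
  have hQK : Q * K = (!![0, κ; 1, 0] : Matrix (Fin 2) (Fin 2) ℂ) * Q :=
    twoRows_mul (by simp [smul_smul, mul_inv_cancel₀ hκ0]) (by
      rw [Matrix.smul_vecMul, Matrix.vecMul_vecMul, hKK, Matrix.vecMul_smul, smul_smul,
        inv_mul_cancel₀ hκ0]
      simp)
  have hPQ : P * Q = 1 := by
    rcases hb with hb | hb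
    · have hca : Commute (P * Q) a := by
        rw [Commute, SemiconjBy, Matrix.mul_assoc, hQa, ← Matrix.mul_assoc, ← haP,
          Matrix.mul_assoc]
      have hcK : Commute (P * Q) K := by
        rw [Commute, SemiconjBy, Matrix.mul_assoc, hQK, ← Matrix.mul_assoc, ← hKP,
          Matrix.mul_assoc]
      have hcb : Commute (P * Q) b := by
        rw [hbK]
        exact (hca.smul_right _).add_right ((hca.mul_right hcK).smul_right _)
      have hcd : Commute (P * Q) d := by
        rw [hdK]
        exact (hcK.mul_right ((((Commute.one_right _).smul_right _).add_right
          (hca.smul_right _)).sub_right (hcb.smul_right _))).smul_right _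
      obtain ⟨t, ht⟩ := hb (P * Q) (fun y => by
        rcases hx y with rfl | rfl | rfl | rfl
        · exact hca
        · exact hcb
        · exact hcd
        · rw [hl]
          exact (((hca.smul_right _).add_right (hcb.smul_right _)).add_right
            (hcd.smul_right _)).smul_right _)
      have h1 : t • P = P := by
        calc t • P = (t • (1 : Matrix ι ι ℂ)) * P := by rw [Matrix.smul_mul, Matrix.one_mul]
          _ = P := by rw [← ht, Matrix.mul_assoc, hQP, Matrix.mul_one]
      have h2 : t = 1 := by
        have := congrFun (congrFun h1 x) 0
        simp only [P, twoCols, Matrix.smul_apply, Matrix.transpose_apply, Matrix.of_apply,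
          Matrix.cons_val_zero, smul_eq_mul] at this
        exact mul_right_cancel₀ hxu (by rw [this, one_mul])
      rw [ht, h2, one_smul]
    · exact (Matrix.mul_eq_one_comm_of_card_eq _ _ _ (by simpa using hb.symm)).1 hQP
  have hbP : b * P = P * (s i j • !![1, 0; 0, -1] + (2⁻¹ : ℂ) •
      ((!![1, 0; 0, -1] : Matrix (Fin 2) (Fin 2) ℂ) * !![0, κ; 1, 0])) := by
    rw [hbK, Matrix.add_mul, Matrix.mul_add, Matrix.smul_mul, Matrix.smul_mul, haP, Matrix.mul_smul,
      Matrix.mul_smul, Matrix.mul_assoc, hKP, ← Matrix.mul_assoc, haP, Matrix.mul_assoc]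
  have hdP : d * P = P * normalForm c s w i j k k := by
    have e : normalForm c s w i j k k = κ⁻¹ • (!![0, κ; 1, 0] * (w i j k • 1 +
        (2 * s j k) • !![1, 0; 0, -1] - (2 * s i k) • (s i j • !![1, 0; 0, -1] + (2⁻¹ : ℂ) •
        ((!![1, 0; 0, -1] : Matrix (Fin 2) (Fin 2) ℂ) * !![0, κ; 1, 0])))) := by
      simp [normalForm, hik.symm, hjk.symm, hκ]
    rw [e, hdK, Matrix.smul_mul, Matrix.mul_smul, Matrix.mul_assoc, Matrix.sub_mul, Matrix.add_mul,
      Matrix.smul_mul, Matrix.smul_mul, Matrix.smul_mul, haP, hbP, Matrix.one_mul,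
      ← Matrix.mul_assoc P, ← hKP, Matrix.mul_assoc]
    congr 2
    simp only [Matrix.mul_sub, Matrix.mul_add, Matrix.mul_smul, Matrix.mul_one]
  refine ⟨P, Q, hPQ, hQP, fun y => ?_⟩
  rcases hx y with rfl | rfl | rfl | rfl
  · rw [← ha, haP]
    simp [normalForm]
  · rw [← hb', hbP]
    simp [normalForm, hij.symm, hκ]
  · exact hdP
  · have e : normalForm c s w i j k y = -(c y)⁻¹ • (c i • normalForm c s w i j k i +
        c j • normalForm c s w i j k j + c k • normalForm c s w i j k k) := by
      simp [normalForm, hij.symm, hik.symm, hjk.symm, hil.symm, hjl.symm, hkl.symm]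
    have e1 : normalForm c s w i j k i = !![1, 0; 0, -1] := by simp [normalForm]
    have e2 : normalForm c s w i j k j = s i j • !![1, 0; 0, -1] + (2⁻¹ : ℂ) •
      ((!![1, 0; 0, -1] : Matrix (Fin 2) (Fin 2) ℂ) * !![0, κ; 1, 0]) := by
      simp [normalForm, hij.symm, hκ]
    rw [← e1] at haP
    rw [← e2] at hbP
    rw [e, hl, Matrix.smul_mul, Matrix.add_mul, Matrix.add_mul, Matrix.smul_mul, Matrix.smul_mul,
      Matrix.smul_mul, hdP, haP, hbP, Matrix.mul_smul, Matrix.mul_add, Matrix.mul_add,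
      Matrix.mul_smul, Matrix.mul_smul, Matrix.mul_smul]

/-- The matrices have no non-trivial common invariant subspace. -/
def Irred (r : Fin 4 → Matrix ι ι ℂ) : Prop :=
  ∀ W : Submodule ℂ (ι → ℂ), (∀ j, ∀ v ∈ W, r j *ᵥ v ∈ W) → W = ⊥ ∨ W = ⊤

/-- Schur's lemma. -/
theorem Irred.brick [Nonempty ι] (h : Irred r) : Brick r := by
  intro Z hZ
  obtain ⟨a, ha⟩ := Module.End.exists_eigenvalue (Matrix.toLin' Z)
  refine ⟨a, ?_⟩
  have h1 := h (Module.End.eigenspace (Matrix.toLin' Z) a) (fun j v hv => by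
    rw [Module.End.mem_eigenspace_iff, Matrix.toLin'_apply] at hv ⊢
    rw [Matrix.mulVec_mulVec, (hZ j).eq, ← Matrix.mulVec_mulVec, hv, Matrix.mulVec_smul])
  have h2 := h1.resolve_left ha
  refine Matrix.ext_of_mulVec_single fun x => ?_
  have : (Pi.single x 1 : ι → ℂ) ∈ Module.End.eigenspace (Matrix.toLin' Z) a := by
    rw [h2]; trivial
  rw [Module.End.mem_eigenspace_iff, Matrix.toLin'_apply] at this
  rw [this, Matrix.smul_mulVec, Matrix.one_mulVec]

theorem HasChar.irred (hχ : HasChar r s w) (h : ReflRel c r) (hcard : Fintype.card ι = 2)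
    {i j : Fin 4} (hs : s i j ^ 2 ≠ 1) : Irred r := by
  intro W hW
  by_cases hbot : W = ⊥
  · exact Or.inl hbot
  right
  have : Nonempty ι := Fintype.card_pos_iff.1 (by omega)
  set κ : ℂ := 4 * (s i j ^ 2 - 1) with hκ
  have hκ0 : κ ≠ 0 := mul_ne_zero (by norm_num) (sub_ne_zero.2 hs)
  set K := r i * r j - r j * r i with hK
  have hKK : K * K = κ • 1 := commutator_sq (h.sq i) (h.sq j) (hχ.acomm_eq i j)
  have haK : r i * K = -(K * r i) := mul_commutator (h.sq i)
  have hKW : ∀ v ∈ W, K *ᵥ v ∈ W := by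
    intro v hv
    rw [hK, Matrix.sub_mulVec, ← Matrix.mulVec_mulVec, ← Matrix.mulVec_mulVec]
    exact W.sub_mem (hW i _ (hW j _ hv)) (hW j _ (hW i _ hv))
  -- an eigenvector of `r i` in `W`
  obtain ⟨u, hu, hu0, ε, hε, hε0⟩ : ∃ u ∈ W, u ≠ 0 ∧ ∃ ε : ℂ, r i *ᵥ u = ε • u ∧ ε ≠ 0 := by
    obtain ⟨v, hv, hv0⟩ := W.ne_bot_iff.1 hbot
    by_cases h0 : v + r i *ᵥ v = 0
    · refine ⟨v, hv, hv0, -1, ?_, by norm_num⟩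
      rw [neg_smul, one_smul]
      exact (neg_eq_of_add_eq_zero_right h0).symm
    · refine ⟨_, W.add_mem hv (hW i v hv), h0, 1, ?_, one_ne_zero⟩
      rw [Matrix.mulVec_add, Matrix.mulVec_mulVec, h.sq, Matrix.one_mulVec, one_smul, add_comm]
  have hKu : r i *ᵥ (K *ᵥ u) = -(ε • (K *ᵥ u)) := by
    rw [Matrix.mulVec_mulVec, haK, Matrix.neg_mulVec, ← Matrix.mulVec_mulVec, hε,
      Matrix.mulVec_smul]
  have hKu0 : K *ᵥ u ≠ 0 := by
    intro e
    have : K *ᵥ (K *ᵥ u) = 0 := by rw [e, Matrix.mulVec_zero]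
    rw [Matrix.mulVec_mulVec, hKK, Matrix.smul_mulVec, Matrix.one_mulVec] at this
    exact hu0 ((smul_eq_zero.1 this).resolve_left hκ0)
  have hli : LinearIndependent ℂ ![u, K *ᵥ u] := by
    rw [LinearIndependent.pair_iff]
    intro x y hxy
    have h1 := congrArg (fun v => r i *ᵥ v) hxy
    simp only [Matrix.mulVec_add, Matrix.mulVec_smul, hε, hKu, Matrix.mulVec_zero] at h1
    have h2 : (2 * ε * x) • u = 0 := by
      have := congrArg (fun v => ε • v) hxy
      simp only [smul_add, smul_zero] at this
      have h3 := congrArg₂ (· + ·) this h1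
      simp only [add_zero] at h3
      rw [← h3]
      module
    have hx : x = 0 := by
      have := (smul_eq_zero.1 h2).resolve_right hu0
      have h2ε : 2 * ε ≠ 0 := mul_ne_zero two_ne_zero hε0
      exact (mul_eq_zero.1 this).resolve_left h2ε
    rw [hx, zero_smul, zero_add] at hxy
    exact ⟨hx, (smul_eq_zero.1 hxy).resolve_right hKu0⟩
  refine Submodule.eq_top_of_finrank_eq (le_antisymm (Submodule.finrank_le W) ?_)
  have h3 : Submodule.span ℂ (Set.range ![u, K *ᵥ u]) ≤ W := by
    rw [Submodule.span_le]
    rintro _ ⟨x, rfl⟩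
    fin_cases x
    · exact hu
    · exact hKW u hu
  have h4 := Submodule.finrank_mono h3
  rw [finrank_span_eq_card hli] at h4
  simpa [hcard] using h4

/-- When all anticommutators are `2`, the differences of the reflections multiply to zero. -/
theorem HasChar.sub_mul_sub_eq_zero [Nonempty ι] (hχ : HasChar r s w) (h : ReflRel c r)
    (hs : ∀ i j, s i j = 1) (i j k : Fin 4) :
    (r j - r i) * (r k - r i) = 0 ∧ w i j k = 0 := by
  have h2 : ∀ i j, r i * r j + r j * r i = 2 := by
    intro i j
    have := hχ.acomm_eq i j
    rw [hs, mul_one, two_smul, one_add_one_eq_two] at this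
    exact this
  have ha := h.sq i
  have hw := hχ.tri_eq i j k
  set a := r i
  set N := r j - a with hN
  set M := r k - a with hM
  have hNN : ∀ x, (r x - a) * (r x - a) = 0 := by
    intro x
    have : (r x - a) * (r x - a) = r x * r x + a * a - (a * r x + r x * a) := by noncomm_ring
    rw [this, h.sq, ha, h2, one_add_one_eq_two, sub_self]
  have haN : ∀ x, a * (r x - a) + (r x - a) * a = 0 := by
    intro x
    have : a * (r x - a) + (r x - a) * a = a * r x + r x * a - (a * a + a * a) := by noncomm_ring
    rw [this, ha, h2, one_add_one_eq_two, sub_self]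
  have hNM : N * M + M * N = 0 := by
    have : N * M + M * N = (r j * r k + r k * r j) - (a * r j + r j * a) - (a * r k + r k * a) +
        (a * a + a * a) := by rw [hN, hM]; noncomm_ring
    rw [this, ha, h2, h2, h2, one_add_one_eq_two]
    noncomm_ring
  have htri : N * M = (w i j k / 2) • a := by
    have ej : r j = N + a := by rw [hN, sub_add_cancel]
    have ek : r k = M + a := by rw [hM, sub_add_cancel]
    have e0 : N * a = -(a * N) := eq_neg_of_add_eq_zero_right (haN j)
    have e1 : M * a = -(a * M) := eq_neg_of_add_eq_zero_right (haN k)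
    have e2 : M * N = -(N * M) := eq_neg_of_add_eq_zero_right hNM
    have e3 : M * N * a = -(a * N * M) := by
      rw [e2, neg_mul, mul_assoc, e1, mul_neg, ← mul_assoc, e0, neg_mul, neg_neg]
    have e4 : tri r i j k = a * N * M - M * N * a + (a * a) * M - M * (a * a) := by
      rw [tri, ej, ek]
      change a * (N + a) * (M + a) - (M + a) * (N + a) * a = _
      noncomm_ring
    rw [hw, ha, one_mul, mul_one, add_sub_cancel_right, e3, sub_neg_eq_add, ← two_smul ℂ] at e4
    have e5 : a * (a * N * M) = N * M := by rw [mul_assoc, ← mul_assoc a a, ha, one_mul]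
    have e6 : w i j k • a = (2 : ℂ) • (N * M) := by
      rw [← e5, ← mul_smul_comm, ← e4, mul_smul_comm, mul_one]
    rw [div_eq_inv_mul, mul_smul, e6, smul_smul, inv_mul_cancel₀ two_ne_zero, one_smul]
  have hw0 : w i j k = 0 := by
    have h3 : N * M * (N * M) = 0 := by
      have : N * M * (N * M) = N * (M * N + N * M) * M - N * N * M * M := by noncomm_ring
      rw [this, add_comm (M * N), hNM, hNN j]
      simp
    rw [htri, smul_mul_smul_comm, ha] at h3
    have := smul_one_injective (ι := ι) (a := w i j k / 2 * (w i j k / 2)) (b := 0) (by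
      rw [h3, zero_smul])
    simpa using this
  exact ⟨by rw [htri, hw0]; simp, hw0⟩

/-- When all anticommutators are `2`, the reflections have a common eigenvector. -/
theorem HasChar.exists_common_eigenvector [Nonempty ι] (hχ : HasChar r s w) (h : ReflRel c r)
    (hs : ∀ i j, s i j = 1) : ∃ u : ι → ℂ, u ≠ 0 ∧ ∃ ε : ℂ, ∀ j, r j *ᵥ u = ε • u := by
  -- a vector on which all the reflections coincide
  obtain ⟨v, hv0, hv⟩ : ∃ v : ι → ℂ, v ≠ 0 ∧ ∀ j, r j *ᵥ v = r 0 *ᵥ v := by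
    by_cases hN : ∀ j, r j = r 0
    · obtain ⟨x⟩ := ‹Nonempty ι›
      exact ⟨Pi.single x 1, by simp, fun j => by rw [hN]⟩
    · push Not at hN
      obtain ⟨k, hk⟩ := hN
      obtain ⟨x, hx⟩ : ∃ x, (r k - r 0) *ᵥ Pi.single x 1 ≠ 0 := by
        by_contra! H
        refine hk (sub_eq_zero.1 (Matrix.ext_of_mulVec_single fun x => ?_))
        rw [H, Matrix.zero_mulVec]
      refine ⟨_, hx, fun j => ?_⟩
      rw [← sub_eq_zero, ← Matrix.sub_mulVec, Matrix.mulVec_mulVec,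
        (hχ.sub_mul_sub_eq_zero h hs 0 j k).1, Matrix.zero_mulVec]
  have h2 : ∀ j, r j * r 0 + r 0 * r j = (2 : ℂ) • 1 := by
    intro j
    have := hχ.acomm_eq j 0
    rwa [hs, mul_one] at this
  by_cases h0 : v + r 0 *ᵥ v = 0
  · refine ⟨v, hv0, -1, fun j => ?_⟩
    rw [hv, neg_smul, one_smul]
    exact (neg_eq_of_add_eq_zero_right h0).symm
  · refine ⟨_, h0, 1, fun j => ?_⟩
    have h3 : r j *ᵥ (r 0 *ᵥ v) = v := by
      have h4 : r j * r 0 = (2 : ℂ) • 1 - r 0 * r j := by rw [← h2 j, add_sub_cancel_right]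
      rw [Matrix.mulVec_mulVec, h4, Matrix.sub_mulVec, Matrix.smul_mulVec, Matrix.one_mulVec,
        ← Matrix.mulVec_mulVec, hv, Matrix.mulVec_mulVec, h.sq, Matrix.one_mulVec, two_smul,
        add_sub_cancel_right]
    rw [Matrix.mulVec_add, hv, h3, one_smul, add_comm]

theorem Irred.exists_sq_ne_one (hi : Irred r) (hcard : Fintype.card ι = 2) (h : ReflRel c r)
    (hc : NoSubsum c) (hχ : HasChar r s w) : ∃ i j, s i j ^ 2 ≠ 1 := by
  have : Nonempty ι := Fintype.card_pos_iff.1 (by omega)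
  refine (hχ.dichotomy h hc).resolve_left fun hs => ?_
  obtain ⟨u, hu0, ε, hu⟩ := hχ.exists_common_eigenvector h hs
  rcases hi (Submodule.span ℂ {u}) (fun j v hv => by
    obtain ⟨x, rfl⟩ := Submodule.mem_span_singleton.1 hv
    rw [Matrix.mulVec_smul, hu]
    exact Submodule.smul_mem _ _ (Submodule.smul_mem _ _ (Submodule.mem_span_singleton_self u)))
    with e | e
  · exact hu0 (Submodule.span_singleton_eq_bot.1 e)
  · have h1 := finrank_span_singleton (K := ℂ) hu0
    rw [e, finrank_top, Module.finrank_fintype_fun_eq_card, hcard] at h1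
    omega

end TwoDim
end DSP

/-! ### The standard pair of matrices and families with all anticommutators equal to two -/

namespace DSP

open Matrix

section Kronecker

/-- A count of equations: morphisms between two pairs of linear maps exist when the Euler form is
positive. -/
theorem exists_pair_hom {U₁ V₁ U₂ V₂ : Type*} [AddCommGroup U₁] [Module ℂ U₁]
    [FiniteDimensional ℂ U₁] [AddCommGroup V₁] [Module ℂ V₁] [FiniteDimensional ℂ V₁]
    [AddCommGroup U₂] [Module ℂ U₂] [FiniteDimensional ℂ U₂] [AddCommGroup V₂] [Module ℂ V₂]
    [FiniteDimensional ℂ V₂] (e₁ f₁ : U₁ →ₗ[ℂ] V₁) (e₂ f₂ : U₂ →ₗ[ℂ] V₂)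
    (h : 2 * (Module.finrank ℂ U₁ * Module.finrank ℂ V₂) <
      Module.finrank ℂ U₁ * Module.finrank ℂ U₂ + Module.finrank ℂ V₁ * Module.finrank ℂ V₂) :
    ∃ (φ : U₁ →ₗ[ℂ] U₂) (ψ : V₁ →ₗ[ℂ] V₂), (φ, ψ) ≠ 0 ∧ ψ ∘ₗ e₁ = e₂ ∘ₗ φ ∧
      ψ ∘ₗ f₁ = f₂ ∘ₗ φ := by
  let Φ : (U₁ →ₗ[ℂ] U₂) × (V₁ →ₗ[ℂ] V₂) →ₗ[ℂ] (U₁ →ₗ[ℂ] V₂) × (U₁ →ₗ[ℂ] V₂) :=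
    { toFun := fun p => (p.2 ∘ₗ e₁ - e₂ ∘ₗ p.1, p.2 ∘ₗ f₁ - f₂ ∘ₗ p.1)
      map_add' := fun p q => by
        ext x <;> simp <;> abel
      map_smul' := fun a p => by
        ext x <;> simp [smul_sub] }
  have hker : LinearMap.ker Φ ≠ ⊥ := LinearMap.ker_ne_bot_of_finrank_lt (by
    simp only [Module.finrank_prod, Module.finrank_linearMap]
    omega)
  obtain ⟨⟨φ, ψ⟩, hmem, hne⟩ := (Submodule.ne_bot_iff _).1 hker
  have h1 := congrArg Prod.fst (LinearMap.mem_ker.1 hmem)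
  have h2 := congrArg Prod.snd (LinearMap.mem_ker.1 hmem)
  exact ⟨φ, ψ, hne, sub_eq_zero.1 h1, sub_eq_zero.1 h2⟩

/-- The first matrix of the standard pair: the inclusion of the first `l` coordinates. -/
def stdE (l : ℕ) : Matrix (Fin (l + 1)) (Fin l) ℂ :=
  Matrix.of fun x y => if x = y.castSucc then 1 else 0

/-- The second matrix of the standard pair: the inclusion of the last `l` coordinates. -/
def stdF (l : ℕ) : Matrix (Fin (l + 1)) (Fin l) ℂ :=
  Matrix.of fun x y => if x = y.succ then 1 else 0

theorem stdE_mulVec_castSucc {l : ℕ} (u : Fin l → ℂ) (y : Fin l) :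
    (stdE l *ᵥ u) y.castSucc = u y := by
  simp [stdE, Matrix.mulVec, dotProduct]

theorem stdE_mulVec_last {l : ℕ} (u : Fin l → ℂ) : (stdE l *ᵥ u) (Fin.last l) = 0 := by
  simp only [stdE, Matrix.mulVec, dotProduct, Matrix.of_apply]
  exact Finset.sum_eq_zero fun y _ => by rw [if_neg (Fin.castSucc_lt_last y).ne', zero_mul]

theorem stdF_mulVec_succ {l : ℕ} (u : Fin l → ℂ) (y : Fin l) :
    (stdF l *ᵥ u) y.succ = u y := by
  simp [stdF, Matrix.mulVec, dotProduct]

theorem stdE_injective (l : ℕ) : Function.Injective (stdE l).toLin' := by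
  intro u v h
  ext y
  simpa only [Matrix.toLin'_apply, stdE_mulVec_castSucc] using congrFun h y.castSucc

/-- A non-zero subobject of the standard pair has positive defect: otherwise the shift would
preserve a non-zero subspace. -/
theorem finrank_lt_of_stdE_stdF {l : ℕ} {U : Submodule ℂ (Fin l → ℂ)}
    {V : Submodule ℂ (Fin (l + 1) → ℂ)} (hE : U.map (stdE l).toLin' ≤ V)
    (hF : U.map (stdF l).toLin' ≤ V) (h : U ≠ ⊥ ∨ V ≠ ⊥) :
    Module.finrank ℂ U < Module.finrank ℂ V := by
  by_contra! hle
  have hEV : U.map (stdE l).toLin' = V := by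
    refine Submodule.eq_of_le_of_finrank_le hE ?_
    rwa [← (Submodule.equivMapOfInjective _ (stdE_injective l) U).finrank_eq]
  have key : ∀ t : ℕ, ∀ u ∈ U, ∀ i : Fin l, l ≤ i + t + 1 → u i = 0 := by
    intro t
    induction t with
    | zero =>
      intro u hu i hi
      obtain ⟨u', _, he⟩ := (hEV ▸ hF (Submodule.mem_map_of_mem hu) :
        (stdF l).toLin' u ∈ U.map (stdE l).toLin')
      have : i.succ = Fin.last l := by ext; simp; omega
      have h1 := congrFun he i.succ
      rw [Matrix.toLin'_apply, Matrix.toLin'_apply, stdF_mulVec_succ, this, stdE_mulVec_last] at h1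
      exact h1.symm
    | succ t ih =>
      intro u hu i hi
      obtain ⟨u', hu', he⟩ := (hEV ▸ hF (Submodule.mem_map_of_mem hu) :
        (stdF l).toLin' u ∈ U.map (stdE l).toLin')
      have h1 := congrFun he i.succ
      rw [Matrix.toLin'_apply, Matrix.toLin'_apply, stdF_mulVec_succ] at h1
      by_cases hil : i.succ = Fin.last l
      · rw [hil, stdE_mulVec_last] at h1
        exact h1.symm
      · obtain ⟨y, hy⟩ := Fin.exists_castSucc_eq.2 hil
        rw [← hy, stdE_mulVec_castSucc, ih u' hu' y (by
          have := congrArg Fin.val hy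
          simp at this
          omega)] at h1
        exact h1.symm
  have hU : U = ⊥ := by
    rw [Submodule.eq_bot_iff]
    intro u hu
    ext i
    exact key l u hu i (by omega)
  have hV : V = ⊥ := by rw [← hEV, hU, Submodule.map_bot]
  rcases h with h | h
  · exact h hU
  · exact h hV

/-- A pair of linear maps from an `l`-dimensional to an `(l + 1)`-dimensional space with only scalar
endomorphisms is isomorphic to the standard pair. There is a non-zero morphism to the standard
pair; by positivity of the defect there is a non-zero morphism back from its image, and
the composite endomorphism is a non-zero scalar. -/
theorem exists_iso_std {l : ℕ} (e f : (Fin l → ℂ) →ₗ[ℂ] (Fin (l + 1) → ℂ))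
    (hb : ∀ (φ : (Fin l → ℂ) →ₗ[ℂ] (Fin l → ℂ)) (ψ : (Fin (l + 1) → ℂ) →ₗ[ℂ] (Fin (l + 1) → ℂ)),
      ψ ∘ₗ e = e ∘ₗ φ → ψ ∘ₗ f = f ∘ₗ φ → ∃ a : ℂ, φ = a • LinearMap.id ∧ ψ = a • LinearMap.id) :
    ∃ (φ : (Fin l → ℂ) ≃ₗ[ℂ] (Fin l → ℂ)) (ψ : (Fin (l + 1) → ℂ) ≃ₗ[ℂ] (Fin (l + 1) → ℂ)),
      ψ.toLinearMap ∘ₗ e = (stdE l).toLin' ∘ₗ φ.toLinearMap ∧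
      ψ.toLinearMap ∘ₗ f = (stdF l).toLin' ∘ₗ φ.toLinearMap := by
  obtain ⟨φ, ψ, hne, h1, h2⟩ := exists_pair_hom e f (stdE l).toLin' (stdF l).toLin' (by
    simp only [Module.finrank_fintype_fun_eq_card, Fintype.card_fin]; nlinarith)
  let U := LinearMap.range φ
  let V := LinearMap.range ψ
  have hEV : U.map (stdE l).toLin' ≤ V := by
    rintro _ ⟨_, ⟨x, rfl⟩, rfl⟩
    exact ⟨e x, LinearMap.congr_fun h1 x⟩
  have hFV : U.map (stdF l).toLin' ≤ V := by
    rintro _ ⟨_, ⟨x, rfl⟩, rfl⟩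
    exact ⟨f x, LinearMap.congr_fun h2 x⟩
  have hpos : Module.finrank ℂ U < Module.finrank ℂ V := by
    refine finrank_lt_of_stdE_stdF hEV hFV ?_
    by_contra! H
    exact hne (Prod.ext (LinearMap.range_eq_bot.1 H.1) (LinearMap.range_eq_bot.1 H.2))
  have hle : Module.finrank ℂ U ≤ l := by simpa using Submodule.finrank_le U
  let e' : U →ₗ[ℂ] V := (stdE l).toLin'.restrict fun x hx => hEV (Submodule.mem_map_of_mem hx)
  let f' : U →ₗ[ℂ] V := (stdF l).toLin'.restrict fun x hx => hFV (Submodule.mem_map_of_mem hx)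
  obtain ⟨φ', ψ', hne', h1', h2'⟩ := exists_pair_hom e' f' e f (by
    simp only [Module.finrank_fintype_fun_eq_card, Fintype.card_fin]; nlinarith)
  have he' : ∀ x, ψ.rangeRestrict (e x) = e' (φ.rangeRestrict x) := fun x =>
    Subtype.ext (LinearMap.congr_fun h1 x)
  have hf' : ∀ x, ψ.rangeRestrict (f x) = f' (φ.rangeRestrict x) := fun x =>
    Subtype.ext (LinearMap.congr_fun h2 x)
  obtain ⟨a, ha, ha'⟩ := hb (φ' ∘ₗ φ.rangeRestrict) (ψ' ∘ₗ ψ.rangeRestrict)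
    (LinearMap.ext fun x => by
      simp only [LinearMap.comp_apply]
      rw [he']
      exact LinearMap.congr_fun h1' (φ.rangeRestrict x))
    (LinearMap.ext fun x => by
      simp only [LinearMap.comp_apply]
      rw [hf']
      exact LinearMap.congr_fun h2' (φ.rangeRestrict x))
  have ha0 : a ≠ 0 := by
    rintro rfl
    refine hne' (Prod.ext ?_ ?_)
    · refine LinearMap.ext ?_
      rintro ⟨_, x, rfl⟩
      have := LinearMap.congr_fun ha x
      rw [zero_smul] at this
      exact this
    · refine LinearMap.ext ?_
      rintro ⟨_, x, rfl⟩
      have := LinearMap.congr_fun ha' x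
      rw [zero_smul] at this
      exact this
  have hφ : Function.Injective φ := by
    rw [← LinearMap.ker_eq_bot, LinearMap.ker_eq_bot']
    intro x hx
    have h3 := LinearMap.congr_fun ha x
    have h4 : φ.rangeRestrict x = 0 := Subtype.ext hx
    rw [LinearMap.comp_apply, h4, map_zero] at h3
    exact (smul_eq_zero.1 h3.symm).resolve_left ha0
  have hψ : Function.Injective ψ := by
    rw [← LinearMap.ker_eq_bot, LinearMap.ker_eq_bot']
    intro x hx
    have h3 := LinearMap.congr_fun ha' x
    have h4 : ψ.rangeRestrict x = 0 := Subtype.ext hx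
    rw [LinearMap.comp_apply, h4, map_zero] at h3
    exact (smul_eq_zero.1 h3.symm).resolve_left ha0
  refine ⟨LinearEquiv.ofInjectiveEndo φ hφ, LinearEquiv.ofInjectiveEndo ψ hψ, ?_, ?_⟩
  · exact LinearMap.ext fun x => LinearMap.congr_fun h1 x
  · exact LinearMap.ext fun x => LinearMap.congr_fun h2 x

/-- The matrix form of `exists_iso_std`. -/
theorem exists_matrix_iso_std {l : ℕ} (E F : Matrix (Fin (l + 1)) (Fin l) ℂ)
    (hb : ∀ (Y : Matrix (Fin l) (Fin l) ℂ) (X : Matrix (Fin (l + 1)) (Fin (l + 1)) ℂ),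
      X * E = E * Y → X * F = F * Y → ∃ a : ℂ, Y = a • 1 ∧ X = a • 1) :
    ∃ (Y Y' : Matrix (Fin l) (Fin l) ℂ) (X X' : Matrix (Fin (l + 1)) (Fin (l + 1)) ℂ),
      Y * Y' = 1 ∧ Y' * Y = 1 ∧ X * X' = 1 ∧ X' * X = 1 ∧ X * E = stdE l * Y ∧
      X * F = stdF l * Y := by
  obtain ⟨φ, ψ, h1, h2⟩ := exists_iso_std E.toLin' F.toLin' (by
    intro φ ψ h1 h2
    obtain ⟨a, ha, ha'⟩ := hb φ.toMatrix' ψ.toMatrix' (by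
      apply Matrix.toLin'.injective
      rw [Matrix.toLin'_mul, Matrix.toLin'_mul, Matrix.toLin'_toMatrix', Matrix.toLin'_toMatrix', h1])
      (by
      apply Matrix.toLin'.injective
      rw [Matrix.toLin'_mul, Matrix.toLin'_mul, Matrix.toLin'_toMatrix', Matrix.toLin'_toMatrix', h2])
    refine ⟨a, ?_, ?_⟩
    · rw [← Matrix.toLin'_toMatrix' φ, ha, map_smul, Matrix.toLin'_one]
    · rw [← Matrix.toLin'_toMatrix' ψ, ha', map_smul, Matrix.toLin'_one])
  refine ⟨φ.toLinearMap.toMatrix', φ.symm.toLinearMap.toMatrix', ψ.toLinearMap.toMatrix',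
    ψ.symm.toLinearMap.toMatrix', ?_, ?_, ?_, ?_, ?_, ?_⟩
  · rw [← LinearMap.toMatrix'_comp]; simp
  · rw [← LinearMap.toMatrix'_comp]; simp
  · rw [← LinearMap.toMatrix'_comp]; simp
  · rw [← LinearMap.toMatrix'_comp]; simp
  · apply Matrix.toLin'.injective
    rw [Matrix.toLin'_mul, Matrix.toLin'_mul, Matrix.toLin'_toMatrix', Matrix.toLin'_toMatrix', h1]
  · apply Matrix.toLin'.injective
    rw [Matrix.toLin'_mul, Matrix.toLin'_mul, Matrix.toLin'_toMatrix', Matrix.toLin'_toMatrix', h2]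

/-- The upper right blocks of the standard family. -/
noncomputable def stdBlock (c : Fin 4 → ℂ) (l : ℕ) : Fin 4 → Matrix (Fin (l + 1)) (Fin l) ℂ :=
  ![0, stdE l, stdF l, -(c 3)⁻¹ • (c 1 • stdE l + c 2 • stdF l)]

/-- The standard family of reflections with trivial centralizer for which all anticommutators
are `2`; the other one is its transpose. -/
noncomputable def stdFamily (c : Fin 4 → ℂ) (l : ℕ) :
    Fin 4 → Matrix (Fin (l + 1) ⊕ Fin l) (Fin (l + 1) ⊕ Fin l) ℂ :=
  fun j => fromBlocks (-1) (stdBlock c l j) 0 1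

variable {c : Fin 4 → ℂ}

theorem similar_stdFamily {l : ℕ} {B : Fin 4 → Matrix (Fin (l + 1)) (Fin l) ℂ}
    (hc : c 3 ≠ 0) (hB0 : B 0 = 0) (h : ReflRel c (fun j => (fromBlocks (-1) (B j) 0 1 :
      Matrix (Fin (l + 1) ⊕ Fin l) (Fin (l + 1) ⊕ Fin l) ℂ)))
    (hb : Brick (fun j => (fromBlocks (-1) (B j) 0 1 :
      Matrix (Fin (l + 1) ⊕ Fin l) (Fin (l + 1) ⊕ Fin l) ℂ))) :
    Similar (fun j => (fromBlocks (-1) (B j) 0 1 :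
      Matrix (Fin (l + 1) ⊕ Fin l) (Fin (l + 1) ⊕ Fin l) ℂ)) (stdFamily c l) := by
  have h3 : B 3 = -(c 3)⁻¹ • (c 1 • B 1 + c 2 • B 2) := by
    have := congrArg Matrix.toBlocks₁₂ h.sum
    simp only [Fin.sum_univ_four, Matrix.fromBlocks_smul, Matrix.fromBlocks_add, hB0,
      Matrix.toBlocks_fromBlocks₁₂, smul_zero, zero_add] at this
    rw [show (0 : Matrix (Fin (l + 1) ⊕ Fin l) (Fin (l + 1) ⊕ Fin l) ℂ).toBlocks₁₂ = 0 from rfl]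
      at this
    rw [eq_neg_of_add_eq_zero_left this, neg_smul_neg, smul_smul, inv_mul_cancel₀ hc, one_smul]
  obtain ⟨Y, Y', X, X', hY, hY', hX, hX', h1, h2⟩ := exists_matrix_iso_std (B 1) (B 2) (by
    intro Y X h1 h2
    obtain ⟨a, ha⟩ := hb (fromBlocks X 0 0 Y) (fun j => by
      have key : X * B j = B j * Y := by
        fin_cases j
        · simp [hB0]
        · exact h1
        · exact h2
        · simp only [Fin.reduceFinMk]
          rw [h3, Matrix.mul_smul, Matrix.mul_add, Matrix.mul_smul, Matrix.mul_smul, h1, h2,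
            Matrix.smul_mul, Matrix.add_mul, Matrix.smul_mul, Matrix.smul_mul]
      rw [Commute, SemiconjBy, Matrix.fromBlocks_multiply, Matrix.fromBlocks_multiply]
      simp [key])
    rw [← Matrix.fromBlocks_one, Matrix.fromBlocks_smul, Matrix.fromBlocks_inj] at ha
    exact ⟨a, ha.2.2.2, ha.1⟩)
  have key : ∀ j, X * B j = stdBlock c l j * Y := by
    intro j
    fin_cases j
    · simp [hB0, stdBlock]
    · exact h1
    · exact h2
    · simp only [Fin.reduceFinMk]
      rw [h3, Matrix.mul_smul, Matrix.mul_add, Matrix.mul_smul, Matrix.mul_smul, h1, h2]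
      simp [stdBlock, Matrix.add_mul]
  refine Similar.symm ⟨fromBlocks X 0 0 Y, fromBlocks X' 0 0 Y', ?_, ?_, fun j => ?_⟩
  · rw [Matrix.fromBlocks_multiply]; simp [hX, hY]
  · rw [Matrix.fromBlocks_multiply]; simp [hX', hY']
  · rw [stdFamily, Matrix.fromBlocks_multiply, Matrix.fromBlocks_multiply]
    simp [key]

section

variable {ι κ : Type*} [Fintype ι] [DecidableEq ι] [Fintype κ] [DecidableEq κ]
  {r : Fin 4 → Matrix ι ι ℂ} {r' : Fin 4 → Matrix κ κ ℂ}

/-- The matrices have no common eigenvector with eigenvalue `ε`. -/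
def NoFix (r : Fin 4 → Matrix ι ι ℂ) (ε : ℂ) : Prop :=
  ∀ u : ι → ℂ, (∀ j, r j *ᵥ u = ε • u) → u = 0

theorem Similar.noFix (h : Similar r r') {ε : ℂ} (hr' : NoFix r' ε) : NoFix r ε := by
  obtain ⟨P, Q, h1, h2, h3⟩ := h.symm
  obtain ⟨P', Q', h1', h2', h3'⟩ := h
  intro u hu
  have := hr' (P *ᵥ u) (fun j => by
    rw [Matrix.mulVec_mulVec, h3, ← Matrix.mulVec_mulVec, hu, Matrix.mulVec_smul])
  have h4 : Q *ᵥ (P *ᵥ u) = 0 := by rw [this, Matrix.mulVec_zero]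
  rwa [Matrix.mulVec_mulVec, h2, Matrix.one_mulVec] at h4

theorem Similar.hasChar (h : Similar r r') {s : Fin 4 → Fin 4 → ℂ}
    {w : Fin 4 → Fin 4 → Fin 4 → ℂ} (hχ : HasChar r' s w) : HasChar r s w := by
  obtain ⟨f, hf⟩ := h.exists_algEquiv
  refine ⟨fun i j => ?_, fun i j k => ?_⟩
  · have := congrArg f (hχ.acomm_eq i j)
    simpa [acomm, hf] using this
  · have := congrArg f (hχ.tri_eq i j k)
    simpa [tri, hf] using this

theorem noFix_stdFamily (l : ℕ) : NoFix (stdFamily c l) 1 := by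
  intro u hu
  have h0 := hu 0
  have h1 := hu 1
  simp only [stdFamily, stdBlock, Matrix.fromBlocks_mulVec, one_smul] at h0 h1
  have hx : ∀ x, u (Sum.inl x) = 0 := by
    intro x
    have := congrFun h0 (Sum.inl x)
    simp [Matrix.neg_mulVec] at this
    exact self_eq_neg.1 this.symm
  have hinl : u ∘ Sum.inl = 0 := funext hx
  ext (x | y)
  · exact hx x
  · have := congrFun h1 (Sum.inl y.castSucc)
    simp only [hinl, Matrix.mulVec_zero, zero_add, Matrix.cons_val_one, Sum.elim_inl,
      Matrix.cons_val_zero, hx, stdE_mulVec_castSucc] at this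
    exact this

theorem noFix_stdFamily_transpose {l : ℕ} (hl : 1 ≤ l) :
    NoFix (fun j => (stdFamily c l j)ᵀ) (-1) := by
  intro u hu
  have h0 := hu 0
  have h1 := hu 1
  have h2 := hu 2
  simp only [stdFamily, stdBlock, Matrix.fromBlocks_transpose, Matrix.fromBlocks_mulVec] at h0 h1 h2
  have hy : ∀ y, u (Sum.inr y) = 0 := by
    intro y
    have := congrFun h0 (Sum.inr y)
    simp at this
    exact self_eq_neg.1 this
  have hinr : u ∘ Sum.inr = 0 := funext hy
  have hE : ∀ y, u (Sum.inl (Fin.castSucc y)) = 0 := by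
    intro y
    have := congrFun h1 (Sum.inr y)
    simpa [hinr, hy, stdE, Matrix.mulVec, dotProduct] using this
  have hF : ∀ y, u (Sum.inl (Fin.succ y)) = 0 := by
    intro y
    have := congrFun h2 (Sum.inr y)
    simpa [hinr, hy, stdF, Matrix.mulVec, dotProduct] using this
  ext (x | y)
  · refine Fin.cases ?_ (fun y => hF y) x
    exact hE ⟨0, hl⟩
  · exact hy y

theorem not_noFix_stdFamily (l : ℕ) : ¬ NoFix (stdFamily c l) (-1) := by
  intro h
  have := h (Sum.elim (fun _ => 1) 0) (fun j => by
    rw [stdFamily, Matrix.fromBlocks_mulVec]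
    ext (x | y) <;> simp [Matrix.neg_mulVec])
  simpa using congrFun this (Sum.inl 0)

theorem not_noFix_stdFamily_transpose {l : ℕ} (hl : 1 ≤ l) :
    ¬ NoFix (fun j => (stdFamily c l j)ᵀ) 1 := by
  intro h
  have := h (Sum.elim 0 (fun _ => 1)) (fun j => by
    simp only [stdFamily]
    rw [Matrix.fromBlocks_transpose, Matrix.fromBlocks_mulVec]
    ext (x | y) <;> simp)
  simpa using congrFun this (Sum.inr ⟨0, hl⟩)

/-- The classification of the families with trivial centralizer for which all anticommutators
are `2`. -/
theorem similar_stdFamily_or {l : ℕ} {s : Fin 4 → Fin 4 → ℂ} {w : Fin 4 → Fin 4 → Fin 4 → ℂ}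
    (hc : ∀ j, c j ≠ 0) (h : ReflRel c r) (hb : Brick r) (hχ : HasChar r s w)
    (hs : ∀ i j, s i j = 1) (hcard : Fintype.card ι = 2 * l + 1) (htr : (r 0).trace = -1) :
    (NoFix r 1 ∧ Similar r (stdFamily c l)) ∨
      (1 ≤ l ∧ NoFix r (-1) ∧ Similar r (fun j => (stdFamily c l j)ᵀ)) := by
  suffices H : Similar r (stdFamily c l) ∨ (1 ≤ l ∧ Similar r (fun j => (stdFamily c l j)ᵀ)) by
    rcases H with H | ⟨hl, H⟩
    · exact Or.inl ⟨H.noFix (noFix_stdFamily l), H⟩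
    · exact Or.inr ⟨hl, H.noFix (noFix_stdFamily_transpose hl), H⟩
  obtain ⟨P, Q, h1, h2, h3⟩ := exists_block_form_of_sq_eq_one (p := l + 1) (q := l) (h.sq 0)
    (by omega) (by rw [htr]; push_cast; ring)
  have hsim : Similar r (fun j => Q * r j * P) := by
    refine ⟨P, Q, h1, h2, fun j => ?_⟩
    rw [← Matrix.mul_assoc, ← Matrix.mul_assoc, h1, Matrix.one_mul]
  set r' : Fin 4 → Matrix (Fin (l + 1) ⊕ Fin l) (Fin (l + 1) ⊕ Fin l) ℂ := fun j => Q * r j * P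
    with hr'
  have h0 : r' 0 = fromBlocks (-1) 0 0 1 := by
    rw [hr']
    simp only
    rw [Matrix.mul_assoc, h3, ← Matrix.mul_assoc, h2, Matrix.one_mul]
  have hb' : Brick r' := hsim.symm.brick hb
  have hR' : ReflRel c r' := hsim.symm.reflRel h
  have hχ' : HasChar r' s w := hsim.symm.hasChar hχ
  clear_value r'
  let B := fun j => (r' j).toBlocks₁₂
  let C := fun j => (r' j).toBlocks₂₁
  have hblk : ∀ j, r' j = fromBlocks (-1) (B j) (C j) 1 := by
    intro j
    have e := hχ'.acomm_eq 0 j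
    rw [acomm, h0, hs, ← Matrix.fromBlocks_toBlocks (r' j), Matrix.fromBlocks_multiply,
      Matrix.fromBlocks_multiply, Matrix.fromBlocks_add, ← Matrix.fromBlocks_one,
      Matrix.fromBlocks_smul, Matrix.fromBlocks_inj] at e
    simp only [Matrix.neg_mul, Matrix.one_mul, Matrix.zero_mul, add_zero, Matrix.mul_neg,
      Matrix.mul_one, Matrix.mul_zero, zero_add, mul_one] at e
    have e1 : (r' j).toBlocks₁₁ = -1 := by
      have := e.1
      rw [← neg_add, ← two_smul ℂ, ← smul_neg] at this
      rw [← smul_right_injective _ (two_ne_zero' ℂ) this, neg_neg]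
    have e2 : (r' j).toBlocks₂₂ = 1 := by
      have := e.2.2.2
      rw [← two_smul ℂ] at this
      exact smul_right_injective _ (two_ne_zero' ℂ) this
    rw [← Matrix.fromBlocks_toBlocks (r' j), e1, e2]
  have hBC : ∀ j k, B j * C k = 0 ∧ C j * B k = 0 := by
    intro j k
    have e := (hχ'.sub_mul_sub_eq_zero hR' hs 0 j k).1
    rw [hblk j, hblk k, h0, sub_eq_add_neg, sub_eq_add_neg, Matrix.fromBlocks_neg,
      Matrix.fromBlocks_add, Matrix.fromBlocks_add, Matrix.fromBlocks_multiply,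
      ← Matrix.fromBlocks_zero, Matrix.fromBlocks_inj] at e
    simpa using And.intro e.1 e.2.2.2
  have hdich : (∀ j, C j = 0) ∨ ∀ j, B j = 0 := by
    by_contra! H
    obtain ⟨⟨j, hj⟩, i, hi⟩ := H
    have hj' : ∃ z t, C j z t ≠ 0 := by
      by_contra! H
      exact hj (Matrix.ext H)
    have hi' : ∃ x y, B i x y ≠ 0 := by
      by_contra! H
      exact hi (Matrix.ext H)
    obtain ⟨z, t, hzt⟩ := hj'
    obtain ⟨x, y, hxy⟩ := hi'
    obtain ⟨a, ha⟩ := hb' (fromBlocks (B i * (Matrix.single y z (1 : ℂ) : Matrix (Fin l) (Fin l) ℂ) * C j) 0 0 0) (fun k => by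
      rw [Commute, SemiconjBy, hblk k, Matrix.fromBlocks_multiply, Matrix.fromBlocks_multiply,
        Matrix.mul_assoc _ (C j) (B k), (hBC j k).2, ← Matrix.mul_assoc (C k) _ (C j),
        ← Matrix.mul_assoc (C k) (B i), (hBC k i).2]
      simp)
    rw [← Matrix.fromBlocks_one, Matrix.fromBlocks_smul, Matrix.fromBlocks_inj] at ha
    have ha0 : a = 0 := by
      have := congrFun (congrFun ha.2.2.2 z) z
      simpa using this.symm
    have := congrFun (congrFun ha.1 x) t
    rw [ha0, zero_smul, Matrix.mul_assoc, Matrix.mul_apply, Finset.sum_eq_single y] at this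
    · rw [Matrix.single_mul_apply_same, one_mul, Matrix.zero_apply] at this
      exact mul_ne_zero hxy hzt this
    · intro y' _ hy'
      rw [Matrix.single_mul_apply_of_ne _ _ _ _ _ hy', mul_zero]
    · simp
  have hB0 : B 0 = 0 := by simp [B, h0]
  have hC0 : C 0 = 0 := by simp [C, h0]
  rcases hdich with H | H
  · left
    have e : r' = fun j => fromBlocks (-1) (B j) 0 1 := funext fun j => by rw [hblk j, H]
    refine hsim.trans ?_
    rw [e] at hb' hR' ⊢
    exact similar_stdFamily (hc 3) hB0 hR' hb'
  · have e : (fun j => (r' j)ᵀ) = fun j => fromBlocks (-1) (C j)ᵀ 0 1 := funext fun j => by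
      rw [hblk j, H, Matrix.fromBlocks_transpose]
      simp
    have hb'' := hb'.transpose
    have hR'' := hR'.transpose
    rw [e] at hb'' hR''
    have h4 : Similar (fun j => (r' j)ᵀ) (stdFamily c l) := by
      rw [e]
      exact similar_stdFamily (hc 3) (by rw [hC0]; rfl) hR'' hb''
    have h5 : Similar r (fun j => (stdFamily c l j)ᵀ) := by
      refine hsim.trans ?_
      simpa using h4.transpose
    rcases Nat.eq_zero_or_pos l with rfl | hl
    · left
      convert h5 using 1
      funext j
      rw [stdFamily, Matrix.fromBlocks_transpose]
      simp only [Matrix.transpose_neg, Matrix.transpose_one, Matrix.transpose_zero]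
      congr 1
      · ext x y; exact y.elim0
      · ext x y; exact x.elim0
    · exact Or.inr ⟨hl, h5⟩

/-- Families with trivial centralizer for which all anticommutators are `2` are equivalent as soon
as they have the same size and both lack a common eigenvector with the same eigenvalue. -/
theorem similar_of_noFix {l : ℕ} {s s' : Fin 4 → Fin 4 → ℂ} {w w' : Fin 4 → Fin 4 → Fin 4 → ℂ}
    (hc : ∀ j, c j ≠ 0) (h : ReflRel c r) (hb : Brick r) (hχ : HasChar r s w)
    (hs : ∀ i j, s i j = 1) (hcard : Fintype.card ι = 2 * l + 1) (htr : (r 0).trace = -1)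
    (h' : ReflRel c r') (hb' : Brick r') (hχ' : HasChar r' s' w')
    (hs' : ∀ i j, s' i j = 1) (hcard' : Fintype.card κ = 2 * l + 1) (htr' : (r' 0).trace = -1)
    {ε : ℂ} (hε : ε = 1 ∨ ε = -1) (hn : NoFix r ε) (hn' : NoFix r' ε) : Similar r r' := by
  have h1 := similar_stdFamily_or hc h hb hχ hs hcard htr
  have h1' := similar_stdFamily_or hc h' hb' hχ' hs' hcard' htr'
  rcases h1 with ⟨_, h1⟩ | ⟨hl, _, h1⟩ <;> rcases h1' with ⟨_, h1'⟩ | ⟨hl', _, h1'⟩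
  · exact h1.trans h1'.symm
  · rcases hε with rfl | rfl
    · exact absurd (h1'.symm.noFix hn') (not_noFix_stdFamily_transpose hl')
    · exact absurd (h1.symm.noFix hn) (not_noFix_stdFamily l)
  · rcases hε with rfl | rfl
    · exact absurd (h1.symm.noFix hn) (not_noFix_stdFamily_transpose hl)
    · exact absurd (h1'.symm.noFix hn') (not_noFix_stdFamily l)
  · exact h1.trans h1'.symm

end

end Kronecker
end DSP

/-! ### Direct sums of families and their centralizers -/

namespace DSP

open Matrix

section DirectSum

variable {τ : Type*} [Fintype τ] [DecidableEq τ] {F : τ → Type*} [∀ t, Fintype (F t)]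
  [∀ t, DecidableEq (F t)]

/-- The block-diagonal families with blocks `B t`. -/
def dsum {τ : Type*} [DecidableEq τ] {F : τ → Type*} (B : ∀ t, Fin 4 → Matrix (F t) (F t) ℂ) :
    Fin 4 → Matrix (Σ t, F t) (Σ t, F t) ℂ :=
  fun j => blockDiagonal' fun t => B t j

/-- The algebra homomorphism that forms a block-diagonal matrix from its blocks. -/
def blockDiagonalHom (F : τ → Type*) [∀ t, Fintype (F t)] [∀ t, DecidableEq (F t)] :
    (∀ t, Matrix (F t) (F t) ℂ) →ₐ[ℂ] Matrix (Σ t, F t) (Σ t, F t) ℂ :=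
  AlgHom.ofLinearMap
    { toFun := fun M => blockDiagonal' M
      map_add' := blockDiagonal'_add
      map_smul' := fun x M => blockDiagonal'_smul x M }
    blockDiagonal'_one fun M N => blockDiagonal'_mul M N

theorem blockDiagonalHom_apply (M : ∀ t, Matrix (F t) (F t) ℂ) :
    blockDiagonalHom F M = blockDiagonal' M := rfl

theorem reflRel_dsum_iff {c : Fin 4 → ℂ} {B : ∀ t, Fin 4 → Matrix (F t) (F t) ℂ} :
    ReflRel c (dsum B) ↔ ∀ t, ReflRel c (B t) := by
  constructor
  · intro h t
    refine ⟨fun j => ?_, ?_⟩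
    · have := h.sq j
      rw [dsum, ← blockDiagonal'_mul, ← blockDiagonal'_one, blockDiagonal'_inj] at this
      exact congrFun this t
    · have e : ∑ j, c j • dsum B j = blockDiagonal' (∑ j, c j • fun t => B t j) := by
        rw [← blockDiagonalHom_apply, map_sum]
        simp only [map_smul]
        rfl
      have h1 := h.sum
      rw [e, ← blockDiagonal'_zero, blockDiagonal'_inj] at h1
      have := congrFun h1 t
      simpa using this
  · intro h
    have : ReflRel c (fun j t => B t j) :=
      ⟨fun j => funext fun t => (h t).sq j, funext fun t => by simpa using (h t).sum⟩
    exact this.map (blockDiagonalHom F)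

theorem trace_dsum {τ : Type*} [Fintype τ] [DecidableEq τ] {F : τ → Type*} [∀ t, Fintype (F t)]
    (B : ∀ t, Fin 4 → Matrix (F t) (F t) ℂ) (j : Fin 4) :
    (dsum B j).trace = ∑ t, (B t j).trace :=
  trace_blockDiagonal' _

/-- The value of `centralElt p q` on a family with given scalars. -/
def charValue (p : Fin 4 → Fin 4 → ℂ) (q : Fin 4 → Fin 4 → Fin 4 → ℂ) (σ : Fin 4 → Fin 4 → ℂ)
    (ω : Fin 4 → Fin 4 → Fin 4 → ℂ) : ℂ :=
  ∑ i, ∑ j, p i j * (2 * σ i j) + ∑ i, ∑ j, ∑ k, q i j k * ω i j k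

theorem HasChar.centralElt_eq {ι : Type*} [Fintype ι] [DecidableEq ι] {r : Fin 4 → Matrix ι ι ℂ}
    {σ : Fin 4 → Fin 4 → ℂ} {ω : Fin 4 → Fin 4 → Fin 4 → ℂ} (h : HasChar r σ ω)
    (p : Fin 4 → Fin 4 → ℂ) (q : Fin 4 → Fin 4 → Fin 4 → ℂ) :
    centralElt p q r = charValue p q σ ω • 1 := by
  simp only [centralElt, charValue, h.acomm_eq, h.tri_eq, smul_smul, add_smul, Finset.sum_smul]

theorem centralElt_dsum {B : ∀ t, Fin 4 → Matrix (F t) (F t) ℂ} {σ : τ → Fin 4 → Fin 4 → ℂ}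
    {ω : τ → Fin 4 → Fin 4 → Fin 4 → ℂ} (h : ∀ t, HasChar (B t) (σ t) (ω t))
    (p : Fin 4 → Fin 4 → ℂ) (q : Fin 4 → Fin 4 → Fin 4 → ℂ) :
    centralElt p q (dsum B) = diagonal fun x => charValue p q (σ x.1) (ω x.1) := by
  have h1 := map_centralElt (blockDiagonalHom F) p q (fun j t => B t j)
  have h2 : centralElt p q (fun j t => B t j) = fun t => charValue p q (σ t) (ω t) • 1 := by
    funext t
    rw [← (h t).centralElt_eq]
    exact map_centralElt (Pi.evalAlgHom ℂ (fun t => Matrix (F t) (F t) ℂ) t) p q _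
  rw [h2, blockDiagonalHom_apply] at h1
  change centralElt p q (fun j => blockDiagonal' fun t => B t j) = _
  have h3 : (fun j => (blockDiagonalHom F) ((fun j t => B t j) j)) =
    fun j => blockDiagonal' fun t => B t j := rfl
  rw [← h3, ← h1]
  ext ⟨t, x⟩ ⟨t', y⟩
  rw [blockDiagonal'_apply, diagonal_apply]
  by_cases ht : t = t'
  · subst ht
    by_cases hx : x = y <;> simp [hx]
  · simp [ht]

theorem Similar.dsum {F' : τ → Type*} [∀ t, Fintype (F' t)] [∀ t, DecidableEq (F' t)]
    {B : ∀ t, Fin 4 → Matrix (F t) (F t) ℂ} {B' : ∀ t, Fin 4 → Matrix (F' t) (F' t) ℂ}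
    (h : ∀ t, Similar (B t) (B' t)) : Similar (dsum B) (dsum B') := by
  choose P Q h1 h2 h3 using h
  refine ⟨blockDiagonal' P, blockDiagonal' Q, ?_, ?_, fun j => ?_⟩
  · rw [← blockDiagonal'_mul, ← blockDiagonal'_one]
    exact congrArg _ (funext h1)
  · rw [← blockDiagonal'_mul, ← blockDiagonal'_one]
    exact congrArg _ (funext h2)
  · rw [DSP.dsum, DSP.dsum, ← blockDiagonal'_mul, ← blockDiagonal'_mul]
    exact congrArg _ (funext fun t => h3 t j)

theorem similar_dsum_comp {τ' : Type*} [Fintype τ'] [DecidableEq τ'] (e : τ' ≃ τ)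
    (B : ∀ t, Fin 4 → Matrix (F t) (F t) ℂ) :
    Similar (dsum fun t' => B (e t')) (dsum B) := by
  have := Similar.reindex (dsum fun t' => B (e t')) (Equiv.sigmaCongrLeft e)
  convert this using 2 with j
  ext x y
  obtain ⟨⟨t, x⟩, rfl⟩ := (Equiv.sigmaCongrLeft (β := F) e).surjective x
  obtain ⟨⟨t', y⟩, rfl⟩ := (Equiv.sigmaCongrLeft (β := F) e).surjective y
  rw [reindex_apply, submatrix_apply, Equiv.symm_apply_apply, Equiv.symm_apply_apply]
  simp only [dsum, Equiv.sigmaCongrLeft_apply]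
  by_cases ht : t = t'
  · subst ht
    rw [blockDiagonal'_apply_eq, blockDiagonal'_apply_eq]
  · rw [blockDiagonal'_apply_ne _ _ _ ht, blockDiagonal'_apply_ne _ _ _ (e.injective.ne ht)]

/-- A family whose entries vanish between different fibres of `lab` is the direct sum of its
restrictions to the fibres. -/
theorem dsum_toSquareBlock {τ : Type*} [DecidableEq τ] {ι : Type*} (r : Fin 4 → Matrix ι ι ℂ) (lab : ι → τ)
    (h : ∀ j x y, lab x ≠ lab y → r j x y = 0) :
    (dsum fun t j => (r j).toSquareBlock lab t) = fun j =>
      reindex (Equiv.sigmaFiberEquiv lab).symm (Equiv.sigmaFiberEquiv lab).symm (r j) := by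
  funext j
  ext ⟨t, x, hx⟩ ⟨t', y, hy⟩
  rw [reindex_apply, submatrix_apply, Equiv.symm_symm]
  simp only [dsum, Equiv.sigmaFiberEquiv_apply]
  by_cases ht : t = t'
  · subst ht
    rw [blockDiagonal'_apply_eq]
    rfl
  · rw [blockDiagonal'_apply_ne _ _ _ ht, h]
    rw [hx, hy]
    exact ht

/-- The matrices that commute with all the matrices of the family. -/
def cent {ι : Type*} [Fintype ι] (r : Fin 4 → Matrix ι ι ℂ) : Submodule ℂ (Matrix ι ι ℂ) where
  carrier := {Z | ∀ j, Z * r j = r j * Z}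
  add_mem' h h' j := by rw [Matrix.add_mul, Matrix.mul_add, h, h']
  zero_mem' j := by rw [Matrix.zero_mul, Matrix.mul_zero]
  smul_mem' x Z h j := by rw [Matrix.smul_mul, Matrix.mul_smul, h]

theorem Similar.finrank_cent {ι κ : Type*} [Fintype ι] [DecidableEq ι] [Fintype κ]
    [DecidableEq κ] {r : Fin 4 → Matrix ι ι ℂ} {r' : Fin 4 → Matrix κ κ ℂ} (h : Similar r r') :
    Module.finrank ℂ (cent r) = Module.finrank ℂ (cent r') := by
  obtain ⟨f, hf⟩ := h.exists_algEquiv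
  have e : cent r = (cent r').map f.toLinearMap := by
    ext Z
    constructor
    · intro hZ
      refine ⟨f.symm Z, fun j => f.injective ?_, f.apply_symm_apply Z⟩
      rw [map_mul, map_mul, f.apply_symm_apply, hf, hZ j]
    · rintro ⟨Z, hZ, rfl⟩ j
      change f Z * r j = r j * f Z
      rw [← hf, ← map_mul, hZ j, map_mul]
  rw [e]
  exact LinearEquiv.finrank_map_eq f.toLinearEquiv (cent r')

/-- The matrices commuting with a direct sum of families with trivial centralizers that are told
apart by a central element. -/
theorem mem_cent_dsum_iff {B : ∀ t, Fin 4 → Matrix (F t) (F t) ℂ} (hB : ∀ t, Brick (B t))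
    {ζ : τ → ℂ} (hζ : Function.Injective ζ)
    (hz : ∀ Z ∈ cent (dsum B), Commute Z (diagonal fun x : Σ t, F t => ζ x.1))
    {Z : Matrix (Σ t, F t) (Σ t, F t) ℂ} :
    Z ∈ cent (dsum B) ↔ ∃ f : τ → ℂ, Z = diagonal fun x => f x.1 := by
  constructor
  · intro hZ
    have h1 : ∀ x y : Σ t, F t, x.1 ≠ y.1 → Z x y = 0 := by
      intro x y hxy
      have := congrFun (congrFun (hz Z hZ).eq x) y
      rw [mul_diagonal, diagonal_mul, mul_comm, ← sub_eq_zero, ← sub_mul] at this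
      exact (mul_eq_zero.1 this).resolve_left (sub_ne_zero.2 (hζ.ne (Ne.symm hxy)))
    have h2 : Z = blockDiagonal' fun t => of fun x y => Z ⟨t, x⟩ ⟨t, y⟩ := by
      ext ⟨t, x⟩ ⟨t', y⟩
      by_cases ht : t = t'
      · subst ht; rw [blockDiagonal'_apply_eq]; rfl
      · rw [blockDiagonal'_apply_ne _ _ _ ht, h1 _ _ ht]
    generalize (fun t => of fun x y => Z ⟨t, x⟩ ⟨t, y⟩ : ∀ t, Matrix (F t) (F t) ℂ) = Y at h2
    subst h2
    have h3 : ∀ t, ∃ a : ℂ, Y t = a • 1 := fun t => hB t (Y t) fun j => by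
      have := hZ j
      rw [dsum, ← blockDiagonal'_mul, ← blockDiagonal'_mul, blockDiagonal'_inj] at this
      exact congrFun this t
    choose f hf using h3
    refine ⟨f, ?_⟩
    ext ⟨t, x⟩ ⟨t', y⟩
    rw [blockDiagonal'_apply, diagonal_apply]
    by_cases ht : t = t'
    · subst ht
      by_cases hx : x = y <;> simp [hx, hf]
    · simp [ht]
  · rintro ⟨f, rfl⟩ j
    ext ⟨t, x⟩ ⟨t', y⟩
    rw [mul_diagonal, diagonal_mul, mul_comm]
    by_cases ht : t = t'
    · subst ht; rfl
    · rw [dsum, blockDiagonal'_apply_ne _ _ _ ht, zero_mul, zero_mul]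

theorem finrank_cent_dsum [∀ t, Nonempty (F t)] {B : ∀ t, Fin 4 → Matrix (F t) (F t) ℂ}
    (hB : ∀ t, Brick (B t)) {ζ : τ → ℂ} (hζ : Function.Injective ζ)
    (hz : ∀ Z ∈ cent (dsum B), Commute Z (diagonal fun x : Σ t, F t => ζ x.1)) :
    Module.finrank ℂ (cent (dsum B)) = Fintype.card τ := by
  let D : (τ → ℂ) →ₗ[ℂ] Matrix (Σ t, F t) (Σ t, F t) ℂ :=
    { toFun := fun f => diagonal fun x => f x.1
      map_add' := fun f g => by rw [diagonal_add]; rfl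
      map_smul' := fun a f => by rw [← diagonal_smul]; rfl }
  have hD : Function.Injective D := by
    intro f g h
    funext t
    obtain ⟨x⟩ := ‹∀ t, Nonempty (F t)› t
    exact congrFun (diagonal_injective h) ⟨t, x⟩
  have e : cent (dsum B) = LinearMap.range D := by
    ext Z
    rw [mem_cent_dsum_iff hB hζ hz]
    exact ⟨fun ⟨f, hf⟩ => ⟨f, hf.symm⟩, fun ⟨f, hf⟩ => ⟨f, hf.symm⟩⟩
  rw [e, LinearMap.finrank_range_of_inj hD, Module.finrank_fintype_fun_eq_card]

end DirectSum

section Blocks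

/-- The sizes of the blocks: one of size `m` and `s` of size `2`. -/
def blockSize (m : ℕ) {s : ℕ} (t : Option (Fin s)) : ℕ := t.elim m fun _ => 2

variable {m s : ℕ}

/-- The blocks of a quadruple, with the large block in position `none`. -/
def blocks (b : Fin s → Fin 4 → Matrix (Fin 2) (Fin 2) ℂ) (h : Fin 4 → Matrix (Fin m) (Fin m) ℂ) :
    ∀ t : Option (Fin s), Fin 4 → Matrix (Fin (blockSize m t)) (Fin (blockSize m t)) ℂ
  | none => h
  | some i => b i

/-- The positions in the two ways to write a block-diagonal matrix. -/
def blockEquiv (m s : ℕ) :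
    (Fin 2 × Fin s) ⊕ Fin m ≃ Σ t : Option (Fin s), Fin (blockSize m t) where
  toFun := Sum.elim (fun x => ⟨some x.2, x.1⟩) (fun y => ⟨none, y⟩)
  invFun := fun x => match x with
    | ⟨none, y⟩ => Sum.inr y
    | ⟨some i, x⟩ => Sum.inl (x, i)
  left_inv := by rintro (⟨x, i⟩ | y) <;> rfl
  right_inv := by rintro ⟨_ | i, x⟩ <;> rfl

theorem similar_blocks (b : Fin s → Fin 4 → Matrix (Fin 2) (Fin 2) ℂ)
    (h : Fin 4 → Matrix (Fin m) (Fin m) ℂ) :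
    Similar (fun j => (fromBlocks (blockDiagonal fun i => b i j) 0 0 (h j) :
      Matrix ((Fin 2 × Fin s) ⊕ Fin m) ((Fin 2 × Fin s) ⊕ Fin m) ℂ)) (dsum (blocks b h)) := by
  convert Similar.reindex _ (blockEquiv m s) using 2 with j
  ext x y
  obtain ⟨x, rfl⟩ := (blockEquiv m s).surjective x
  obtain ⟨y, rfl⟩ := (blockEquiv m s).surjective y
  rw [reindex_apply, submatrix_apply, Equiv.symm_apply_apply, Equiv.symm_apply_apply]
  rcases x with ⟨x, i⟩ | x <;> rcases y with ⟨y, i'⟩ | y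
  · rw [fromBlocks_apply₁₁, blockDiagonal_apply]
    by_cases hi : i = i'
    · subst hi
      rw [if_pos rfl]
      exact blockDiagonal'_apply_eq (fun t => blocks b h t j) (some i) x y
    · rw [if_neg hi]
      exact blockDiagonal'_apply_ne (fun t => blocks b h t j) _ _ (by simpa using hi)
  · exact blockDiagonal'_apply_ne (fun t => blocks b h t j) _ _ (by simp)
  · exact blockDiagonal'_apply_ne (fun t => blocks b h t j) _ _ (by simp)
  · exact blockDiagonal'_apply_eq (fun t => blocks b h t j) none x y

end Blocks
end DSP

/-! ### A criterion for local smoothness by curves -/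

namespace DSP

open MvPolynomial

/-- The differential at `x` of the polynomial function defined by `p`. -/
noncomputable def pdiff {ι : Type*} [Fintype ι] (x : ι → ℂ) (p : MvPolynomial ι ℂ) :
    (ι → ℂ) →ₗ[ℂ] ℂ :=
  ∑ i, eval x (pderiv i p) • LinearMap.proj i

section Criterion

variable {ι : Type*}

theorem pdiff_apply [Fintype ι] (x v : ι → ℂ) (p : MvPolynomial ι ℂ) :
    pdiff x p v = ∑ i, eval x (pderiv i p) * v i := by
  simp [pdiff]

theorem hasDerivAt_eval [Fintype ι] {φ : ℂ → ι → ℂ} {v : ι → ℂ} {t : ℂ} (hφ : HasDerivAt φ v t)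
    (p : MvPolynomial ι ℂ) :
    HasDerivAt (fun s => eval (φ s) p) (pdiff (φ t) p v) t := by
  classical
  have hφ' := hasDerivAt_pi.1 hφ
  induction p using MvPolynomial.induction_on with
  | C a => simpa [pdiff_apply] using hasDerivAt_const t a
  | add p q hp hq =>
    rw [show (fun s => eval (φ s) (p + q)) = fun s => eval (φ s) p + eval (φ s) q from
      funext fun _ => map_add ..]
    refine (hp.add hq).congr_deriv ?_
    simp [pdiff_apply, add_mul, Finset.sum_add_distrib]
  | mul_X p i hp =>
    rw [show (fun s => eval (φ s) (p * X i)) = fun s => eval (φ s) p * φ s i from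
      funext fun _ => by rw [map_mul, eval_X]]
    refine (hp.mul (hφ' i)).congr_deriv ?_
    simp only [pdiff_apply, Derivation.leibniz, smul_eq_mul, map_add, map_mul, eval_X, pderiv_X,
      add_mul, Finset.sum_add_distrib, Finset.sum_mul]
    rw [add_comm]
    congr 1
    · rw [Finset.sum_eq_single i]
      · simp
      · intro j _ hj
        simp [hj]
      · simp
    · exact Finset.sum_congr rfl fun j _ => by ring

/-- Along a curve through the origin with velocity `v`, a polynomial without terms of degree less
than `N` grows like the value at `v` of its homogeneous component of degree `N`. -/
theorem tendsto_eval_div_pow [Fintype ι] {φ : ℂ → ι → ℂ} {v : ι → ℂ} (h0 : φ 0 = 0)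
    (hφ : HasDerivAt φ v 0) {N : ℕ} {q : MvPolynomial ι ℂ} (hq : q ∈ idealOfVars ι ℂ ^ N) :
    Filter.Tendsto (fun t => eval (φ t) q / t ^ N) (nhdsWithin 0 {0}ᶜ)
      (nhds (eval v (homogeneousComponent N q))) := by
  have hsl : ∀ i, Filter.Tendsto (fun t => φ t i / t) (nhdsWithin 0 {0}ᶜ) (nhds (v i)) := by
    intro i
    have h := hasDerivAt_iff_tendsto_slope.1 (hasDerivAt_pi.1 hφ i)
    refine h.congr fun t => ?_
    simp [slope_def_field, h0]
  rw [mem_pow_idealOfVars_iff] at hq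
  have hid : Filter.Tendsto (fun t : ℂ => t) (nhdsWithin 0 {0}ᶜ) (nhds 0) :=
    Filter.tendsto_id.mono_left nhdsWithin_le_nhds
  have key : ∀ d ∈ q.support, Filter.Tendsto
      (fun t => coeff d q * (∏ i, (φ t i / t) ^ d i) * t ^ (d.degree - N)) (nhdsWithin 0 {0}ᶜ)
      (nhds (coeff d q * (∏ i, (v i) ^ d i) * 0 ^ (d.degree - N))) := fun d _ =>
    (tendsto_const_nhds.mul (tendsto_finsetProd _ fun i _ => (hsl i).pow _)).mul (hid.pow _)
  have hsum := tendsto_finsetSum _ key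
  refine Filter.Tendsto.congr' ?_ (hsum.trans_eq ?_)
  · filter_upwards [self_mem_nhdsWithin] with t ht
    have ht : t ≠ 0 := ht
    rw [eval_eq', Finset.sum_div]
    refine Finset.sum_congr rfl fun d hd => ?_
    have h1 : t ^ d.degree = t ^ N * t ^ (d.degree - N) := by
      rw [← pow_add, Nat.add_sub_cancel' (hq d hd)]
    have h2 : ∏ i, (φ t i / t) ^ d i = (∏ i, φ t i ^ d i) / t ^ d.degree := by
      simp_rw [div_pow]
      rw [Finset.prod_div_distrib, Finset.prod_pow_eq_pow_sum, Finsupp.degree_eq_sum]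
    rw [h2, h1]
    field_simp
  · congr 1
    rw [homogeneousComponent_apply, map_sum, Finset.sum_filter]
    refine Finset.sum_congr rfl fun d hd => ?_
    split_ifs with h
    · simp [h, eval_monomial, Finsupp.prod_fintype]
    · have : d.degree - N ≠ 0 := by have := hq d hd; omega
      simp [this]

theorem sub_homogeneousComponent_mem {N : ℕ} {q : MvPolynomial ι ℂ}
    (hq : q ∈ idealOfVars ι ℂ ^ N) :
    q - homogeneousComponent N q ∈ idealOfVars ι ℂ ^ (N + 1) := by
  rw [mem_pow_idealOfVars_iff'] at hq ⊢
  intro d hd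
  rw [coeff_sub, coeff_homogeneousComponent]
  split_ifs with h
  · simp
  · rw [hq d (by omega), sub_zero]

theorem homogeneousComponent_mem_pow {N : ℕ} (q : MvPolynomial ι ℂ) :
    homogeneousComponent N q ∈ idealOfVars ι ℂ ^ N := by
  rw [mem_pow_idealOfVars_iff']
  intro d hd
  rw [coeff_homogeneousComponent, if_neg (by omega)]

theorem eval_aeval {τ : Type*} (v : τ → ℂ) (σ : ι → MvPolynomial τ ℂ) (p : MvPolynomial ι ℂ) :
    eval v (aeval σ p) = eval (fun a => eval v (σ a)) p := by
  induction p using MvPolynomial.induction_on with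
  | C a => simp
  | add p q hp hq => rw [map_add, map_add, map_add, hp, hq]
  | mul_X p i hp => rw [map_mul, map_mul, map_mul, hp, aeval_X, eval_X]

theorem sub_aeval_mem {L : Ideal (MvPolynomial ι ℂ)} {σ : ι → MvPolynomial ι ℂ}
    (hσ : ∀ i, X i - σ i ∈ L) (p : MvPolynomial ι ℂ) : p - aeval σ p ∈ L := by
  induction p using MvPolynomial.induction_on with
  | C a => simp
  | add p q hp hq =>
    rw [map_add, add_sub_add_comm]
    exact L.add_mem hp hq
  | mul_X p i hp =>
    have : p * X i - aeval σ (p * X i) = (p - aeval σ p) * X i + aeval σ p * (X i - σ i) := by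
      simp; ring
    rw [this]
    exact L.add_mem (L.mul_mem_right _ hp) (L.mul_mem_left _ (hσ i))

theorem sub_aeval_mem_mul_pow {L : Ideal (MvPolynomial ι ℂ)} {σ : ι → MvPolynomial ι ℂ}
    (hσ : ∀ i, X i - σ i ∈ L) (hσ' : ∀ i, σ i ∈ idealOfVars ι ℂ) (N : ℕ) :
    ∀ q ∈ idealOfVars ι ℂ ^ N, q - aeval σ q ∈ L * idealOfVars ι ℂ ^ (N - 1) := by
  have hm : ∀ a ∈ idealOfVars ι ℂ, aeval σ a ∈ idealOfVars ι ℂ := by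
    intro a ha
    have : (idealOfVars ι ℂ) ≤ (idealOfVars ι ℂ).comap (aeval σ) := by
      rw [idealOfVars, Ideal.span_le]
      rintro _ ⟨i, rfl⟩
      simpa using hσ' i
    exact this ha
  induction N with
  | zero => intro q _; simpa using sub_aeval_mem hσ q
  | succ N ih =>
    intro q hq
    rw [pow_succ'] at hq
    refine Submodule.mul_induction_on hq (fun a ha b hb => ?_) (fun p q hp hq => ?_)
    · have : a * b - aeval σ (a * b) = (a - aeval σ a) * b + aeval σ a * (b - aeval σ b) := by
        simp; ring
      rw [this, Nat.add_sub_cancel]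
      refine Ideal.add_mem _ (Ideal.mul_mem_mul (sub_aeval_mem hσ a) hb) ?_
      rcases N with _ | N
      · exact Ideal.mul_mem_left _ _ (by simpa using ih b hb)
      · have h := Ideal.mul_mem_mul (hm a ha) (ih b hb)
        rw [Nat.add_sub_cancel] at h
        rwa [pow_succ', mul_left_comm]
    · rw [map_add, add_sub_add_comm]
      exact Ideal.add_mem _ hp hq

/-- The linear part at the origin of a polynomial. -/
noncomputable def linPart [Fintype ι] (p : MvPolynomial ι ℂ) : MvPolynomial ι ℂ :=
  ∑ i, C (eval 0 (pderiv i p)) * X i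

theorem eval_linPart [Fintype ι] (p : MvPolynomial ι ℂ) (v : ι → ℂ) :
    eval v (linPart p) = pdiff 0 p v := by
  simp [linPart, pdiff_apply]

theorem sub_linPart_mem [Fintype ι] {p : MvPolynomial ι ℂ} (hp : eval 0 p = 0) :
    p - linPart p ∈ idealOfVars ι ℂ ^ 2 := by
  have hp' : constantCoeff p = 0 := by simpa using hp
  have h1 : p ∈ idealOfVars ι ℂ ^ 1 := by
    rw [mem_pow_idealOfVars_iff']
    intro d hd
    have : d = 0 := by rw [← Finsupp.degree_eq_zero_iff]; omega
    rw [this]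
    exact hp'
  have h2 : homogeneousComponent 1 p = linPart p := by
    refine MvPolynomial.funext fun v => ?_
    have hφ : HasDerivAt (fun t : ℂ => t • v) v 0 := by
      simpa using (hasDerivAt_id (0 : ℂ)).smul_const v
    have ha := tendsto_eval_div_pow (by simp) hφ h1
    have hb := hasDerivAt_iff_tendsto_slope.1 (hasDerivAt_eval hφ p)
    rw [eval_linPart]
    refine tendsto_nhds_unique ha ?_
    simp only [zero_smul] at hb
    refine hb.congr fun t => ?_
    simp [slope_def_field, hp']
  rw [← h2]
  exact sub_homogeneousComponent_mem h1

theorem exists_dual_vectors {V : Type*} [AddCommGroup V] [Module ℂ V] [FiniteDimensional ℂ V]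
    {κ : Type*} [DecidableEq κ] {l : κ → Module.Dual ℂ V} (hl : LinearIndependent ℂ l) :
    ∃ e : κ → V, ∀ i j, l i (e j) = if i = j then 1 else 0 := by
  have h : ∀ j, ∃ v : V, ∀ i, l i v = if i = j then 1 else 0 := by
    intro j
    obtain ⟨F, hF⟩ := LinearMap.exists_extend ((Finsupp.lapply j).comp hl.repr)
    refine ⟨(Module.evalEquiv ℂ V).symm F, fun i => ?_⟩
    rw [Module.apply_evalEquiv_symm_apply]
    have := LinearMap.congr_fun hF ⟨l i, Submodule.subset_span ⟨i, rfl⟩⟩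
    simp only [LinearMap.comp_apply, Submodule.subtype_apply] at this
    rw [this, hl.repr_eq_single i _ rfl]
    simp [Finsupp.single_apply]
  choose e he using h
  exact ⟨e, fun i j => he j i⟩

/-- Polynomials that vanish along the curves with velocity `v` through the origin, for every `v` in
the common kernel of the independent differentials of the `f i`, belong to the ideal of the `f i`
up to terms of arbitrarily high order. -/
theorem mem_span_sup_pow [Fintype ι] {c : ℕ} {f : Fin c → MvPolynomial ι ℂ}
    (hf0 : ∀ i, eval 0 (f i) = 0) (hind : LinearIndependent ℂ fun i => pdiff 0 (f i))
    {φ : (ι → ℂ) → ℂ → ι → ℂ} (hφ0 : ∀ v, φ v 0 = 0)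
    (hφ : ∀ v, (∀ i, pdiff 0 (f i) v = 0) → HasDerivAt (φ v) v 0)
    (hfφ : ∀ v, (∀ i, pdiff 0 (f i) v = 0) →
      ∀ᶠ t in nhdsWithin 0 {0}ᶜ, ∀ i, eval (φ v t) (f i) = 0)
    (N : ℕ) {p : MvPolynomial ι ℂ} (hp : ∀ v, (∀ i, pdiff 0 (f i) v = 0) →
      ∀ᶠ t in nhdsWithin 0 {0}ᶜ, eval (φ v t) p = 0) :
    p ∈ Ideal.span (Set.range f) ⊔ idealOfVars ι ℂ ^ N := by
  obtain ⟨e, he⟩ := exists_dual_vectors hind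
  set m := idealOfVars ι ℂ with hm
  set I := Ideal.span (Set.range f) with hI
  let L : Ideal (MvPolynomial ι ℂ) := Ideal.span (Set.range fun i => linPart (f i))
  let σ : ι → MvPolynomial ι ℂ := fun a => X a - ∑ i, linPart (f i) * C (e i a)
  have hσ : ∀ a, X a - σ a ∈ L := by
    intro a
    simp only [σ, sub_sub_cancel]
    exact Ideal.sum_mem _ fun i _ => Ideal.mul_mem_right _ _ (Ideal.subset_span ⟨i, rfl⟩)
  have hX : ∀ a, (X a : MvPolynomial ι ℂ) ∈ m := fun a => Ideal.subset_span ⟨a, rfl⟩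
  have hσ' : ∀ a, σ a ∈ m := by
    intro a
    refine Ideal.sub_mem _ (hX a) (Ideal.sum_mem _ fun i _ => Ideal.mul_mem_right _ _ ?_)
    exact Ideal.sum_mem _ fun j _ => Ideal.mul_mem_left _ _ (hX j)
  have hπ : ∀ v : ι → ℂ, ∀ i, pdiff 0 (f i) (fun a => eval v (σ a)) = 0 := by
    intro v i
    have : (fun a => eval v (σ a)) = v - ∑ j, pdiff 0 (f j) v • e j := by
      ext a
      simp [σ, eval_linPart]
    rw [this, map_sub, map_sum]
    simp [he]
  have hL : ∀ N, L * m ^ N ≤ I ⊔ m ^ (N + 2) := by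
    intro N
    rw [Ideal.mul_le]
    intro a ha b hb
    refine Submodule.span_induction (p := fun a _ => a * b ∈ I ⊔ m ^ (N + 2)) ?_ ?_ ?_ ?_ ha
    · rintro _ ⟨i, rfl⟩
      have : linPart (f i) * b = f i * b + -((f i - linPart (f i)) * b) := by ring
      simp only [this]
      refine Submodule.add_mem_sup (Ideal.mul_mem_right _ _ (Ideal.subset_span ⟨i, rfl⟩)) ?_
      rw [neg_mem_iff, add_comm N, pow_add]
      exact Ideal.mul_mem_mul (sub_linPart_mem (hf0 i)) hb
    · simp
    · intro x y _ _ hx hy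
      rw [add_mul]
      exact Ideal.add_mem _ hx hy
    · intro r x _ hx
      rw [smul_eq_mul, mul_assoc]
      exact Ideal.mul_mem_left _ _ hx
  induction N with
  | zero => simp
  | succ N ih =>
    obtain ⟨i, hi, q, hq, rfl⟩ := Submodule.mem_sup.1 ih
    have hqφ : ∀ v, (∀ i, pdiff 0 (f i) v = 0) →
        ∀ᶠ t in nhdsWithin 0 {0}ᶜ, eval (φ v t) q = 0 := by
      intro v hv
      filter_upwards [hp v hv, hfφ v hv] with t h1 h2
      have h3 : eval (φ v t) i = 0 := by
        have : I ≤ RingHom.ker (eval (φ v t)) := by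
          rw [hI, Ideal.span_le]
          rintro _ ⟨j, rfl⟩
          exact h2 j
        exact this hi
      rwa [map_add, h3, zero_add] at h1
    -- the leading form of `q` vanishes on the tangent space
    have hlead : ∀ v, (∀ i, pdiff 0 (f i) v = 0) → eval v (homogeneousComponent N q) = 0 := by
      intro v hv
      refine tendsto_nhds_unique (tendsto_eval_div_pow (hφ0 v) (hφ v hv) hq) ?_
      refine (tendsto_const_nhds (x := (0 : ℂ))).congr' ?_
      filter_upwards [hqφ v hv] with t ht
      simp [ht]
    have hσP : aeval σ (homogeneousComponent N q) = 0 := by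
      refine MvPolynomial.funext fun v => ?_
      rw [map_zero, ← hlead _ (hπ v), eval_aeval]
    have hP : homogeneousComponent N q ∈ I ⊔ m ^ (N + 1) := by
      rcases N with _ | N
      · have h := hlead 0 (by simp)
        rw [homogeneousComponent_zero] at h ⊢
        rw [eval_C] at h
        simp [h]
      · have h := sub_aeval_mem_mul_pow hσ hσ' _ _ (homogeneousComponent_mem_pow (N := N + 1) q)
        rw [hσP, sub_zero, Nat.add_sub_cancel] at h
        exact hL N h
    have hq' : q ∈ I ⊔ m ^ (N + 1) := by
      have := Ideal.add_mem _ hP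
        ((le_sup_right : m ^ (N + 1) ≤ I ⊔ _) (sub_homogeneousComponent_mem hq))
      rwa [add_sub_cancel] at this
    exact Ideal.add_mem _ ((le_sup_left : I ≤ _) hi) hq'

/-- Krull's intersection theorem at the origin of affine space. -/
theorem exists_mul_mem_of_mem_sup_pow [Fintype ι] {I : Ideal (MvPolynomial ι ℂ)}
    {p : MvPolynomial ι ℂ} (hp : ∀ N, p ∈ I ⊔ idealOfVars ι ℂ ^ N) :
    ∃ h : MvPolynomial ι ℂ, eval 0 h = 1 ∧ h * p ∈ I := by
  let J := (idealOfVars ι ℂ).map (Ideal.Quotient.mk I)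
  have h1 : Ideal.Quotient.mk I p ∈ (⨅ i : ℕ, J ^ i • (⊤ : Submodule (MvPolynomial ι ℂ ⧸ I)
      (MvPolynomial ι ℂ ⧸ I))) := by
    rw [Submodule.mem_iInf]
    intro N
    obtain ⟨i, hi, q, hq, rfl⟩ := Submodule.mem_sup.1 (hp N)
    rw [map_add, Ideal.Quotient.eq_zero_iff_mem.2 hi, zero_add, smul_eq_mul, Ideal.mul_top]
    rw [← Ideal.map_pow]
    exact Ideal.mem_map_of_mem _ hq
  obtain ⟨⟨r, hr⟩, hrp⟩ := (Ideal.mem_iInf_smul_pow_eq_bot_iff J _).1 h1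
  obtain ⟨r, hr', rfl⟩ := (Ideal.mem_map_iff_of_surjective _ Ideal.Quotient.mk_surjective).1 hr
  refine ⟨1 - r, ?_, ?_⟩
  · have : idealOfVars ι ℂ ≤ RingHom.ker (eval (0 : ι → ℂ)) := by
      rw [idealOfVars, Ideal.span_le]
      rintro _ ⟨j, rfl⟩
      simp
    have h : eval (0 : ι → ℂ) r = 0 := this hr'
    rw [map_sub, h, map_one, sub_zero]
  · rw [← Ideal.Quotient.eq_zero_iff_mem, map_mul, map_sub, map_one, sub_mul, one_mul]
    simp only [smul_eq_mul] at hrp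
    rw [hrp, sub_self]

/-- The translation of a polynomial function by the vector `x`. -/
noncomputable def translate (x : ι → ℂ) : MvPolynomial ι ℂ →ₐ[ℂ] MvPolynomial ι ℂ :=
  aeval fun i => X i + C (x i)

theorem eval_translate (x y : ι → ℂ) (p : MvPolynomial ι ℂ) :
    eval y (translate x p) = eval (y + x) p := by
  rw [translate, eval_aeval]
  congr 2
  ext i
  simp

theorem pdiff_translate [Fintype ι] (x : ι → ℂ) (p : MvPolynomial ι ℂ) :
    pdiff 0 (translate x p) = pdiff x p := by
  refine LinearMap.ext fun w => ?_
  have h0 : HasDerivAt (fun t : ℂ => t • w) w 0 := by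
    simpa using (hasDerivAt_id (0 : ℂ)).smul_const w
  have h1 := hasDerivAt_eval h0 (translate x p)
  have h2 := hasDerivAt_eval (h0.add_const x) p
  simp only [eval_translate] at h1
  simpa using h1.unique h2

/-- A closed algebraic set all of whose Zariski tangent vectors at the point `x` are velocities of
curves in the set is near `x` a smooth complete intersection: the equations `f i` with independent
differentials cut it out, because each of the other equations vanishes along enough curves to lie
in the ideal of the `f i` up to terms of arbitrarily high order. -/
theorem exists_local_equations [Fintype ι] {κ : Type*} [Fintype κ]
    (g : κ → MvPolynomial ι ℂ) (x : ι → ℂ) (hx : ∀ a, eval x (g a) = 0) {d : ℕ}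
    (hd : Module.finrank ℂ (⨅ a, LinearMap.ker (pdiff x (g a)) : Submodule ℂ (ι → ℂ)) = d)
    (hcurve : ∀ v, (∀ a, pdiff x (g a) v = 0) → ∃ φ : ℂ → ι → ℂ, φ 0 = x ∧ HasDerivAt φ v 0 ∧
      ∀ᶠ t in nhdsWithin 0 {0}ᶜ, ∀ a, eval (φ t) (g a) = 0) :
    ∃ (c : ℕ) (h : MvPolynomial ι ℂ) (f : Fin c → MvPolynomial ι ℂ),
      c + d = Fintype.card ι ∧ eval x h ≠ 0 ∧
      (∀ y, eval y h ≠ 0 → ((∀ a, eval y (g a) = 0) ↔ ∀ i, eval y (f i) = 0)) ∧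
      LinearIndependent ℂ (fun (i : Fin c) (v : ι) => eval x (pderiv v (f i))) := by
  classical
  obtain ⟨κ', a, ha, hspan, hind⟩ := exists_linearIndependent' ℂ (fun b => pdiff x (g b))
  have : Fintype κ' := Fintype.ofInjective a ha
  let eq := (Fintype.equivFin κ').symm
  set c := Fintype.card κ'
  let f : Fin c → MvPolynomial ι ℂ := fun i => g (a (eq i))
  have hindf : LinearIndependent ℂ fun i => pdiff x (f i) := hind.comp eq eq.injective
  have hker : ∀ v, (∀ i, pdiff x (f i) v = 0) ↔ ∀ b, pdiff x (g b) v = 0 := by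
    intro v
    refine ⟨fun h b => ?_, fun h i => h _⟩
    have h1 : Submodule.span ℂ (Set.range ((fun b => pdiff x (g b)) ∘ a)) ≤
        LinearMap.ker (LinearMap.applyₗ (R := ℂ) v : ((ι → ℂ) →ₗ[ℂ] ℂ) →ₗ[ℂ] ℂ) := by
      rw [Submodule.span_le]
      rintro _ ⟨j, rfl⟩
      have := h (eq.symm j)
      simpa [f] using this
    have h2 : pdiff x (g b) ∈ Submodule.span ℂ (Set.range ((fun b => pdiff x (g b)) ∘ a)) := by
      rw [hspan]
      exact Submodule.subset_span ⟨b, rfl⟩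
    simpa using h1 h2
  have hcd : c + d = Fintype.card ι := by
    obtain ⟨e, he⟩ := exists_dual_vectors hindf
    have hT : (⨅ a, LinearMap.ker (pdiff x (g a)) : Submodule ℂ (ι → ℂ)) =
        LinearMap.ker (LinearMap.pi fun i => pdiff x (f i)) := by
      ext v
      rw [Submodule.mem_iInf, LinearMap.mem_ker]
      simp only [LinearMap.mem_ker]
      rw [← hker, _root_.funext_iff]
      rfl
    have hs : LinearMap.range (LinearMap.pi fun i => pdiff x (f i)) = ⊤ := by
      rw [LinearMap.range_eq_top]
      intro w
      refine ⟨∑ j, w j • e j, ?_⟩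
      ext i
      simp [he]
    have := LinearMap.finrank_range_add_finrank_ker (LinearMap.pi fun i => pdiff x (f i))
    rw [hs, ← hT, hd, finrank_top] at this
    simpa using this
  have hφ : ∀ v, ∃ φ : ℂ → ι → ℂ, φ 0 = x ∧ ((∀ i, pdiff x (f i) v = 0) → HasDerivAt φ v 0 ∧
      ∀ᶠ t in nhdsWithin 0 {0}ᶜ, ∀ a, eval (φ t) (g a) = 0) := by
    intro v
    by_cases hv : ∀ i, pdiff x (f i) v = 0
    · obtain ⟨φ, h1, h2, h3⟩ := hcurve v ((hker v).1 hv)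
      exact ⟨φ, h1, fun _ => ⟨h2, h3⟩⟩
    · exact ⟨fun _ => x, rfl, fun h => absurd h hv⟩
  choose φ hφ0 hφ using hφ
  have hkr : ∀ b, ∃ h : MvPolynomial ι ℂ, eval x h = 1 ∧ h * g b ∈ Ideal.span (Set.range f) := by
    intro b
    have key : ∀ N, translate x (g b) ∈
        Ideal.span (Set.range fun i => translate x (f i)) ⊔ idealOfVars ι ℂ ^ N := by
      intro N
      refine mem_span_sup_pow (φ := fun v t => φ v t - x) ?_ ?_ ?_ ?_ ?_ N ?_
      · intro i
        rw [eval_translate, zero_add]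
        exact hx _
      · simpa only [pdiff_translate] using hindf
      · intro v
        simp [hφ0]
      · intro v hv
        simp only [pdiff_translate] at hv
        exact (hφ v hv).1.sub_const x
      · intro v hv
        simp only [pdiff_translate] at hv
        filter_upwards [(hφ v hv).2] with t ht i
        rw [eval_translate, sub_add_cancel]
        exact ht _
      · intro v hv
        simp only [pdiff_translate] at hv
        filter_upwards [(hφ v hv).2] with t ht
        rw [eval_translate, sub_add_cancel]
        exact ht _
    obtain ⟨h, h0, h1⟩ := exists_mul_mem_of_mem_sup_pow key
    refine ⟨translate (-x) h, by rw [eval_translate, add_neg_cancel, h0], ?_⟩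
    have hinv : ∀ p, translate (-x) (translate x p) = p := by
      intro p
      refine MvPolynomial.funext fun y => ?_
      rw [eval_translate, eval_translate, neg_add_cancel_right]
    have h2 := Ideal.mem_map_of_mem (translate (-x)) h1
    rw [Ideal.map_span, map_mul, hinv, ← Set.range_comp] at h2
    simpa only [Function.comp_def, hinv] using h2
  choose h hh0 hh using hkr
  refine ⟨c, ∏ b, h b, f, hcd, ?_, ?_, ?_⟩
  · rw [map_prod]
    simp [hh0]
  · intro y hy
    refine ⟨fun H i => H _, fun H b => ?_⟩
    have h1 : Ideal.span (Set.range f) ≤ RingHom.ker (eval y) := by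
      rw [Ideal.span_le]
      rintro _ ⟨j, rfl⟩
      exact H j
    have h2 : eval y (h b * g b) = 0 := h1 (hh b)
    rw [map_mul] at h2
    rw [map_prod] at hy
    exact (mul_eq_zero.1 h2).resolve_left (Finset.prod_ne_zero_iff.1 hy b (Finset.mem_univ _))
  · rw [Fintype.linearIndependent_iff] at hindf ⊢
    intro w hw i
    refine hindf w ?_ i
    ext v
    have := congrFun hw v
    simpa [pdiff_apply, Pi.single_apply] using this

end Criterion
end DSP

/-! ### From matrices with two eigenvalues to involutions -/

namespace DSP

open Matrix

section Reflections

variable {R : Type*} [Ring R] [Algebra ℂ R] {lam mu : Fin 4 → ℂ}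

/-- The involutions of which the elements `A j` with eigenvalues `lam j`, `mu j` are affine
functions; `lam j` corresponds to the eigenvalue `-1` and `mu j` to the eigenvalue `1`. -/
noncomputable def toRefl (lam mu : Fin 4 → ℂ) (A : Fin 4 → R) : Fin 4 → R :=
  fun j => (mu j - lam j)⁻¹ • ((2 : ℂ) • A j - (lam j + mu j) • 1)

/-- The inverse of `toRefl`. -/
noncomputable def ofRefl (lam mu : Fin 4 → ℂ) (r : Fin 4 → R) : Fin 4 → R :=
  fun j => (2⁻¹ : ℂ) • ((lam j + mu j) • 1 + (mu j - lam j) • r j)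

theorem ofRefl_toRefl (hne : ∀ j, lam j ≠ mu j) (A : Fin 4 → R) :
    ofRefl lam mu (toRefl lam mu A) = A := by
  funext j
  rw [ofRefl, toRefl, smul_inv_smul₀ (sub_ne_zero.2 (hne j).symm), add_sub_cancel, smul_smul,
    inv_mul_cancel₀ two_ne_zero, one_smul]

theorem toRefl_ofRefl (hne : ∀ j, lam j ≠ mu j) (r : Fin 4 → R) :
    toRefl lam mu (ofRefl lam mu r) = r := by
  funext j
  simp only [ofRefl, toRefl]
  rw [smul_smul, mul_inv_cancel₀ two_ne_zero, one_smul, add_sub_cancel_left,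
    inv_smul_smul₀ (sub_ne_zero.2 (hne j).symm)]

theorem map_toRefl {R' : Type*} [Ring R'] [Algebra ℂ R'] (f : R →ₐ[ℂ] R') (A : Fin 4 → R)
    (j : Fin 4) : f (toRefl lam mu A j) = toRefl lam mu (fun j => f (A j)) j := by
  simp [toRefl]

theorem sum_smul_toRefl (hne : ∀ j, lam j ≠ mu j) (hlam : ∑ j, lam j = 0) (hmu : ∑ j, mu j = 0)
    (A : Fin 4 → R) : ∑ j, (mu j - lam j) • toRefl lam mu A j = (2 : ℂ) • ∑ j, A j := by
  have h : ∀ j, (mu j - lam j) • toRefl lam mu A j = (2 : ℂ) • A j - (lam j + mu j) • 1 :=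
    fun j => smul_inv_smul₀ (sub_ne_zero.2 (hne j).symm) _
  simp only [h]
  rw [Finset.sum_sub_distrib, ← Finset.sum_smul, Finset.sum_add_distrib, hlam, hmu, add_zero,
    zero_smul, sub_zero, Finset.smul_sum]

end Reflections

section Matrices

variable {ι κ : Type*} [Fintype ι] [DecidableEq ι] [Fintype κ] [DecidableEq κ]
  {lam mu : Fin 4 → ℂ}

theorem similar_toRefl_iff (hne : ∀ j, lam j ≠ mu j) {A : Fin 4 → Matrix ι ι ℂ}
    {B : Fin 4 → Matrix κ κ ℂ} :
    Similar (toRefl lam mu A) (toRefl lam mu B) ↔ Similar A B := by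
  constructor
  · rintro ⟨P, Q, h1, h2, h3⟩
    refine ⟨P, Q, h1, h2, fun j => ?_⟩
    rw [← ofRefl_toRefl hne A, ← ofRefl_toRefl hne B]
    simp only [ofRefl, Matrix.smul_mul, Matrix.mul_smul, Matrix.add_mul, Matrix.mul_add, h3,
      Matrix.one_mul, Matrix.mul_one]
  · rintro ⟨P, Q, h1, h2, h3⟩
    refine ⟨P, Q, h1, h2, fun j => ?_⟩
    simp only [toRefl, Matrix.smul_mul, Matrix.mul_smul, Matrix.sub_mul, Matrix.mul_sub, h3,
      Matrix.one_mul, Matrix.mul_one]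

theorem cent_toRefl (hne : ∀ j, lam j ≠ mu j) (A : Fin 4 → Matrix ι ι ℂ) :
    cent (toRefl lam mu A) = cent A := by
  ext Z
  constructor
  · intro h j
    rw [← ofRefl_toRefl hne A]
    simp only [ofRefl, Matrix.smul_mul, Matrix.mul_smul, Matrix.add_mul, Matrix.mul_add, h j,
      Matrix.one_mul, Matrix.mul_one]
  · intro h j
    simp only [toRefl, Matrix.smul_mul, Matrix.mul_smul, Matrix.sub_mul, Matrix.mul_sub, h j,
      Matrix.one_mul, Matrix.mul_one]

theorem toRefl_mulVec_eq_smul_iff (hne : ∀ j, lam j ≠ mu j) {A : Fin 4 → Matrix ι ι ℂ} {j : Fin 4}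
    {u : ι → ℂ} {ε : ℂ} :
    toRefl lam mu A j *ᵥ u = ε • u ↔
      A j *ᵥ u = ((2⁻¹ : ℂ) * (lam j + mu j + (mu j - lam j) * ε)) • u := by
  have h := sub_ne_zero.2 (hne j).symm
  rw [toRefl, smul_mulVec, inv_smul_eq_iff₀ h, sub_mulVec, smul_mulVec, smul_mulVec, one_mulVec,
    sub_eq_iff_eq_add, mul_smul, eq_inv_smul_iff₀ (two_ne_zero' ℂ), smul_smul,
    ← add_smul, add_comm (_ * ε)]

theorem irred_toRefl_iff (hne : ∀ j, lam j ≠ mu j) {A : Fin 4 → Matrix ι ι ℂ} :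
    Irred (toRefl lam mu A) ↔ Irred A := by
  constructor
  · intro h W hW
    refine h W fun j v hv => ?_
    rw [toRefl, smul_mulVec, sub_mulVec, smul_mulVec, smul_mulVec, one_mulVec]
    exact W.smul_mem _ (W.sub_mem (W.smul_mem _ (hW j v hv)) (W.smul_mem _ hv))
  · intro h W hW
    refine h W fun j v hv => ?_
    rw [← ofRefl_toRefl hne A, ofRefl, smul_mulVec, add_mulVec, smul_mulVec, smul_mulVec,
      one_mulVec]
    exact W.smul_mem _ (W.add_mem (W.smul_mem _ hv) (W.smul_mem _ (hW j v hv)))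

theorem areEquivalent_iff {n : ℕ} {A B : Quad n} : AreEquivalent A B ↔ Similar A B := by
  constructor
  · rintro ⟨g, hg⟩
    refine Similar.symm ⟨g.val, g⁻¹.val, g.mul_inv, g.inv_mul, fun j => ?_⟩
    rw [hg, Matrix.mul_assoc, g.inv_mul, Matrix.mul_one]
  · intro h
    obtain ⟨P, Q, h1, h2, h3⟩ := h.symm
    exact ⟨⟨P, Q, h1, h2⟩, fun j => Similar.eq_mul h1 h3 j⟩

end Matrices

section Varieties

variable {lam mu : Fin 4 → ℂ}

theorem isDiagWith_iff {n a b : ℕ} (hn : a + b = n) {M : Matrix (Fin n) (Fin n) ℂ} {α β : ℂ}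
    (hne : α ≠ β) :
    IsDiagWith M α β a b ↔
      ((β - α)⁻¹ • ((2 : ℂ) • M - (α + β) • (1 : Matrix (Fin n) (Fin n) ℂ))) *
        ((β - α)⁻¹ • ((2 : ℂ) • M - (α + β) • (1 : Matrix (Fin n) (Fin n) ℂ))) = 1 ∧
      ((β - α)⁻¹ • ((2 : ℂ) • M - (α + β) • (1 : Matrix (Fin n) (Fin n) ℂ))).trace =
        (b : ℂ) - a := by
  have h0 : β - α ≠ 0 := sub_ne_zero.2 hne.symm
  have hsum : ∀ d : Fin n → ℂ, (∀ i, d i = 1 ∨ d i = -1) → ∑ i, d i =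
      ((Finset.univ.filter fun i => d i = 1).card : ℂ) -
        (Finset.univ.filter fun i => d i = -1).card := by
    intro d hd
    have : ∀ i, d i = (if d i = 1 then (1 : ℂ) else 0) - (if d i = -1 then (1 : ℂ) else 0) := by
      intro i
      rcases hd i with h | h <;> norm_num [h]
    rw [Finset.sum_congr rfl fun i _ => this i, Finset.sum_sub_distrib, Finset.sum_boole,
      Finset.sum_boole]
  constructor
  · rintro ⟨P, d, h1, h2, h3, h4⟩
    have hM : M = P.val * diagonal d * P⁻¹.val := by
      rw [← h1]
      simp [← Matrix.mul_assoc]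
    let d' : Fin n → ℂ := fun i => (β - α)⁻¹ * (2 * d i - (α + β))
    have hr : (β - α)⁻¹ • ((2 : ℂ) • M - (α + β) • (1 : Matrix (Fin n) (Fin n) ℂ)) =
        P.val * diagonal d' * P⁻¹.val := by
      have e : diagonal d' = (β - α)⁻¹ • ((2 : ℂ) • diagonal d -
          (α + β) • (1 : Matrix (Fin n) (Fin n) ℂ)) := by
        ext x y
        by_cases h : x = y <;> simp [h, d']
      rw [e, hM]
      simp only [Matrix.mul_smul, Matrix.smul_mul, Matrix.mul_sub, Matrix.sub_mul, Matrix.mul_one]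
      simp
    have hα : ∀ i, d i = α → d' i = -1 := fun i h => by
      simp only [d', h]; field_simp; ring
    have hβ : ∀ i, d i = β → d' i = 1 := fun i h => by
      simp only [d', h]; field_simp; ring
    have hd' : ∀ i, d' i = 1 ∨ d' i = -1 := fun i => (h2 i).symm.imp (hβ i) (hα i)
    rw [hr]
    constructor
    · have e : diagonal d' * diagonal d' = (1 : Matrix (Fin n) (Fin n) ℂ) := by
        rw [diagonal_mul_diagonal, ← diagonal_one]
        congr 1
        funext i
        rcases hd' i with h | h <;> simp [h]
      calc P.val * diagonal d' * P⁻¹.val * (P.val * diagonal d' * P⁻¹.val) =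
          P.val * (diagonal d' * (P⁻¹.val * P.val) * diagonal d') * P⁻¹.val := by
            simp only [Matrix.mul_assoc]
        _ = 1 := by rw [P.inv_mul, Matrix.mul_one, e, Matrix.mul_one, P.mul_inv]
    · rw [Matrix.trace_mul_comm, ← Matrix.mul_assoc, P.inv_mul, Matrix.one_mul, trace_diagonal,
        hsum d' hd', ← h3, ← h4]
      have n1 : (1 : ℂ) ≠ -1 := by norm_num
      congr 3
      · ext i
        simp only [Finset.mem_filter, Finset.mem_univ, true_and]
        refine ⟨fun h => (h2 i).resolve_left fun h' => ?_, hβ i⟩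
        exact n1 (h.symm.trans (hα i h'))
      · ext i
        simp only [Finset.mem_filter, Finset.mem_univ, true_and]
        refine ⟨fun h => (h2 i).resolve_right fun h' => ?_, hα i⟩
        exact n1 ((hβ i h').symm.trans h)
  · rintro ⟨h1, h2⟩
    obtain ⟨P, Q, d, hPQ, hQP, hM, hd⟩ := exists_diagonalization_of_sq_eq_one h1
    set r := (β - α)⁻¹ • ((2 : ℂ) • M - (α + β) • (1 : Matrix (Fin n) (Fin n) ℂ)) with hr
    have hMr : M = (2⁻¹ : ℂ) • ((α + β) • (1 : Matrix (Fin n) (Fin n) ℂ) + (β - α) • r) := by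
      rw [hr, smul_inv_smul₀ h0, add_sub_cancel, smul_smul, inv_mul_cancel₀ two_ne_zero, one_smul]
    let d' : Fin n → ℂ := fun i => 2⁻¹ * ((α + β) + (β - α) * d i)
    have hα : ∀ i, d i = -1 → d' i = α := fun i h => by simp only [d', h]; ring
    have hβ : ∀ i, d i = 1 → d' i = β := fun i h => by simp only [d', h]; ring
    have ht : ∑ i, d i = (b : ℂ) - a := by
      rw [← h2, ← trace_diagonal, ← Matrix.one_mul (diagonal d), ← hQP, Matrix.mul_assoc, ← hM,
        Matrix.trace_mul_comm, Matrix.mul_assoc, hPQ, Matrix.mul_one]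
    have h1α : (Finset.univ.filter fun i => d' i = α) = Finset.univ.filter fun i => d i = -1 := by
      ext i
      simp only [Finset.mem_filter, Finset.mem_univ, true_and]
      exact ⟨fun h => (hd i).resolve_left fun h' => hne (h.symm.trans (hβ i h')), hα i⟩
    have h1β : (Finset.univ.filter fun i => d' i = β) = Finset.univ.filter fun i => d i = 1 := by
      ext i
      simp only [Finset.mem_filter, Finset.mem_univ, true_and]
      exact ⟨fun h => (hd i).resolve_right fun h' => hne ((hα i h').symm.trans h), hβ i⟩
    rw [hsum d hd] at ht
    have hcount : (Finset.univ.filter fun i => d i = 1).card +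
        (Finset.univ.filter fun i => d i = -1).card = a + b := by
      rw [← Finset.card_union_of_disjoint, ← Finset.filter_or, Finset.filter_true_of_mem, hn]
      · simp
      · exact fun i _ => hd i
      · rw [Finset.disjoint_filter]
        intro i _ h h'
        rw [h] at h'
        norm_num at h'
    have hcount' := hcount
    apply_fun (Nat.cast : ℕ → ℂ) at hcount'
    push_cast at hcount'
    refine ⟨⟨P, Q, hPQ, hQP⟩, d', ?_, fun i => (hd i).symm.imp (hα i) (hβ i), ?_, ?_⟩
    · change Q * M * P = _
      have e : Q * r * P = diagonal d := by
        rw [Matrix.mul_assoc, hM, ← Matrix.mul_assoc, hQP, Matrix.one_mul]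
      rw [hMr, Matrix.mul_smul, Matrix.smul_mul, Matrix.mul_add, Matrix.add_mul, Matrix.mul_smul,
        Matrix.smul_mul, Matrix.mul_one, hQP, Matrix.mul_smul, Matrix.smul_mul, e]
      ext x y
      by_cases h : x = y <;> simp [h, d']
    · rw [h1α, ← Nat.cast_inj (R := ℂ)]
      linear_combination (hcount' - ht) / 2
    · rw [h1β, ← Nat.cast_inj (R := ℂ)]
      linear_combination (hcount' + ht) / 2

theorem mem_variety_iff {n a b : ℕ} (hn : a + b = n) (hne : ∀ j, lam j ≠ mu j)
    (hlam : ∑ j, lam j = 0) (hmu : ∑ j, mu j = 0) {A : Quad n} :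
    A ∈ variety n a b lam mu ↔ ReflRel (fun j => mu j - lam j) (toRefl lam mu A) ∧
      ∀ j, (toRefl lam mu A j).trace = (b : ℂ) - a := by
  have h1 : A ∈ variety n a b lam mu ↔
    (∀ j, toRefl lam mu A j * toRefl lam mu A j = 1 ∧ (toRefl lam mu A j).trace = (b : ℂ) - a) ∧
      ∑ j, A j = 0 := and_congr_left' (forall_congr' fun j => isDiagWith_iff hn (hne j))
  have h2 : ∑ j, A j = 0 ↔ ∑ j, (mu j - lam j) • toRefl lam mu A j = 0 := by
    rw [sum_smul_toRefl hne hlam hmu, smul_eq_zero_iff_right two_ne_zero]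
  rw [h1, h2, forall_and]
  exact ⟨fun h => ⟨⟨h.1.1, h.2⟩, h.1.2⟩, fun h => ⟨⟨h.1.sq, h.2⟩, h.1.sum⟩⟩

theorem OnlyRelation.sum_mu_eq_zero {k : ℕ} (hk : 1 ≤ k)
    (htr : ((k : ℂ) + 1) * ∑ j, lam j + (k : ℂ) * ∑ j, mu j = 0)
    (hrel : OnlyRelation k lam mu) : ∑ j, mu j = 0 := by
  rw [hrel.1, mul_zero, zero_add] at htr
  exact (mul_eq_zero.1 htr).resolve_left (Nat.cast_ne_zero.2 (by omega))

theorem OnlyRelation.noSubsum {k : ℕ} (hk : 1 ≤ k)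
    (htr : ((k : ℂ) + 1) * ∑ j, lam j + (k : ℂ) * ∑ j, mu j = 0)
    (hrel : OnlyRelation k lam mu) : NoSubsum fun j => mu j - lam j := by
  refine ⟨by rw [Finset.sum_sub_distrib, hrel.1, hrel.sum_mu_eq_zero hk htr, sub_zero],
    fun J hJ => ?_⟩
  let y : Fin (2 * k + 1) := Fin.last (2 * k)
  have hy : ¬ y.val ≤ k := by simp only [y, Fin.val_last]; omega
  -- one eigenvalue of each matrix: `mu j` for `j` in `J` and `lam j` otherwise
  have h := hrel.2 1 (fun j => if j ∈ J then {y} else {0}) one_pos (by omega)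
    (fun j => by split_ifs <;> simp) (by
      have : ∀ j, ∑ i ∈ (if j ∈ J then {y} else {0} : Finset (Fin (2 * k + 1))),
          eigenvalueList k (lam j) (mu j) i = lam j + if j ∈ J then mu j - lam j else 0 := by
        intro j
        split_ifs <;> simp [eigenvalueList, hy]
      simp only [this]
      rw [Finset.sum_add_distrib, hrel.1, zero_add, Finset.sum_ite_mem, Finset.univ_inter]
      exact hJ)
  by_cases h0 : ∃ j, j ∉ J
  · obtain ⟨j, hj⟩ := h0
    left
    refine Finset.eq_empty_of_forall_notMem fun j' hj' => ?_
    have := h j j'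
    simp [hj, hj', Finset.filter_singleton, hy] at this
  · push Not at h0
    exact Or.inr (Finset.eq_univ_iff_forall.2 h0)

end Varieties
end DSP

/-! ### The strata in terms of involutions -/

namespace DSP

open Matrix

section Strata

/-- The families of involutions that are equivalent to a direct sum of `s` pairwise inequivalent
irreducible `2 × 2` families and the given family `h`. -/
def IsHB {ι : Type*} [Fintype ι] [DecidableEq ι] (c : Fin 4 → ℂ) {m : ℕ} (s : ℕ)
    (h : Fin 4 → Matrix (Fin m) (Fin m) ℂ) (r : Fin 4 → Matrix ι ι ℂ) : Prop :=
  ∃ b : Fin s → Fin 4 → Matrix (Fin 2) (Fin 2) ℂ, (∀ i, ReflRel c (b i) ∧ Irred (b i)) ∧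
    (∀ i i', i ≠ i' → ¬ Similar (b i) (b i')) ∧ Similar r (dsum (blocks b h))

/-- The family `h` is a brick of size `2 * l + 1` for which all anticommutators are `2`, with
the eigenvalue `ε` not occurring on common eigenvectors. By `similar_of_noFix` such families are
unique up to equivalence. -/
structure IsUnipotent {ι : Type*} [Fintype ι] [DecidableEq ι] (c : Fin 4 → ℂ) (ε : ℂ)
    (h : Fin 4 → Matrix ι ι ℂ) : Prop where
  reflRel : ReflRel c h
  brick : Brick h
  hasChar : HasChar h (fun _ _ => 1) (fun _ _ _ => 0)
  trace : ∀ j, (h j).trace = -1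
  noFix : NoFix h ε
  eps : ε = 1 ∨ ε = -1

variable {c lam mu : Fin 4 → ℂ}

theorem IsUnipotent.similar {ι κ : Type*} [Fintype ι] [DecidableEq ι] [Fintype κ] [DecidableEq κ]
    {ε : ℂ} {l : ℕ} {h : Fin 4 → Matrix ι ι ℂ} {h' : Fin 4 → Matrix κ κ ℂ} (hc : ∀ j, c j ≠ 0)
    (hh : IsUnipotent c ε h) (hh' : IsUnipotent c ε h') (hι : Fintype.card ι = 2 * l + 1)
    (hκ : Fintype.card κ = 2 * l + 1) : Similar h h' :=
  similar_of_noFix hc hh.reflRel hh.brick hh.hasChar (fun _ _ => rfl) hι (hh.trace 0) hh'.reflRel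
    hh'.brick hh'.hasChar (fun _ _ => rfl) hκ (hh'.trace 0) hh.eps hh.noFix hh'.noFix

theorem Irred.exists_hasChar {b : Fin 4 → Matrix (Fin 2) (Fin 2) ℂ} (hi : Irred b)
    (h : ReflRel c b) (hc : NoSubsum c) :
    ∃ σ ω, HasChar b σ ω ∧ ∃ i j k, i ≠ j ∧ i ≠ k ∧ j ≠ k ∧ σ i j ^ 2 ≠ 1 := by
  obtain ⟨σ, ω, hχ⟩ := hi.brick.exists_hasChar h hc.ne_zero
  obtain ⟨i, j, hs⟩ := hi.exists_sq_ne_one (by simp) h hc hχ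
  have hij : i ≠ j := by
    rintro rfl
    rw [hχ.self_eq_one h, one_pow] at hs
    exact hs rfl
  obtain ⟨k, hik, hjk⟩ : ∃ k : Fin 4, i ≠ k ∧ j ≠ k := by
    clear hs
    revert i j
    decide
  exact ⟨σ, ω, hχ, i, j, k, hij, hik, hjk, hs⟩

theorem Irred.trace_eq_zero {b : Fin 4 → Matrix (Fin 2) (Fin 2) ℂ} (hi : Irred b)
    (h : ReflRel c b) (hc : NoSubsum c) (x : Fin 4) : (b x).trace = 0 := by
  obtain ⟨σ, ω, hχ, i, j, k, hij, hik, hjk, hs⟩ := hi.exists_hasChar h hc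
  rw [(hχ.similar_normalForm h hc.ne_zero (Or.inl hi.brick) hij hik hjk hs).trace_eq,
    trace_normalForm]

theorem isTypeB_iff (hne : ∀ j, lam j ≠ mu j) (hlam : ∑ j, lam j = 0) (hmu : ∑ j, mu j = 0)
    (hc : NoSubsum fun j => mu j - lam j) {B : Quad 2} :
    IsTypeB lam mu B ↔ ReflRel (fun j => mu j - lam j) (toRefl lam mu B) ∧
      Irred (toRefl lam mu B) := by
  rw [IsTypeB, mem_variety_iff (show 1 + 1 = 2 from rfl) hne hlam hmu, irred_toRefl_iff hne,
    IsIrreducibleQuad]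
  constructor
  · exact fun h => ⟨h.1.1, h.2.2⟩
  · refine fun h => ⟨⟨h.1, fun j => ?_⟩, two_pos, h.2⟩
    rw [((irred_toRefl_iff hne).2 h.2).trace_eq_zero h.1 hc]
    simp

theorem IsTypeH.isUnipotent (hne : ∀ j, lam j ≠ mu j) (hlam : ∑ j, lam j = 0)
    (hmu : ∑ j, mu j = 0) (hc : NoSubsum fun j => mu j - lam j) {l : ℕ}
    {o : Fin (2 * l + 1) → Bool} {H : Quad (2 * l + 1)} (h : IsTypeH lam mu l o H) :
    IsUnipotent (fun j => mu j - lam j) (if o 0 = true then 1 else -1) (toRefl lam mu H) := by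
  obtain ⟨hV, htri, hcent, ho⟩ := h
  rw [mem_variety_iff (by omega) hne hlam hmu] at hV
  obtain ⟨hR, htr⟩ := hV
  have htr' : ∀ j, (toRefl lam mu H j).trace = -1 := fun j => by
    rw [htr]; push_cast; ring
  have hb : Brick (toRefl lam mu H) := by
    intro Z hZ
    have : Z ∈ cent (toRefl lam mu H) := fun j => (hZ j).eq
    rw [cent_toRefl hne] at this
    exact hcent Z this
  -- the first basis vector is a common eigenvector
  have hdiag : ∀ j, toRefl lam mu H j *ᵥ Pi.single 0 1 =
      (if o 0 = true then (-1 : ℂ) else 1) • Pi.single 0 1 := by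
    intro j
    rw [toRefl_mulVec_eq_smul_iff hne]
    ext x
    rw [mulVec_single_one, col_apply, Pi.smul_apply, smul_eq_mul]
    by_cases hx : x = 0
    · subst hx
      rw [ho, Pi.single_eq_same]
      split_ifs <;> ring
    · rw [htri j (Fin.pos_of_ne_zero hx), Pi.single_eq_of_ne hx, mul_zero]
  obtain ⟨σ, ω, hχ⟩ := hb.exists_hasChar hR hc.ne_zero
  have hv0 : (Pi.single 0 1 : Fin (2 * l + 1) → ℂ) ≠ 0 := by simp
  have hσ : ∀ i j, σ i j = 1 := by
    intro i j
    have h1 : acomm (toRefl lam mu H) i j *ᵥ Pi.single 0 1 = (2 : ℂ) • Pi.single 0 1 := by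
      rw [acomm, add_mulVec, ← mulVec_mulVec, ← mulVec_mulVec, hdiag, hdiag, mulVec_smul,
        mulVec_smul, hdiag, hdiag, smul_smul, ← add_smul]
      congr 1
      split_ifs <;> norm_num
    rw [hχ.acomm_eq, smul_mulVec, one_mulVec] at h1
    have := smul_left_injective ℂ hv0 h1
    linear_combination this / 2
  have hω : ∀ i j k, ω i j k = 0 := fun i j k => (hχ.sub_mul_sub_eq_zero hR hσ i j k).2
  have e1 : σ = fun _ _ => 1 := by funext i j; exact hσ i j
  have e2 : ω = fun _ _ _ => 0 := by funext i j k; exact hω i j k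
  subst e1 e2
  refine ⟨hR, hb, hχ, htr', ?_, ?_⟩
  · by_cases h0 : o 0 = true
    · rw [if_pos h0]
      rcases similar_stdFamily_or hc.ne_zero hR hb hχ (fun _ _ => rfl)
          (Fintype.card_fin (2 * l + 1)) (htr' 0) with
        h | ⟨_, h, _⟩
      · exact h.1
      · exact absurd (h _ fun j => by rw [hdiag j, if_pos h0]) hv0
    · rw [if_neg h0]
      rcases similar_stdFamily_or hc.ne_zero hR hb hχ (fun _ _ => rfl)
          (Fintype.card_fin (2 * l + 1)) (htr' 0) with
        h | ⟨_, h, _⟩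
      · exact absurd (h.1 _ fun j => by rw [hdiag j, if_neg h0]) hv0
      · exact h
  · split_ifs
    · exact Or.inl rfl
    · exact Or.inr rfl

theorem toRefl_dsum {τ : Type*} [Fintype τ] [DecidableEq τ] {F : τ → Type*} [∀ t, Fintype (F t)]
    [∀ t, DecidableEq (F t)] (A : ∀ t, Fin 4 → Matrix (F t) (F t) ℂ) :
    toRefl lam mu (dsum A) = dsum fun t => toRefl lam mu (A t) := by
  funext j
  exact (map_toRefl (blockDiagonalHom F) (fun j t => A t j) j).symm

theorem similar_blocks_iff {n m s : ℕ} (hn : 2 * s + m = n) {A : Quad n} {B : Fin s → Quad 2}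
    {H : Quad m} :
    Similar A (dsum (blocks B H)) ↔ ∃ (e : (Fin 2 × Fin s) ⊕ Fin m ≃ Fin n) (g : GL (Fin n) ℂ),
      ∀ j, A j = g.val *
        Matrix.reindex e e (Matrix.fromBlocks (Matrix.blockDiagonal (fun i => B i j)) 0 0 (H j)) *
        (g⁻¹).val := by
  constructor
  · intro h
    have e : (Fin 2 × Fin s) ⊕ Fin m ≃ Fin n := Fintype.equivOfCardEq (by simp [hn])
    obtain ⟨P, Q, h1, h2, h3⟩ := (h.trans (similar_blocks B H).symm).trans (Similar.reindex _ e)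
    exact ⟨e, ⟨P, Q, h1, h2⟩, fun j => Similar.eq_mul h1 h3 j⟩
  · rintro ⟨e, g, h⟩
    refine Similar.trans ?_ (((Similar.reindex _ e).symm).trans (similar_blocks B H))
    exact ⟨g.val, g⁻¹.val, g.mul_inv, g.inv_mul, fun j => by
      rw [h, Matrix.mul_assoc, g.inv_mul, Matrix.mul_one]⟩

/-- Membership in a stratum, in terms of involutions. -/
theorem mem_setHB_iff {k s : ℕ} (hs : s ≤ k) (hne : ∀ j, lam j ≠ mu j) (hlam : ∑ j, lam j = 0)
    (hmu : ∑ j, mu j = 0) (hc : NoSubsum fun j => mu j - lam j)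
    {o : Fin (2 * (k - s) + 1) → Bool} {H : Quad (2 * (k - s) + 1)}
    (hH : IsTypeH lam mu (k - s) o H) {A : Quad (2 * k + 1)} :
    A ∈ setHB k s lam mu o ↔
      IsHB (fun j => mu j - lam j) s (toRefl lam mu H) (toRefl lam mu A) := by
  have hblocks : ∀ (B : Fin s → Quad 2) (H' : Quad (2 * (k - s) + 1)),
      dsum (blocks (fun i => toRefl lam mu (B i)) (toRefl lam mu H')) =
        toRefl lam mu (dsum (blocks B H')) := by
    intro B H'
    rw [toRefl_dsum]
    congr 1
    funext t
    cases t <;> rfl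
  have hU := hH.isUnipotent hne hlam hmu hc
  constructor
  · rintro ⟨-, B, H', e, g, hB, hBB, hH', hA⟩
    refine ⟨fun i => toRefl lam mu (B i), fun i => (isTypeB_iff hne hlam hmu hc).1 (hB i),
      fun i i' hi h => hBB i i' hi ?_, ?_⟩
    · exact areEquivalent_iff.2 ((similar_toRefl_iff hne).1 h)
    · have h1 : Similar A (dsum (blocks B H')) :=
        (similar_blocks_iff (by omega)).2 ⟨e, g, hA⟩
      have h2 : Similar (toRefl lam mu H') (toRefl lam mu H) :=
        (hH'.isUnipotent hne hlam hmu hc).similar hc.ne_zero hU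
          (Fintype.card_fin _) (Fintype.card_fin _)
      refine ((similar_toRefl_iff hne).2 h1).trans ?_
      rw [← hblocks]
      refine Similar.dsum fun t => ?_
      cases t
      · exact h2
      · exact Similar.refl _
  · rintro ⟨b, hb, hbb, hA⟩
    have hb' : ∀ i, toRefl lam mu (ofRefl lam mu (b i)) = b i := fun i => toRefl_ofRefl hne _
    have h1 : Similar A (dsum (blocks (fun i => ofRefl lam mu (b i)) H)) := by
      rw [← similar_toRefl_iff hne, ← hblocks]
      simpa only [hb'] using hA
    obtain ⟨e, g, hg⟩ := (similar_blocks_iff (by omega)).1 h1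
    refine ⟨(mem_variety_iff (by omega) hne hlam hmu).2 ⟨?_, fun j => ?_⟩, _, H, e, g, ?_, ?_, hH,
      hg⟩
    · refine hA.reflRel (reflRel_dsum_iff.2 fun t => ?_)
      cases t
      · exact hU.reflRel
      · exact (hb _).1
    · rw [hA.trace_eq, trace_dsum, Fintype.sum_option]
      have : ∀ i, (blocks b (toRefl lam mu H) (some i) j).trace = 0 := fun i =>
        (hb i).2.trace_eq_zero (hb i).1 hc j
      rw [Finset.sum_eq_zero fun i _ => this i]
      change (toRefl lam mu H j).trace + 0 = _
      rw [hU.trace]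
      push_cast
      ring
    · intro i
      rw [isTypeB_iff hne hlam hmu hc, hb']
      exact hb i
    · intro i i' hi h
      rw [areEquivalent_iff, ← similar_toRefl_iff hne, hb', hb'] at h
      exact hbb i i' hi h

end Strata
end DSP

/-! ### Separation of the blocks by central elements -/

namespace DSP

open Matrix

section Gram

variable {ι κ : Type*} [Fintype ι] [DecidableEq ι] [Fintype κ] [DecidableEq κ]

/-- The Gram matrix of the first `N` powers of `z` for the trace form. -/
def gram (N : ℕ) {R : Type*} [CommRing R] {ι : Type*} [Fintype ι] [DecidableEq ι]
    (z : Matrix ι ι R) : Matrix (Fin N) (Fin N) R :=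
  of fun a b => (z ^ (a.val + b.val)).trace

theorem gram_mulVec {N : ℕ} (z : Matrix ι ι ℂ) (g : Fin N → ℂ) (a : Fin N) :
    (gram N z *ᵥ g) a = (z ^ a.val * ∑ b, g b • z ^ b.val).trace := by
  rw [Finset.mul_sum, trace_sum]
  simp only [mulVec, dotProduct, gram, of_apply, Matrix.mul_smul, trace_smul, ← pow_add,
    smul_eq_mul, mul_comm]

theorem linearIndependent_pow_of_gram {N : ℕ} {z : Matrix ι ι ℂ} (h : (gram N z).det ≠ 0) :
    LinearIndependent ℂ fun a : Fin N => z ^ a.val := by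
  rw [Fintype.linearIndependent_iff]
  intro g hg i
  have : g = 0 := by
    refine Matrix.eq_zero_of_mulVec_eq_zero h (funext fun a => ?_)
    rw [gram_mulVec, hg, Matrix.mul_zero, trace_zero]
    rfl
  rw [this]
  rfl

/-- If the first `N` powers of `z` form a basis of the matrices commuting with `r`, and their Gram
matrix is invertible, then no non-zero nilpotent matrix commutes with `r`. -/
theorem eq_zero_of_isNilpotent_of_gram {N : ℕ} {r : Fin 4 → Matrix ι ι ℂ} {z : Matrix ι ι ℂ}
    (h : (gram N z).det ≠ 0) (hz : ∀ j, Commute z (r j))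
    (hcent : Module.finrank ℂ (cent r) ≤ N) {n : Matrix ι ι ℂ} (hn : n ∈ cent r)
    (hnil : IsNilpotent n) : n = 0 := by
  have hspan : Submodule.span ℂ (Set.range fun a : Fin N => z ^ a.val) = cent r := by
    refine Submodule.eq_of_le_of_finrank_le ?_ ?_
    · rw [Submodule.span_le]
      rintro _ ⟨a, rfl⟩ j
      exact (hz j).pow_left _
    · rw [finrank_span_eq_card (linearIndependent_pow_of_gram h), Fintype.card_fin]
      exact hcent
  rw [← hspan, Submodule.mem_span_range_iff_exists_fun] at hn
  obtain ⟨g, rfl⟩ := hn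
  have : g = 0 := by
    refine Matrix.eq_zero_of_mulVec_eq_zero h (funext fun a => ?_)
    rw [gram_mulVec]
    have hcomm : Commute (z ^ a.val) (∑ b, g b • z ^ b.val) :=
      Commute.sum_right _ _ _ fun b _ => (((Commute.refl z).pow_left _).pow_right _).smul_right _
    exact (Matrix.isNilpotent_trace_of_isNilpotent (hcomm.isNilpotent_mul_left hnil)).eq_zero
  simp [this]

theorem exists_diagonalization_of_gram {N : ℕ} {r : Fin 4 → Matrix ι ι ℂ} {z : Matrix ι ι ℂ}
    (h : (gram N z).det ≠ 0) (hz : ∀ j, Commute z (r j))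
    (hcent : Module.finrank ℂ (cent r) ≤ N) :
    ∃ (P Q : Matrix ι ι ℂ) (d : ι → ℂ), P * Q = 1 ∧ Q * P = 1 ∧ z * P = P * diagonal d := by
  refine exists_diagonalization z ?_
  obtain ⟨n, hn, t, -, hnil, ht, hnt⟩ :=
    Module.End.exists_isNilpotent_isSemisimple (f := Matrix.toLinAlgEquiv' z)
  have hn0 : n = 0 := by
    have h1 : LinearMap.toMatrixAlgEquiv' n = 0 := by
      refine eq_zero_of_isNilpotent_of_gram h hz hcent (fun j => ?_)
        (hnil.map LinearMap.toMatrixAlgEquiv')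
      have h2 : Algebra.adjoin ℂ {Matrix.toLinAlgEquiv' z} ≤
          Subalgebra.centralizer ℂ {Matrix.toLinAlgEquiv' (r j)} := by
        rw [Algebra.adjoin_le_iff, Set.singleton_subset_iff, SetLike.mem_coe,
          Subalgebra.mem_centralizer_iff]
        rintro _ rfl
        exact ((hz j).map Matrix.toLinAlgEquiv').eq.symm
      have h3 := (Subalgebra.mem_centralizer_iff _).1 (h2 hn) _ rfl
      have h4 := congrArg LinearMap.toMatrixAlgEquiv' h3
      rw [map_mul, map_mul, LinearMap.toMatrixAlgEquiv'_toLinAlgEquiv'] at h4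
      exact h4.symm
    exact LinearMap.toMatrixAlgEquiv'.injective (h1.trans (map_zero _).symm)
  rw [hn0, zero_add] at hnt
  rw [eq_top_iff, ← ht.iSup_eigenspace_eq_top, ← hnt]
  refine iSup_le fun a v hv => Submodule.subset_span ⟨a, ?_⟩
  rwa [Module.End.mem_eigenspace_iff, Matrix.toLinAlgEquiv'_apply] at hv

theorem Similar.trace_centralElt_pow {r : Fin 4 → Matrix ι ι ℂ} {r' : Fin 4 → Matrix κ κ ℂ}
    (h : Similar r r') (p : Fin 4 → Fin 4 → ℂ) (q : Fin 4 → Fin 4 → Fin 4 → ℂ) (a : ℕ) :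
    (centralElt p q r ^ a).trace = (centralElt p q r' ^ a).trace := by
  obtain ⟨P, Q, h1, h2, h3⟩ := h
  have e : centralElt p q r = conjAlg P Q h1 h2 (centralElt p q r') := by
    rw [show r = fun j => conjAlg P Q h1 h2 (r' j) from funext fun j => by
      rw [conjAlg_apply, ← Similar.eq_mul h1 h3]]
    exact (map_centralElt (conjAlg P Q h1 h2).toAlgHom p q r').symm
  rw [e, ← map_pow, conjAlg_apply, trace_mul_comm, ← Matrix.mul_assoc, h2, Matrix.one_mul]

theorem Similar.gram_eq {r : Fin 4 → Matrix ι ι ℂ} {r' : Fin 4 → Matrix κ κ ℂ}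
    (h : Similar r r') (p : Fin 4 → Fin 4 → ℂ) (q : Fin 4 → Fin 4 → Fin 4 → ℂ) (N : ℕ) :
    gram N (centralElt p q r) = gram N (centralElt p q r') := by
  ext a b
  exact h.trace_centralElt_pow p q _

theorem det_gram_diagonal_ne_zero {N : ℕ} {τ : Type*} [Fintype τ] [DecidableEq τ]
    (hN : Fintype.card τ = N)
    {F : τ → Type*} [∀ t, Fintype (F t)] [∀ t, DecidableEq (F t)] [∀ t, Nonempty (F t)]
    {ζ : τ → ℂ} (hζ : Function.Injective ζ) :
    (gram N (diagonal fun x : Σ t, F t => ζ x.1)).det ≠ 0 := by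
  let e : Fin N ≃ τ := (Fintype.equivFinOfCardEq hN).symm
  have h1 : gram N (diagonal fun x : Σ t, F t => ζ x.1) =
      (vandermonde fun a => ζ (e a))ᵀ * diagonal (fun a => (Fintype.card (F (e a)) : ℂ)) *
        vandermonde fun a => ζ (e a) := by
    ext a b
    rw [Matrix.mul_apply]
    simp only [mul_diagonal, transpose_apply, vandermonde_apply, gram, of_apply, diagonal_pow,
      trace_diagonal, Pi.pow_apply]
    rw [Fintype.sum_sigma, ← e.sum_comp]
    refine Finset.sum_congr rfl fun x _ => ?_
    simp only [Finset.sum_const, Finset.card_univ, nsmul_eq_mul, pow_add]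
    ring
  have h2 : (vandermonde fun a => ζ (e a)).det ≠ 0 :=
    det_vandermonde_ne_zero_iff.2 (hζ.comp e.injective)
  rw [h1, det_mul, det_mul, det_transpose, det_diagonal]
  refine mul_ne_zero (mul_ne_zero h2 (Finset.prod_ne_zero_iff.2 fun a _ => ?_)) h2
  exact Nat.cast_ne_zero.2 Fintype.card_ne_zero

end Gram

section Separation

theorem exists_charValue_injective {τ : Type*} [Finite τ] {σ : τ → Fin 4 → Fin 4 → ℂ}
    {ω : τ → Fin 4 → Fin 4 → Fin 4 → ℂ} (h : ∀ t t', t ≠ t' → σ t ≠ σ t' ∨ ω t ≠ ω t') :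
    ∃ p q, Function.Injective fun t => charValue p q (σ t) (ω t) := by
  let f : {x : τ × τ // x.1 ≠ x.2} →
      Module.Dual ℂ ((Fin 4 → Fin 4 → ℂ) × (Fin 4 → Fin 4 → Fin 4 → ℂ)) := fun x =>
    { toFun := fun y => charValue y.1 y.2 (σ x.1.1) (ω x.1.1) -
        charValue y.1 y.2 (σ x.1.2) (ω x.1.2)
      map_add' := fun y y' => by
        simp only [charValue, Prod.fst_add, Prod.snd_add, Pi.add_apply, add_mul,
          Finset.sum_add_distrib]
        ring
      map_smul' := fun a y => by
        simp only [charValue, Prod.smul_fst, Prod.smul_snd, Pi.smul_apply, smul_eq_mul,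
          RingHom.id_apply, mul_assoc, ← Finset.mul_sum]
        ring }
  obtain ⟨⟨p, q⟩, hpq⟩ := Module.Dual.exists_forall_ne_zero_of_forall_exists f (by
    rintro ⟨⟨t, t'⟩, ht⟩
    rcases h t t' ht with h | h
    · obtain ⟨i, hi⟩ := Function.ne_iff.1 h
      obtain ⟨j, hj⟩ := Function.ne_iff.1 hi
      refine ⟨(Pi.single i (Pi.single j 1), 0), ?_⟩
      change charValue _ _ _ _ - charValue _ _ _ _ ≠ 0
      simpa [charValue, Pi.single_apply, Finset.sum_apply, ite_apply, sub_eq_zero] using hj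
    · obtain ⟨i, hi⟩ := Function.ne_iff.1 h
      obtain ⟨j, hj⟩ := Function.ne_iff.1 hi
      obtain ⟨k, hk⟩ := Function.ne_iff.1 hj
      refine ⟨(0, Pi.single i (Pi.single j (Pi.single k 1))), ?_⟩
      change charValue _ _ _ _ - charValue _ _ _ _ ≠ 0
      simpa [charValue, Pi.single_apply, Finset.sum_apply, ite_apply, sub_eq_zero] using hk)
  refine ⟨p, q, fun t t' htt => ?_⟩
  by_contra ht
  exact hpq ⟨(t, t'), ht⟩ (sub_eq_zero.2 htt)

variable {c : Fin 4 → ℂ} {m s : ℕ} {ε : ℂ}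

theorem brick_blocks {b : Fin s → Fin 4 → Matrix (Fin 2) (Fin 2) ℂ}
    {h : Fin 4 → Matrix (Fin m) (Fin m) ℂ} (hb : ∀ i, Irred (b i)) (hh : Brick h) :
    ∀ t, Brick (blocks b h t)
  | none => hh
  | some i => (hb i).brick

theorem reflRel_blocks {b : Fin s → Fin 4 → Matrix (Fin 2) (Fin 2) ℂ}
    {h : Fin 4 → Matrix (Fin m) (Fin m) ℂ} (hb : ∀ i, ReflRel c (b i)) (hh : ReflRel c h) :
    ∀ t, ReflRel c (blocks b h t)
  | none => hh
  | some i => hb i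

/-- The blocks of a family in a stratum are told apart by a central element. -/
theorem exists_centralElt_blocks (hc : NoSubsum c) {b : Fin s → Fin 4 → Matrix (Fin 2) (Fin 2) ℂ}
    {h : Fin 4 → Matrix (Fin m) (Fin m) ℂ} (hb : ∀ i, ReflRel c (b i) ∧ Irred (b i))
    (hbb : ∀ i i', i ≠ i' → ¬ Similar (b i) (b i')) (hh : IsUnipotent c ε h) :
    ∃ (p : Fin 4 → Fin 4 → ℂ) (q : Fin 4 → Fin 4 → Fin 4 → ℂ) (ζ : Option (Fin s) → ℂ),
      Function.Injective ζ ∧ centralElt p q (dsum (blocks b h)) = diagonal fun x => ζ x.1 := by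
  choose σ ω hχ i j k hij hik hjk hσ using fun i => (hb i).2.exists_hasChar (hb i).1 hc
  let σ' : Option (Fin s) → Fin 4 → Fin 4 → ℂ := fun t => t.elim (fun _ _ => 1) σ
  let ω' : Option (Fin s) → Fin 4 → Fin 4 → Fin 4 → ℂ := fun t => t.elim (fun _ _ _ => 0) ω
  obtain ⟨p, q, hpq⟩ := exists_charValue_injective (σ := σ') (ω := ω') (by
    have h0 : ∀ x, σ x ≠ fun _ _ => 1 := fun x hx => by
      have := hσ x
      rw [hx] at this
      norm_num at this
    rintro (_ | x) (_ | x') ht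
    · exact absurd rfl ht
    · exact Or.inl (h0 x').symm
    · exact Or.inl (h0 x)
    · by_contra! H
      obtain ⟨H1, H2⟩ : σ x = σ x' ∧ ω x = ω x' := H
      refine hbb x x' (by simpa using ht) ?_
      have h1 := (hχ x).similar_normalForm (hb x).1 hc.ne_zero (Or.inl (hb x).2.brick) (hij x)
        (hik x) (hjk x) (hσ x)
      have h2 := (H1 ▸ H2 ▸ hχ x' : HasChar (b x') (σ x) (ω x)).similar_normalForm (hb x').1
        hc.ne_zero (Or.inl (hb x').2.brick) (hij x) (hik x) (hjk x) (hσ x)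
      exact h1.trans h2.symm)
  refine ⟨p, q, _, hpq, centralElt_dsum (fun t => ?_) p q⟩
  cases t
  · exact hh.hasChar
  · exact hχ _

theorem nonempty_blocks [Nonempty (Fin m)] : ∀ t : Option (Fin s), Nonempty (Fin (blockSize m t))
  | none => ‹_›
  | some _ => ⟨(0 : Fin 2)⟩

end Separation
end DSP

/-! ### Recognition of the decomposition from a Gram determinant -/

namespace DSP

open Matrix

section Recognition

variable {ι : Type*} [Fintype ι] [DecidableEq ι] {c : Fin 4 → ℂ} {r : Fin 4 → Matrix ι ι ℂ}

theorem commute_apply_eq_zero {d : ι → ℂ} {M : Matrix ι ι ℂ} (h : Commute (diagonal d) M)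
    {x y : ι} (hxy : d x ≠ d y) : M x y = 0 := by
  have := congrFun (congrFun h.eq x) y
  rw [mul_diagonal, diagonal_mul, mul_comm, ← sub_eq_zero, ← mul_sub] at this
  exact (mul_eq_zero.1 this).resolve_right (sub_ne_zero.2 hxy)

/-- Under the conditions of `eq_zero_of_isNilpotent_of_gram`, the family decomposes into bricks,
indexed by the eigenvalues of the central element. -/
theorem exists_similar_dsum_of_gram {N : ℕ} (hc : ∀ j, c j ≠ 0) (h : ReflRel c r)
    {p : Fin 4 → Fin 4 → ℂ} {q : Fin 4 → Fin 4 → Fin 4 → ℂ}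
    (hgram : (gram N (centralElt p q r)).det ≠ 0) (hcent : Module.finrank ℂ (cent r) ≤ N) :
    ∃ (d : ι → ℂ) (B : ∀ t : Set.range d, Fin 4 → Matrix {x // Set.rangeFactorization d x = t}
        {x // Set.rangeFactorization d x = t} ℂ),
      Similar r (dsum B) ∧ (∀ t, Brick (B t)) ∧ Nat.card (Set.range d) = N ∧
      centralElt p q (dsum B) = diagonal fun x => (x.1 : ℂ) := by
  classical
  obtain ⟨P, Q, d, h1, h2, h3⟩ :=
    exists_diagonalization_of_gram hgram (h.commute_centralElt hc p q) hcent
  let r' : Fin 4 → Matrix ι ι ℂ := fun j => conjAlg Q P h2 h1 (r j)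
  have hr' : centralElt p q r' = diagonal d := by
    rw [show r' = fun j => (conjAlg Q P h2 h1).toAlgHom (r j) from rfl, ← map_centralElt]
    change Q * _ * P = _
    rw [Matrix.mul_assoc, h3, ← Matrix.mul_assoc, h2, Matrix.one_mul]
  have hsim : Similar r r' := by
    refine ⟨P, Q, h1, h2, fun j => ?_⟩
    change _ = P * (Q * r j * P)
    rw [← Matrix.mul_assoc, ← Matrix.mul_assoc, h1, Matrix.one_mul]
  have hR' : ReflRel c r' := hsim.symm.reflRel h
  have hcomm : ∀ j x y, d x ≠ d y → r' j x y = 0 := fun j x y hxy =>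
    commute_apply_eq_zero (hr' ▸ hR'.commute_centralElt hc p q j) hxy
  let lab := Set.rangeFactorization d
  let B : ∀ t : Set.range d, Fin 4 → Matrix {x // lab x = t} {x // lab x = t} ℂ :=
    fun t j => (r' j).toSquareBlock lab t
  have hdsum := dsum_toSquareBlock r' lab fun j x y hxy =>
    hcomm j x y fun e => hxy (Subtype.ext e)
  have hsim' : Similar r' (dsum B) := by
    rw [hdsum]
    exact Similar.reindex r' _
  have hRB : ReflRel c (dsum B) := hsim'.symm.reflRel hR'
  have hz : centralElt p q (dsum B) = diagonal fun x => (x.1 : ℂ) := by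
    rw [hdsum]
    have := map_centralElt (reindexAlgEquiv ℂ ℂ (Equiv.sigmaFiberEquiv lab).symm).toAlgHom p q r'
    refine this.symm.trans ?_
    rw [hr']
    change (diagonal d).submatrix _ _ = _
    rw [submatrix_diagonal_equiv]
    congr 1
    funext ⟨t, x, hx⟩
    exact congrArg Subtype.val hx
  have : ∀ t : Set.range d, Nonempty {x // lab x = t} := by
    rintro ⟨_, x, rfl⟩
    exact ⟨⟨x, rfl⟩⟩
  let D : (Set.range d → ℂ) →ₗ[ℂ]
      Matrix (Σ t, {x // lab x = t}) (Σ t, {x // lab x = t}) ℂ :=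
    { toFun := fun f => diagonal fun x => f x.1
      map_add' := fun f g => by rw [diagonal_add]; rfl
      map_smul' := fun a f => by rw [← diagonal_smul]; rfl }
  have hD : Function.Injective D := by
    intro f g h
    funext t
    obtain ⟨x⟩ := this t
    exact congrFun (diagonal_injective h) ⟨t, x⟩
  have hDle : LinearMap.range D ≤ cent (dsum B) := by
    rintro _ ⟨f, rfl⟩ j
    ext ⟨t, x⟩ ⟨t', y⟩
    change ((diagonal fun x : Σ t, {x // lab x = t} => f x.1) * dsum B j) _ _ =
      (dsum B j * (diagonal fun x : Σ t, {x // lab x = t} => f x.1)) _ _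
    rw [mul_diagonal, diagonal_mul, mul_comm]
    by_cases ht : t = t'
    · subst ht; rfl
    · rw [dsum, blockDiagonal'_apply_ne _ _ _ ht, zero_mul, zero_mul]
  have hle := Submodule.finrank_mono hDle
  rw [LinearMap.finrank_range_of_inj hD, Module.finrank_fintype_fun_eq_card,
    ← (hsim.trans hsim').finrank_cent] at hle
  rw [(hsim.trans hsim').gram_eq] at hgram
  have hge : N ≤ Fintype.card (Set.range d) := by
    have h4 := linearIndependent_pow_of_gram hgram
    have h5 : Submodule.span ℂ (Set.range fun a : Fin N => centralElt p q (dsum B) ^ a.val) ≤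
        LinearMap.range D := by
      rw [Submodule.span_le]
      rintro _ ⟨a, rfl⟩
      refine ⟨fun t => (t : ℂ) ^ a.val, ?_⟩
      simp only [hz, diagonal_pow]
      rfl
    have h6 := Submodule.finrank_mono h5
    rwa [finrank_span_eq_card h4, Fintype.card_fin, LinearMap.finrank_range_of_inj hD,
      Module.finrank_fintype_fun_eq_card] at h6
  have hcard : Fintype.card (Set.range d) = N := le_antisymm (hle.trans hcent) hge
  have hDeq : LinearMap.range D = cent (dsum B) := by
    refine Submodule.eq_of_le_of_finrank_le hDle ?_
    rw [LinearMap.finrank_range_of_inj hD, Module.finrank_fintype_fun_eq_card, hcard,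
      ← (hsim.trans hsim').finrank_cent]
    exact hcent
  refine ⟨d, B, hsim.trans hsim', fun t Z hZ => ?_, by rw [Nat.card_eq_fintype_card, hcard], hz⟩
  have h7 : blockDiagonal' (Pi.single t Z) ∈ cent (dsum B) := by
    intro j
    rw [dsum, ← blockDiagonal'_mul, ← blockDiagonal'_mul]
    congr 1
    funext t'
    by_cases ht : t' = t
    · subst ht
      simpa using (hZ j).eq
    · simp [Pi.single_eq_of_ne ht]
  rw [← hDeq] at h7
  obtain ⟨f, hf⟩ := h7
  refine ⟨f t, ?_⟩
  ext x y
  have h8 := congrFun (congrFun hf ⟨t, x⟩) ⟨t, y⟩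
  rw [blockDiagonal'_apply_eq, Pi.single_eq_same] at h8
  rw [← h8]
  change (diagonal fun x : Σ t, {x // lab x = t} => f x.1) _ _ = _
  by_cases hx : x = y <;> simp [hx]

/-- The conditions that single out a stratum among the solutions near a given one. -/
theorem isHB_of_gram {k s : ℕ} {ε : ℂ} (hs : s ≤ k) (hc : NoSubsum c)
    (hcard : Fintype.card ι = 2 * k + 1)
    {h : Fin 4 → Matrix (Fin (2 * (k - s) + 1)) (Fin (2 * (k - s) + 1)) ℂ}
    (hh : IsUnipotent c ε h) (hr : ReflRel c r) (htr : ∀ j, (r j).trace = -1)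
    {p : Fin 4 → Fin 4 → ℂ} {q : Fin 4 → Fin 4 → Fin 4 → ℂ}
    (hgram : (gram (s + 1) (centralElt p q r)).det ≠ 0)
    (hcent : Module.finrank ℂ (cent r) ≤ s + 1) (hfix : NoFix r ε) : IsHB c s h r := by
  classical
  obtain ⟨d, B, hsim, hB, hN, hz⟩ := exists_similar_dsum_of_gram hc.ne_zero hr hgram hcent
  have hR : ∀ t, ReflRel c (B t) := reflRel_dsum_iff.1 (hsim.symm.reflRel hr)
  have hne : ∀ t : Set.range d, Nonempty {x // Set.rangeFactorization d x = t} := by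
    rintro ⟨_, x, rfl⟩
    exact ⟨⟨x, rfl⟩⟩
  choose σ ω hχ using fun t => (hB t).exists_hasChar (hR t) hc.ne_zero
  have hval : ∀ t : Set.range d, charValue p q (σ t) (ω t) = t := by
    intro t
    obtain ⟨x⟩ := hne t
    exact congrFun (diagonal_injective ((centralElt_dsum hχ p q).symm.trans hz)) ⟨t, x⟩
  -- a unipotent block belongs to the value of the central element at the scalars `1`, `0`
  have huni : ∀ t, (∀ i j, σ t i j = 1) →
      (σ t = fun _ _ => 1) ∧ ω t = fun _ _ _ => 0 := fun t ht =>
    ⟨funext fun i => funext fun j => ht i j, funext fun i => funext fun j => funext fun k =>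
      ((hχ t).sub_mul_sub_eq_zero (hR t) ht i j k).2⟩
  have hother : ∀ t, (¬ ∀ i j, σ t i j = 1) → ∃ b : Fin 4 → Matrix (Fin 2) (Fin 2) ℂ,
      Similar (B t) b ∧ ReflRel c b ∧ Irred b := by
    intro t ht
    obtain ⟨i, j, hij⟩ := ((hχ t).dichotomy (hR t) hc).resolve_left ht
    have hij' : i ≠ j := by
      rintro rfl
      rw [(hχ t).self_eq_one (hR t), one_pow] at hij
      exact hij rfl
    obtain ⟨k, hik, hjk⟩ : ∃ k : Fin 4, i ≠ k ∧ j ≠ k := by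
      clear hij
      revert i j
      decide
    have h1 := (hχ t).similar_normalForm (hR t) hc.ne_zero (Or.inl (hB t)) hij' hik hjk hij
    have h2 := h1.symm.reflRel (hR t)
    exact ⟨_, h1, h2, (h1.symm.hasChar (hχ t)).irred h2 (by simp) hij⟩
  have hother_tr : ∀ t, (¬ ∀ i j, σ t i j = 1) → ∀ j, (B t j).trace = 0 := by
    intro t ht j
    obtain ⟨b, h1, h2, h3⟩ := hother t ht
    rw [h1.trace_eq, h3.trace_eq_zero h2 hc]
  have htrace : ∀ j, ∑ t, (B t j).trace = -1 := fun j => by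
    rw [← trace_dsum, ← hsim.trace_eq, htr]
  obtain ⟨t₀, ht₀⟩ : ∃ t, ∀ i j, σ t i j = 1 := by
    by_contra! H
    have := htrace 0
    rw [Finset.sum_eq_zero fun t _ => hother_tr t (by
      obtain ⟨i, j, hij⟩ := H t
      exact fun h => hij (h i j)) 0] at this
    norm_num at this
  have hother₀ : ∀ t, t ≠ t₀ → ¬ ∀ i j, σ t i j = 1 := by
    intro t ht h
    refine ht (Subtype.ext ?_)
    rw [← hval, ← hval, (huni t h).1, (huni t h).2, (huni t₀ ht₀).1, (huni t₀ ht₀).2]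
  have hU : IsUnipotent c ε (B t₀) := by
    refine ⟨hR t₀, hB t₀, ?_, fun j => ?_, ?_, hh.eps⟩
    · have := hχ t₀
      rwa [(huni t₀ ht₀).1, (huni t₀ ht₀).2] at this
    · rw [← htrace j, Finset.sum_eq_single t₀ (fun t _ ht => hother_tr t (hother₀ t ht) j)
        (by simp)]
    · intro u hu
      have h1 := hsim.symm.noFix hfix
        (fun x => if hx : x.1 = t₀ then u (hx ▸ x.2) else 0) (fun j => ?_)
      · funext x
        simpa using congrFun h1 ⟨t₀, x⟩
      · ext ⟨t, x⟩
        have h2 := congrFun (hu j)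
        simp only [mulVec, dotProduct, dsum, Pi.smul_apply] at h2 ⊢
        rw [Fintype.sum_sigma, Finset.sum_eq_single t₀]
        · by_cases ht : t = t₀
          · subst ht
            simpa [blockDiagonal'_apply_eq] using h2 x
          · simp [blockDiagonal'_apply_ne _ _ _ ht, ht]
        · intro t' _ ht'
          simp [ht']
        · simp
  have hcardB : ∀ t, t ≠ t₀ → Fintype.card {x // Set.rangeFactorization d x = t} = 2 := by
    intro t ht
    obtain ⟨b, ⟨P, Q, h1, h2, _⟩, _⟩ := hother t (hother₀ t ht)
    have h3 := congrArg trace h1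
    rw [trace_mul_comm, h2, trace_one, trace_one] at h3
    simpa using (Nat.cast_injective h3).symm
  have hN' : Fintype.card {t : Set.range d // t ≠ t₀} = s := by
    have := Fintype.card_subtype_compl fun t : Set.range d => t = t₀
    rw [Fintype.card_subtype_eq, ← Nat.card_eq_fintype_card (α := Set.range d), hN,
      Nat.add_sub_cancel] at this
    exact this
  have hcard₀ : Fintype.card {x // Set.rangeFactorization d x = t₀} = 2 * (k - s) + 1 := by
    have h1 : ∑ t, Fintype.card {x // Set.rangeFactorization d x = t} = 2 * k + 1 := by
      rw [← Fintype.card_sigma, ← hcard]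
      exact Fintype.card_congr (Equiv.sigmaFiberEquiv _)
    rw [← Finset.add_sum_erase _ _ (Finset.mem_univ t₀), Finset.sum_congr rfl fun t ht =>
      hcardB t (Finset.ne_of_mem_erase ht), Finset.sum_const, Finset.card_erase_of_mem
      (Finset.mem_univ t₀), Finset.card_univ, ← Nat.card_eq_fintype_card (α := Set.range d), hN,
      smul_eq_mul] at h1
    omega
  let e : Option (Fin s) ≃ Set.range d :=
    ((Fintype.equivFinOfCardEq hN').symm.optionCongr).trans (Equiv.optionSubtypeNe t₀)
  have he : e none = t₀ := rfl
  have he' : ∀ i, e (some i) ≠ t₀ := fun i h => by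
    have := e.injective (h.trans he.symm)
    exact absurd this (by simp)
  choose b hb1 hb2 hb3 using fun i => hother (e (some i)) (hother₀ _ (he' i))
  refine ⟨b, fun i => ⟨hb2 i, hb3 i⟩, fun i i' hi hsim' => hi ?_, ?_⟩
  · have h1 := (((hb1 i).trans hsim').trans (hb1 i').symm).hasChar (hχ (e (some i')))
    have h2 := smul_one_injective
      (((hχ (e (some i))).centralElt_eq p q).symm.trans (h1.centralElt_eq p q))
    rw [hval, hval] at h2
    exact Option.some_injective _ (e.injective (Subtype.ext h2))
  · refine hsim.trans ((similar_dsum_comp e B).symm.trans (Similar.dsum fun t => ?_))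
    cases t
    · exact hU.similar hc.ne_zero hh hcard₀ (Fintype.card_fin _)
    · exact hb1 _

end Recognition
end DSP

/-! ### Strata are open in the variety of solutions -/

namespace DSP

open Matrix MvPolynomial

section Semicontinuity

/-- The dimension of the kernel of a matrix of polynomials is Zariski upper semicontinuous. -/
theorem exists_forall_finrank_ker_le {ι α β : Type*} [Fintype α] [Fintype β]
    [DecidableEq β] (M : Matrix α β (MvPolynomial ι ℂ)) (x : ι → ℂ) :
    ∃ h : MvPolynomial ι ℂ, eval x h ≠ 0 ∧ ∀ y, eval y h ≠ 0 →
      Module.finrank ℂ (LinearMap.ker (mulVecLin (M.map (eval y)))) ≤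
        Module.finrank ℂ (LinearMap.ker (mulVecLin (M.map (eval x)))) := by
  classical
  set K := LinearMap.ker (mulVecLin (M.map (eval x))) with hK
  -- a projection `E` to the kernel at `x`, and a partial inverse `N`
  obtain ⟨E', hE'⟩ := LinearMap.exists_leftInverse_of_injective K.subtype (Submodule.ker_subtype K)
  let E : (β → ℂ) →ₗ[ℂ] (β → ℂ) := K.subtype ∘ₗ E'
  obtain ⟨N, hN⟩ := LinearMap.exists_leftInverse_of_injective
    (mulVecLin (M.map (eval x)) ∘ₗ (LinearMap.ker E').subtype) (by
      rw [LinearMap.ker_eq_bot']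
      intro v hv
      have h1 : (v : β → ℂ) ∈ K := hv
      have h2 := LinearMap.congr_fun hE' ⟨v, h1⟩
      have h3 : E' v = 0 := v.2
      simp only [LinearMap.comp_apply, Submodule.subtype_apply, h3, LinearMap.id_apply] at h2
      exact Subtype.ext (congrArg Subtype.val h2).symm)
  let N' : (α → ℂ) →ₗ[ℂ] (β → ℂ) := (LinearMap.ker E').subtype ∘ₗ N
  let G : Matrix β β (MvPolynomial ι ℂ) :=
    ((LinearMap.toMatrix' N').map C : Matrix β α (MvPolynomial ι ℂ)) * M +
      (LinearMap.toMatrix' E).map C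
  have hG : ∀ y v, G.map (eval y) *ᵥ v = N' (M.map (eval y) *ᵥ v) + E v := by
    intro y v
    have h1 : G.map (eval y) =
        LinearMap.toMatrix' N' * M.map (eval y) + LinearMap.toMatrix' E := by
      rw [Matrix.map_add _ (map_add _), Matrix.map_mul, Matrix.map_map, Matrix.map_map]
      congr 2
      · ext a b; simp
      · ext a b; simp
    rw [h1, add_mulVec, ← mulVec_mulVec, LinearMap.toMatrix'_mulVec, LinearMap.toMatrix'_mulVec]
  refine ⟨G.det, ?_, fun y hy => ?_⟩
  · have h1 : G.map (eval x) = 1 := by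
      refine Matrix.ext_of_mulVec_single fun i => ?_
      generalize (Pi.single i 1 : β → ℂ) = v
      have h2 : E' (v - E v) = 0 := by
        rw [map_sub, sub_eq_zero]
        exact (LinearMap.congr_fun hE' (E' v)).symm
      have h3 : M.map (eval x) *ᵥ v = M.map (eval x) *ᵥ (v - E v) := by
        rw [mulVec_sub, show M.map (eval x) *ᵥ E v = 0 from (E' v).2, sub_zero]
      have h4 : N (M.map (eval x) *ᵥ (v - E v)) = ⟨v - E v, h2⟩ :=
        LinearMap.congr_fun hN ⟨v - E v, h2⟩
      rw [hG, h3, one_mulVec]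
      simp only [N', LinearMap.comp_apply, h4, Submodule.subtype_apply, sub_add_cancel]
    rw [RingHom.map_det, RingHom.mapMatrix_apply, h1, det_one]
    exact one_ne_zero
  · rw [RingHom.map_det, RingHom.mapMatrix_apply] at hy
    refine LinearMap.finrank_le_finrank_of_injective
      (f := E' ∘ₗ (LinearMap.ker (mulVecLin (M.map (eval y)))).subtype) ?_
    rw [← LinearMap.ker_eq_bot, LinearMap.ker_eq_bot']
    rintro ⟨v, hv⟩ hv'
    have h1 : M.map (eval y) *ᵥ v = 0 := hv
    have h2 : E' v = 0 := hv'
    refine Subtype.ext (Matrix.eq_zero_of_mulVec_eq_zero hy ?_)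
    rw [hG, h1, map_zero, zero_add]
    simp only [E, LinearMap.comp_apply, h2, map_zero]

end Semicontinuity

section GenericMatrices

variable {n : ℕ}

/-- The quadruple of generic matrices. -/
noncomputable def genericQuad (n : ℕ) :
    Fin 4 → Matrix (Fin n) (Fin n) (MvPolynomial (Fin 4 × Fin n × Fin n) ℂ) :=
  fun j => of fun a b => X (j, a, b)

/-- Evaluation of polynomial matrices at a quadruple. -/
noncomputable def evalQuad (A : Quad n) :
    Matrix (Fin n) (Fin n) (MvPolynomial (Fin 4 × Fin n × Fin n) ℂ) →ₐ[ℂ]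
      Matrix (Fin n) (Fin n) ℂ :=
  (aeval (coords A)).mapMatrix

theorem evalQuad_apply (A : Quad n)
    (M : Matrix (Fin n) (Fin n) (MvPolynomial (Fin 4 × Fin n × Fin n) ℂ)) :
    evalQuad A M = M.map (eval (coords A)) := rfl

theorem evalQuad_genericQuad (A : Quad n) (j : Fin 4) : evalQuad A (genericQuad n j) = A j := by
  ext a b
  simp [evalQuad_apply, genericQuad, coords]

theorem coords_injective : Function.Injective (coords : Quad n → Fin 4 × Fin n × Fin n → ℂ) := by
  intro A B h
  funext j
  ext a b
  exact congrFun h (j, a, b)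

/-- The dimension of the centralizer is Zariski upper semicontinuous. -/
theorem exists_forall_finrank_cent_le (A : Quad n) :
    ∃ h : MvPolynomial (Fin 4 × Fin n × Fin n) ℂ, eval (coords A) h ≠ 0 ∧ ∀ B : Quad n,
      eval (coords B) h ≠ 0 → Module.finrank ℂ (cent B) ≤ Module.finrank ℂ (cent A) := by
  let M : Matrix (Fin 4 × Fin n × Fin n) (Fin n × Fin n) (MvPolynomial (Fin 4 × Fin n × Fin n) ℂ) :=
    of fun x y => (if x.2.1 = y.1 then X (x.1, y.2, x.2.2) else 0) -
      (if x.2.2 = y.2 then X (x.1, x.2.1, y.1) else 0)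
  have key : ∀ B : Quad n, Module.finrank ℂ (LinearMap.ker (mulVecLin (M.map (eval (coords B))))) =
      Module.finrank ℂ (cent B) := by
    intro B
    let e : (Fin n × Fin n → ℂ) ≃ₗ[ℂ] Matrix (Fin n) (Fin n) ℂ :=
      LinearEquiv.curry ℂ ℂ (Fin n) (Fin n)
    have h1 : ∀ v, M.map (eval (coords B)) *ᵥ v = 0 ↔ e v ∈ cent B := by
      intro v
      have h2 : ∀ j a b, (M.map (eval (coords B)) *ᵥ v) (j, a, b) =
          (e v * B j) a b - (B j * e v) a b := by
        intro j a b
        simp only [mulVec, dotProduct, M, map_apply, of_apply, map_sub, sub_mul,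
          Finset.sum_sub_distrib, apply_ite (eval (coords B)), map_zero, eval_X, Matrix.mul_apply,
          Fintype.sum_prod_type, ite_mul, zero_mul, Finset.sum_ite_eq, Finset.mem_univ, if_true]
        congr 1
        · rw [Finset.sum_eq_single a]
          · simp only [if_true]
            exact Finset.sum_congr rfl fun x _ => mul_comm _ _
          · intro x _ hx
            simp [hx.symm]
          · simp
      constructor
      · intro h j
        ext a b
        rw [← sub_eq_zero, ← h2, h]
        rfl
      · intro h
        funext ⟨j, a, b⟩
        rw [h2, h j, sub_self]
        rfl
    have h3 : cent B = (LinearMap.ker (mulVecLin (M.map (eval (coords B))))).map e.toLinearMap := by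
      ext Z
      rw [Submodule.mem_map]
      constructor
      · intro hZ
        exact ⟨e.symm Z, (h1 _).2 (by rwa [e.apply_symm_apply]), e.apply_symm_apply Z⟩
      · rintro ⟨v, hv, rfl⟩
        exact (h1 v).1 hv
    rw [h3]
    exact (LinearEquiv.finrank_map_eq e _).symm
  obtain ⟨h, h1, h2⟩ := exists_forall_finrank_ker_le M (coords A)
  refine ⟨h, h1, fun B hB => ?_⟩
  rw [← key, ← key]
  exact h2 _ hB

/-- The absence of common eigenvectors with given eigenvalues is a Zariski open condition. -/
theorem exists_forall_no_common_eigenvector (A : Quad n) (ν : Fin 4 → ℂ)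
    (hA : ∀ u : Fin n → ℂ, (∀ j, A j *ᵥ u = ν j • u) → u = 0) :
    ∃ h : MvPolynomial (Fin 4 × Fin n × Fin n) ℂ, eval (coords A) h ≠ 0 ∧ ∀ B : Quad n,
      eval (coords B) h ≠ 0 → ∀ u : Fin n → ℂ, (∀ j, B j *ᵥ u = ν j • u) → u = 0 := by
  let M : Matrix (Fin 4 × Fin n) (Fin n) (MvPolynomial (Fin 4 × Fin n × Fin n) ℂ) :=
    of fun x y => X (x.1, x.2, y) - if x.2 = y then C (ν x.1) else 0
  have key : ∀ (B : Quad n) u, M.map (eval (coords B)) *ᵥ u = 0 ↔ ∀ j, B j *ᵥ u = ν j • u := by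
    intro B u
    have h1 : ∀ j a, (M.map (eval (coords B)) *ᵥ u) (j, a) = (B j *ᵥ u) a - (ν j • u) a := by
      intro j a
      simp [mulVec, dotProduct, M, sub_mul, Finset.sum_sub_distrib, apply_ite (eval (coords B)),
        coords]
    constructor
    · intro h j
      funext a
      rw [← sub_eq_zero, ← h1, h]
      rfl
    · intro h
      funext ⟨j, a⟩
      rw [h1, h j, sub_self]
      rfl
  obtain ⟨h, h1, h2⟩ := exists_forall_finrank_ker_le M (coords A)
  have h3 : LinearMap.ker (mulVecLin (M.map (eval (coords A)))) = ⊥ := by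
    rw [LinearMap.ker_eq_bot']
    exact fun u hu => hA u ((key A u).1 hu)
  rw [h3, finrank_bot] at h2
  refine ⟨h, h1, fun B hB u hu => ?_⟩
  have h4 := Submodule.finrank_eq_zero.1 (Nat.le_zero.1 (h2 _ hB))
  have h5 : u ∈ LinearMap.ker (mulVecLin (M.map (eval (coords B)))) := (key B u).2 hu
  rwa [h4, Submodule.mem_bot] at h5

end GenericMatrices

section Openness

variable {lam mu : Fin 4 → ℂ}

theorem commute_centralElt_of_mem_cent {ι : Type*} [Fintype ι] [DecidableEq ι]
    {r : Fin 4 → Matrix ι ι ℂ} {Z : Matrix ι ι ℂ} (hZ : Z ∈ cent r) (p : Fin 4 → Fin 4 → ℂ)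
    (q : Fin 4 → Fin 4 → Fin 4 → ℂ) : Commute Z (centralElt p q r) := by
  have h : ∀ j, Commute Z (r j) := hZ
  refine Commute.add_right ?_ ?_
  · exact Commute.sum_right _ _ _ fun i _ => Commute.sum_right _ _ _ fun j _ =>
      (((h i).mul_right (h j)).add_right ((h j).mul_right (h i))).smul_right _
  · exact Commute.sum_right _ _ _ fun i _ => Commute.sum_right _ _ _ fun j _ =>
      Commute.sum_right _ _ _ fun k _ => ((((h i).mul_right (h j)).mul_right (h k)).sub_right
        (((h k).mul_right (h j)).mul_right (h i))).smul_right _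

theorem finrank_cent_of_isHB {ι : Type*} [Fintype ι] [DecidableEq ι] {c : Fin 4 → ℂ} {m s : ℕ}
    [Nonempty (Fin m)] {ε : ℂ} (hc : NoSubsum c) {h : Fin 4 → Matrix (Fin m) (Fin m) ℂ}
    (hh : IsUnipotent c ε h) {r : Fin 4 → Matrix ι ι ℂ} (hr : IsHB c s h r) :
    Module.finrank ℂ (cent r) = s + 1 := by
  obtain ⟨b, hb, hbb, hsim⟩ := hr
  obtain ⟨p, q, ζ, hζ, hz⟩ := exists_centralElt_blocks hc hb hbb hh
  have hne' : ∀ t : Option (Fin s), Nonempty (Fin (blockSize m t)) := nonempty_blocks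
  rw [hsim.finrank_cent, finrank_cent_dsum (brick_blocks (fun i => (hb i).2) hh.brick) hζ fun Z hZ =>
    hz ▸ commute_centralElt_of_mem_cent hZ p q, Fintype.card_option, Fintype.card_fin]

theorem noFix_of_isHB {ι : Type*} [Fintype ι] [DecidableEq ι] {c : Fin 4 → ℂ} {m s : ℕ} {ε : ℂ}
    {h : Fin 4 → Matrix (Fin m) (Fin m) ℂ} (hh : IsUnipotent c ε h) {r : Fin 4 → Matrix ι ι ℂ}
    (hr : IsHB c s h r) : NoFix r ε := by
  obtain ⟨b, hb, hbb, hsim⟩ := hr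
  refine hsim.noFix fun u hu => ?_
  have h1 : ∀ t j, blocks b h t j *ᵥ (fun x => u ⟨t, x⟩) = ε • fun x => u ⟨t, x⟩ := by
    intro t j
    funext x
    have := congrFun (hu j) ⟨t, x⟩
    simp only [mulVec, dotProduct, dsum, Pi.smul_apply] at this ⊢
    rw [Fintype.sum_sigma, Finset.sum_eq_single t] at this
    · simpa only [blockDiagonal'_apply_eq] using this
    · intro t' _ ht'
      simp [blockDiagonal'_apply_ne _ _ _ ht'.symm]
    · simp
  -- an irreducible block has no common eigenvector
  have h2 : ∀ t, (fun x => u ⟨t, x⟩) = (0 : Fin (blockSize m t) → ℂ) := by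
    rintro (_ | i)
    · exact hh.noFix _ (h1 none)
    · by_contra h0
      have h3 := h1 (some i)
      let v : Fin 2 → ℂ := fun x => u ⟨some i, x⟩
      have h4 : ∀ j, b i j *ᵥ v = ε • v := h3
      have h5 : v ≠ 0 := h0
      rcases (hb i).2 (Submodule.span ℂ {v}) (fun j w hw => by
        obtain ⟨a, rfl⟩ := Submodule.mem_span_singleton.1 hw
        rw [mulVec_smul, h4]
        exact Submodule.smul_mem _ _ (Submodule.smul_mem _ _ (Submodule.mem_span_singleton_self v))) with H | H
      · exact h5 (Submodule.span_singleton_eq_bot.1 H)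
      · have := finrank_span_singleton (K := ℂ) h5
        rw [H, finrank_top] at this
        simp at this
  funext ⟨t, x⟩
  exact congrFun (h2 t) x

/-- Near each of its points, in the Zariski topology, a stratum contains all quadruples of the
variety. -/
theorem exists_forall_isHB {k s : ℕ} {ε : ℂ} (hs : s ≤ k) (hne : ∀ j, lam j ≠ mu j)
    (hc : NoSubsum fun j => mu j - lam j)
    {h : Fin 4 → Matrix (Fin (2 * (k - s) + 1)) (Fin (2 * (k - s) + 1)) ℂ}
    (hh : IsUnipotent (fun j => mu j - lam j) ε h) {A : Quad (2 * k + 1)}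
    (hA : IsHB (fun j => mu j - lam j) s h (toRefl lam mu A)) :
    ∃ f : MvPolynomial (Fin 4 × Fin (2 * k + 1) × Fin (2 * k + 1)) ℂ, eval (coords A) f ≠ 0 ∧
      ∀ B : Quad (2 * k + 1), eval (coords B) f ≠ 0 →
        ReflRel (fun j => mu j - lam j) (toRefl lam mu B) →
        (∀ j, (toRefl lam mu B j).trace = -1) →
        IsHB (fun j => mu j - lam j) s h (toRefl lam mu B) := by
  obtain ⟨f₁, hf₁, hf₁'⟩ := exists_forall_finrank_cent_le A
  rw [← cent_toRefl hne A, finrank_cent_of_isHB hc hh hA] at hf₁'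
  have hfix : ∀ B : Quad (2 * k + 1), NoFix (toRefl lam mu B) ε ↔ ∀ u : Fin (2 * k + 1) → ℂ,
      (∀ j, B j *ᵥ u = ((2⁻¹ : ℂ) * (lam j + mu j + (mu j - lam j) * ε)) • u) → u = 0 := by
    intro B
    simp only [NoFix, toRefl_mulVec_eq_smul_iff hne]
  obtain ⟨f₂, hf₂, hf₂'⟩ :=
    exists_forall_no_common_eigenvector A _ ((hfix A).1 (noFix_of_isHB hh hA))
  obtain ⟨b, hb, hbb, hsim⟩ := hA
  obtain ⟨p, q, ζ, hζ, hz⟩ := exists_centralElt_blocks hc hb hbb hh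
  have hne' : ∀ t : Option (Fin s), Nonempty (Fin (blockSize (2 * (k - s) + 1) t)) :=
    nonempty_blocks
  let f₃ := (gram (s + 1) (centralElt p q (toRefl lam mu (genericQuad (2 * k + 1))))).det
  have hf₃ : ∀ B : Quad (2 * k + 1), eval (coords B) f₃ =
      (gram (s + 1) (centralElt p q (toRefl lam mu B))).det := by
    intro B
    rw [RingHom.map_det]
    congr 1
    ext x y
    have h1 : centralElt p q (toRefl lam mu B) =
        evalQuad B (centralElt p q (toRefl lam mu (genericQuad (2 * k + 1)))) := by
      rw [map_centralElt]
      congr 1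
      funext j
      rw [map_toRefl]
      simp only [evalQuad_genericQuad]
    simp only [gram, RingHom.mapMatrix_apply, map_apply, of_apply, h1]
    rw [← map_pow, evalQuad_apply]
    exact AddMonoidHom.map_trace (eval (coords B)).toAddMonoidHom _
  refine ⟨f₁ * f₂ * f₃, ?_, fun B hB hR htr => ?_⟩
  · rw [map_mul, map_mul, hf₃, hsim.gram_eq, hz]
    exact mul_ne_zero (mul_ne_zero hf₁ hf₂) (det_gram_diagonal_ne_zero (by simp) hζ)
  · rw [map_mul, map_mul] at hB
    have h1 := left_ne_zero_of_mul hB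
    refine isHB_of_gram hs hc (Fintype.card_fin _) hh hR htr (p := p) (q := q) ?_ ?_ ?_
    · rw [← hf₃]
      exact right_ne_zero_of_mul hB
    · rw [cent_toRefl hne]
      exact hf₁' B (left_ne_zero_of_mul h1)
    · exact (hfix B).2 (hf₂' B (right_ne_zero_of_mul h1))

end Openness
end DSP

/-! ### The tangent space -/

namespace DSP

open Matrix

section TangentSpace

variable {ι : Type*} [Fintype ι] [DecidableEq ι] {c : Fin 4 → ℂ} {r : Fin 4 → Matrix ι ι ℂ}

/-- The matrices that anticommute with `M`. -/
def anticomm {ι : Type*} [Fintype ι] (M : Matrix ι ι ℂ) : Submodule ℂ (Matrix ι ι ℂ) where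
  carrier := {X | M * X + X * M = 0}
  add_mem' {X Y} hX hY := by
    change M * (X + Y) + (X + Y) * M = 0
    rw [Matrix.mul_add, Matrix.add_mul, add_add_add_comm, hX, hY, add_zero]
  zero_mem' := by simp
  smul_mem' a X hX := by
    change M * (a • X) + (a • X) * M = 0
    rw [Matrix.mul_smul, Matrix.smul_mul, ← smul_add, hX, smul_zero]

theorem mem_anticomm {ι : Type*} [Fintype ι] {M X : Matrix ι ι ℂ} :
    X ∈ anticomm M ↔ M * X + X * M = 0 := Iff.rfl

theorem finrank_anticomm {M : Matrix ι ι ℂ} (h : M * M = 1) {p q : ℕ}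
    (hcard : Fintype.card ι = p + q) (htr : M.trace = (q : ℂ) - p) :
    Module.finrank ℂ (anticomm M) = 2 * (p * q) := by
  obtain ⟨P, Q, h1, h2, h3⟩ := exists_block_form_of_sq_eq_one h hcard htr
  set D : Matrix (Fin p ⊕ Fin q) (Fin p ⊕ Fin q) ℂ := fromBlocks (-1) 0 0 1 with hD
  let L : (Matrix (Fin p) (Fin q) ℂ × Matrix (Fin q) (Fin p) ℂ) →ₗ[ℂ] Matrix ι ι ℂ :=
    { toFun := fun X => P * (fromBlocks 0 X.1 X.2 0 : Matrix (Fin p ⊕ Fin q) (Fin p ⊕ Fin q) ℂ) * Q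
      map_add' := fun X Y => by
        rw [← Matrix.add_mul, ← Matrix.mul_add, Matrix.fromBlocks_add]
        simp
      map_smul' := fun a X => by
        rw [RingHom.id_apply, ← Matrix.smul_mul, ← Matrix.mul_smul, Matrix.fromBlocks_smul]
        simp }
  have hM : M = P * D * Q := by rw [← h3, Matrix.mul_assoc, h1, Matrix.mul_one]
  have hcancel : ∀ X : Matrix (Fin p ⊕ Fin q) (Fin p ⊕ Fin q) ℂ, Q * (P * X * Q) * P = X := by
    intro X
    calc Q * (P * X * Q) * P = (Q * P) * X * (Q * P) := by simp only [Matrix.mul_assoc]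
      _ = X := by rw [h2, Matrix.one_mul, Matrix.mul_one]
  have hmul : ∀ X Y : Matrix (Fin p ⊕ Fin q) (Fin p ⊕ Fin q) ℂ,
      (P * X * Q) * (P * Y * Q) = P * (X * Y) * Q := by
    intro X Y
    calc (P * X * Q) * (P * Y * Q) = P * X * (Q * P) * Y * Q := by simp only [Matrix.mul_assoc]
      _ = _ := by rw [h2, Matrix.mul_one]; simp only [Matrix.mul_assoc]
  have hL : Function.Injective L := by
    intro X Y hXY
    have h4 : (fromBlocks 0 X.1 X.2 0 : Matrix (Fin p ⊕ Fin q) (Fin p ⊕ Fin q) ℂ) =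
        fromBlocks 0 Y.1 Y.2 0 := by
      rw [← hcancel (fromBlocks 0 X.1 X.2 0), ← hcancel (fromBlocks 0 Y.1 Y.2 0)]
      exact congrArg (fun Z => Q * Z * P) hXY
    rw [Matrix.fromBlocks_inj] at h4
    exact Prod.ext h4.2.1 h4.2.2.1
  have hrange : LinearMap.range L = anticomm M := by
    ext X
    constructor
    · rintro ⟨Y, rfl⟩
      have hLY : L Y = P * (fromBlocks 0 Y.1 Y.2 0 :
        Matrix (Fin p ⊕ Fin q) (Fin p ⊕ Fin q) ℂ) * Q := rfl
      rw [mem_anticomm, hLY, hM, hmul, hmul, ← Matrix.add_mul, ← Matrix.mul_add, hD,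
        Matrix.fromBlocks_multiply,
        Matrix.fromBlocks_multiply, Matrix.fromBlocks_add]
      simp
    · intro hX
      have hX' : X = P * (Q * X * P) * Q := by
        calc X = (P * Q) * X * (P * Q) := by rw [h1, Matrix.one_mul, Matrix.mul_one]
          _ = _ := by simp only [Matrix.mul_assoc]
      have h4 : D * (Q * X * P) + (Q * X * P) * D = 0 := by
        have h5 : Q * (M * X + X * M) * P = 0 := by
          rw [mem_anticomm.1 hX, Matrix.mul_zero, Matrix.zero_mul]
        rw [hX', hM, hmul, hmul, ← Matrix.add_mul, ← Matrix.mul_add, hcancel] at h5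
        exact h5
      generalize Q * X * P = Z at h4 hX'
      rw [← Matrix.fromBlocks_toBlocks Z, hD, Matrix.fromBlocks_multiply,
        Matrix.fromBlocks_multiply, Matrix.fromBlocks_add, ← Matrix.fromBlocks_zero,
        Matrix.fromBlocks_inj] at h4
      have e1 : Z.toBlocks₁₁ = 0 := by
        have := h4.1
        simp only [Matrix.neg_mul, Matrix.one_mul, Matrix.zero_mul, add_zero, Matrix.mul_neg,
          Matrix.mul_one, Matrix.mul_zero] at this
        rw [← neg_add, neg_eq_zero, ← two_smul ℂ] at this
        exact (smul_eq_zero.1 this).resolve_left two_ne_zero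
      have e2 : Z.toBlocks₂₂ = 0 := by
        have := h4.2.2.2
        simp only [Matrix.one_mul, Matrix.zero_mul, zero_add,
          Matrix.mul_one, Matrix.mul_zero] at this
        rw [← two_smul ℂ] at this
        exact (smul_eq_zero.1 this).resolve_left two_ne_zero
      refine ⟨(Z.toBlocks₁₂, Z.toBlocks₂₁), ?_⟩
      rw [hX']
      change P * (fromBlocks 0 Z.toBlocks₁₂ Z.toBlocks₂₁ 0 :
        Matrix (Fin p ⊕ Fin q) (Fin p ⊕ Fin q) ℂ) * Q = _
      rw [← Matrix.fromBlocks_toBlocks Z, e1, e2]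
      simp
  rw [← hrange, LinearMap.finrank_range_of_inj hL]
  simp only [Module.finrank_prod, Module.finrank_matrix, Fintype.card_fin, Module.finrank_self]
  ring

/-- The trace form. -/
def traceForm (ι : Type*) [Fintype ι] : LinearMap.BilinForm ℂ (Matrix ι ι ℂ) :=
  LinearMap.mk₂ ℂ (fun X Y => (X * Y).trace) (fun X X' Y => by rw [Matrix.add_mul, trace_add])
    (fun a X Y => by rw [Matrix.smul_mul, trace_smul])
    (fun X Y Y' => by rw [Matrix.mul_add, trace_add])
    (fun a X Y => by rw [Matrix.mul_smul, trace_smul])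

theorem traceForm_apply {ι : Type*} [Fintype ι] (X Y : Matrix ι ι ℂ) :
    traceForm ι X Y = (X * Y).trace := rfl

theorem traceForm_nondegenerate {ι : Type*} [Fintype ι] : (traceForm ι).Nondegenerate := by
  constructor
  · intro X hX
    exact Matrix.ext_iff_trace_mul_right.2 fun Y => by rw [Matrix.zero_mul, trace_zero]; exact hX Y
  · intro X hX
    exact Matrix.ext_iff_trace_mul_left.2 fun Y => by rw [Matrix.mul_zero, trace_zero]; exact hX Y

/-- The derivative of the weighted sum `∑ c j • r j` when the `r j` are conjugated separately. -/
def sumComm (c : Fin 4 → ℂ) (r : Fin 4 → Matrix ι ι ℂ) :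
    (Fin 4 → Matrix ι ι ℂ) →ₗ[ℂ] Matrix ι ι ℂ where
  toFun X := ∑ j, c j • (X j * r j - r j * X j)
  map_add' X Y := by
    rw [← Finset.sum_add_distrib]
    refine Finset.sum_congr rfl fun j _ => ?_
    rw [← smul_add]
    congr 1
    rw [Pi.add_apply, Matrix.add_mul, Matrix.mul_add]
    abel
  map_smul' a X := by
    rw [RingHom.id_apply, Finset.smul_sum]
    refine Finset.sum_congr rfl fun j _ => ?_
    rw [Pi.smul_apply, Matrix.smul_mul, Matrix.mul_smul, ← smul_sub, smul_comm]

theorem sumComm_apply {ι : Type*} [Fintype ι] {r : Fin 4 → Matrix ι ι ℂ}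
    (X : Fin 4 → Matrix ι ι ℂ) :
    sumComm c r X = ∑ j, c j • (X j * r j - r j * X j) := rfl

theorem finrank_range_sumComm (hc : ∀ j, c j ≠ 0) (r : Fin 4 → Matrix ι ι ℂ) :
    Module.finrank ℂ (LinearMap.range (sumComm c r)) + Module.finrank ℂ (cent r) =
      Fintype.card ι ^ 2 := by
  have h1 : (traceForm ι).orthogonal (LinearMap.range (sumComm c r)) = cent r := by
    ext Z
    rw [LinearMap.BilinForm.mem_orthogonal_iff]
    constructor
    · intro h j
      rw [← sub_eq_zero]
      refine Matrix.ext_iff_trace_mul_left.2 fun Y => ?_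
      have h2 := h _ ⟨Pi.single j ((c j)⁻¹ • Y), rfl⟩
      rw [traceForm_apply] at h2
      have h3 : sumComm c r (Pi.single j ((c j)⁻¹ • Y)) = Y * r j - r j * Y := by
        rw [sumComm_apply, Finset.sum_eq_single j]
        · rw [Pi.single_eq_same, Matrix.smul_mul, Matrix.mul_smul, ← smul_sub,
            smul_inv_smul₀ (hc j)]
        · intro i _ hi
          simp [hi]
        · simp
      rw [h3, Matrix.sub_mul, trace_sub, Matrix.mul_assoc, Matrix.mul_assoc,
        trace_mul_comm (r j)] at h2
      rw [Matrix.mul_sub, trace_sub, Matrix.mul_zero, trace_zero, ← neg_eq_zero, ← h2,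
        ← Matrix.mul_assoc Y Z]
      ring
    · rintro hZ _ ⟨X, rfl⟩
      rw [traceForm_apply, sumComm_apply, Finset.sum_mul, trace_sum]
      refine Finset.sum_eq_zero fun j _ => ?_
      rw [Matrix.smul_mul, trace_smul, Matrix.sub_mul, trace_sub, Matrix.mul_assoc,
        Matrix.mul_assoc, trace_mul_comm (r j), Matrix.mul_assoc, hZ j, sub_self, smul_zero]
  have h2 := LinearMap.BilinForm.finrank_orthogonal traceForm_nondegenerate
    (LinearMap.range (sumComm c r))
  have h3 := Submodule.finrank_le (LinearMap.range (sumComm c r))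
  rw [h1] at h2
  rw [Module.finrank_matrix, Module.finrank_self, mul_one, ← pow_two] at h2 h3
  omega

/-- The solutions of the linearization of the equations `ReflRel c r`. -/
def tangent {ι : Type*} [Fintype ι] (c : Fin 4 → ℂ) (r : Fin 4 → Matrix ι ι ℂ) :
    Submodule ℂ (Fin 4 → Matrix ι ι ℂ) where
  carrier := {ρ | (∀ j, ρ j ∈ anticomm (r j)) ∧ ∑ j, c j • ρ j = 0}
  add_mem' {ρ ρ'} h h' := by
    refine ⟨fun j => Submodule.add_mem _ (h.1 j) (h'.1 j), ?_⟩
    simp only [Pi.add_apply, smul_add, Finset.sum_add_distrib]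
    rw [h.2, h'.2, add_zero]
  zero_mem' := ⟨fun j => Submodule.zero_mem _, by simp⟩
  smul_mem' a ρ h := by
    refine ⟨fun j => Submodule.smul_mem _ _ (h.1 j), ?_⟩
    simp only [Pi.smul_apply, smul_comm _ a]
    rw [← Finset.smul_sum, h.2, smul_zero]

/-- A matrix anticommuting with an involution is a commutator. -/
theorem commutator_of_mem_anticomm {M X : Matrix ι ι ℂ} (h : M * M = 1) (hX : X ∈ anticomm M) :
    ((2⁻¹ : ℂ) • (X * M)) * M - M * ((2⁻¹ : ℂ) • (X * M)) = X := by
  have h1 : M * X = -(X * M) := eq_neg_of_add_eq_zero_left hX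
  rw [Matrix.smul_mul, Matrix.mul_smul, ← Matrix.mul_assoc M, h1, Matrix.neg_mul, Matrix.mul_assoc,
    h, Matrix.mul_one, ← smul_sub, sub_neg_eq_add, ← two_smul ℂ, smul_smul,
    inv_mul_cancel₀ two_ne_zero, one_smul]

theorem commutator_mem_anticomm {M : Matrix ι ι ℂ} (h : M * M = 1) (X : Matrix ι ι ℂ) :
    X * M - M * X ∈ anticomm M := by
  have e : M * (X * M - M * X) + (X * M - M * X) * M = X * (M * M) - (M * M) * X := by
    noncomm_ring
  rw [mem_anticomm, e, h, Matrix.mul_one, Matrix.one_mul, sub_self]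

theorem finrank_tangent {k : ℕ} (hc : ∀ j, c j ≠ 0) (h : ReflRel c r)
    (hcard : Fintype.card ι = 2 * k + 1) (htr : ∀ j, (r j).trace = -1) :
    Module.finrank ℂ (tangent c r) + (2 * k + 1) ^ 2 =
      8 * (k * (k + 1)) + Module.finrank ℂ (cent r) := by
  let Φ : (∀ j, anticomm (r j)) →ₗ[ℂ] Matrix ι ι ℂ :=
    ∑ j, c j • ((anticomm (r j)).subtype ∘ₗ LinearMap.proj j)
  have hΦ : ∀ ρ, Φ ρ = ∑ j, c j • (ρ j : Matrix ι ι ℂ) := fun ρ => by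
    simp [Φ, LinearMap.sum_apply]
  have h1 : LinearMap.range Φ = LinearMap.range (sumComm c r) := by
    ext Y
    constructor
    · rintro ⟨ρ, rfl⟩
      refine ⟨fun j => (2⁻¹ : ℂ) • ((ρ j : Matrix ι ι ℂ) * r j), ?_⟩
      rw [hΦ, sumComm_apply]
      refine Finset.sum_congr rfl fun j _ => ?_
      rw [commutator_of_mem_anticomm (h.sq j) (ρ j).2]
    · rintro ⟨X, rfl⟩
      exact ⟨fun j => ⟨_, commutator_mem_anticomm (h.sq j) (X j)⟩, hΦ _⟩
  have h2 : Module.finrank ℂ (LinearMap.ker Φ) = Module.finrank ℂ (tangent c r) := by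
    refine LinearEquiv.finrank_eq
      { toFun := fun ρ => ⟨fun j => (ρ.1 j).1, fun j => (ρ.1 j).2, (hΦ ρ.1).symm.trans ρ.2⟩
        invFun := fun ρ => ⟨fun j => ⟨ρ.1 j, ρ.2.1 j⟩, (hΦ _).trans ρ.2.2⟩
        map_add' := fun _ _ => rfl
        map_smul' := fun _ _ => rfl
        left_inv := fun _ => rfl
        right_inv := fun _ => rfl }
  have h3 := LinearMap.finrank_range_add_finrank_ker Φ
  have h4 : ∀ j, Module.finrank ℂ (anticomm (r j)) = 2 * ((k + 1) * k) := fun j =>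
    finrank_anticomm (h.sq j) (by omega) (by rw [htr]; push_cast; ring)
  rw [Module.finrank_pi_fintype, Finset.sum_congr rfl fun j _ => h4 j, h1, h2] at h3
  have h5 := finrank_range_sumComm hc r
  rw [hcard] at h5
  simp only [Finset.sum_const, Finset.card_univ, Fintype.card_fin, smul_eq_mul] at h3
  linarith

end TangentSpace
end DSP

/-! ### Curves of solutions -/

namespace DSP

open Matrix Filter Topology

section Curves

/-- A vector in the kernel of a surjective derivative is the velocity of a curve in the fibre. -/
theorem exists_curve_of_range_eq_top {E F : Type*} [NormedAddCommGroup E] [NormedSpace ℂ E]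
    [CompleteSpace E] [NormedAddCommGroup F] [NormedSpace ℂ F] [FiniteDimensional ℂ F] {f : E → F}
    {f' : E →L[ℂ] F} {a v : E} (hf : HasStrictFDerivAt f f' a) (hf' : f'.range = ⊤)
    (hv : f' v = 0) :
    ∃ γ : ℂ → E, γ 0 = a ∧ HasDerivAt γ v 0 ∧ ∀ᶠ t in 𝓝 0, f (γ t) = f a := by
  let w : f'.ker := ⟨v, hv⟩
  have h1 : HasDerivAt (fun t : ℂ => t • w) w 0 := by
    simpa using (hasDerivAt_id (0 : ℂ)).smul_const w
  refine ⟨fun t => hf.implicitFunction f f' hf' (f a) (t • w), ?_, ?_, ?_⟩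
  · simp
  · have h2 := (hf.to_implicitFunction hf').hasFDerivAt
    rw [← zero_smul ℂ w] at h2
    exact h2.comp_hasDerivAt 0 h1
  · have h3 : Tendsto (fun t : ℂ => (f a, t • w)) (𝓝 0) (𝓝 (f a, 0)) := by
      refine tendsto_const_nhds.prodMk_nhds ?_
      have := h1.continuousAt.tendsto
      rwa [zero_smul] at this
    exact h3.eventually (hf.map_implicitFunction_eq hf')

theorem hasStrictFDerivAt_conj {R : Type*} [NormedRing R] [NormedAlgebra ℂ R] [CompleteSpace R]
    (m : R) : HasStrictFDerivAt (fun x : R => (1 + x) * m * Ring.inverse (1 + x))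
      ((ContinuousLinearMap.mul ℂ R).flip m - ContinuousLinearMap.mul ℂ R m) 0 := by
  have h1 : HasStrictFDerivAt (fun x : R => 1 + x) (ContinuousLinearMap.id ℂ R) 0 :=
    (hasStrictFDerivAt_id (𝕜 := ℂ) (0 : R)).const_add 1
  have h2 : HasStrictFDerivAt (fun x : R => Ring.inverse (1 + x)) _ 0 :=
    HasStrictFDerivAt.comp (0 : R) (g := Ring.inverse) (f := fun x : R => 1 + x)
      (by simpa using hasStrictFDerivAt_ringInverse (𝕜 := ℂ) (1 : Rˣ)) h1
  have h3 := (h1.mul_const' m).mul' h2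
  refine h3.congr_fderiv ?_
  ext x
  simp
  abel

theorem eventually_isUnit_one_add {R : Type*} [NormedRing R] [CompleteSpace R] {γ : ℂ → R}
    (h : ContinuousAt γ 0) (h0 : γ 0 = 0) : ∀ᶠ t in 𝓝 0, IsUnit (1 + γ t) := by
  have h1 : ContinuousAt (fun t => 1 + γ t) 0 := continuousAt_const.add h
  refine h1.eventually (Units.isOpen.mem_nhds ?_)
  simp [h0]

section Matrix

attribute [local instance] Matrix.linftyOpNormedRing Matrix.linftyOpNormedAlgebra

variable {ι : Type*} [Fintype ι] [DecidableEq ι] {c : Fin 4 → ℂ} {r : Fin 4 → Matrix ι ι ℂ}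

theorem range_sumComm_eq_ker_trace [Nonempty ι] (hc : ∀ j, c j ≠ 0) (hb : Brick r) :
    LinearMap.range (sumComm c r) = LinearMap.ker (traceLinearMap ι ℂ ℂ) := by
  refine Submodule.eq_of_le_of_finrank_le ?_ ?_
  · rintro _ ⟨X, rfl⟩
    rw [LinearMap.mem_ker, traceLinearMap_apply, sumComm_apply, trace_sum]
    refine Finset.sum_eq_zero fun j _ => ?_
    rw [trace_smul, trace_sub, trace_mul_comm, sub_self, smul_zero]
  · have h1 := finrank_range_sumComm hc r
    have h2 := LinearMap.finrank_range_add_finrank_ker (traceLinearMap ι ℂ ℂ)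
    have h3 : LinearMap.range (traceLinearMap ι ℂ ℂ) = ⊤ := by
      rw [LinearMap.range_eq_top]
      intro a
      refine ⟨(a / Fintype.card ι) • 1, ?_⟩
      rw [traceLinearMap_apply, trace_smul, trace_one, smul_eq_mul, div_mul_cancel₀]
      exact Nat.cast_ne_zero.2 Fintype.card_ne_zero
    have h4 : cent r = Submodule.span ℂ {1} := by
      ext Z
      rw [Submodule.mem_span_singleton]
      constructor
      · intro hZ
        obtain ⟨a, ha⟩ := hb Z hZ
        exact ⟨a, ha.symm⟩
      · rintro ⟨a, rfl⟩ j
        simp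
    rw [h3, finrank_top, Module.finrank_self, Module.finrank_matrix, Module.finrank_self, mul_one,
      ← pow_two] at h2
    rw [h4, finrank_span_singleton one_ne_zero] at h1
    omega

/-- `ρ` is the velocity at `r` of a curve of solutions, with constant traces. -/
def HasCurve {ι : Type*} [Fintype ι] [DecidableEq ι] (c : Fin 4 → ℂ)
    (r ρ : Fin 4 → Matrix ι ι ℂ) : Prop :=
  ∃ R : ℂ → Fin 4 → Matrix ι ι ℂ, R 0 = r ∧
    (∀ j a b, HasDerivAt (fun t => R t j a b) (ρ j a b) 0) ∧
    ∀ᶠ t in 𝓝 0, ReflRel c (R t) ∧ ∀ j, (R t j).trace = (r j).trace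

/-- For a family with trivial centralizer, every solution of the linearized equations is the
velocity of a curve of solutions. -/
theorem Brick.hasCurve [Nonempty ι] (hb : Brick r) (hc : ∀ j, c j ≠ 0) (h : ReflRel c r)
    {ρ : Fin 4 → Matrix ι ι ℂ} (hρ : ρ ∈ tangent c r) : HasCurve c r ρ := by
  let V := LinearMap.ker (traceLinearMap ι ℂ ℂ)
  have hn : (Fintype.card ι : ℂ) ≠ 0 := Nat.cast_ne_zero.2 Fintype.card_ne_zero
  let π : Matrix ι ι ℂ →ₗ[ℂ] V := LinearMap.codRestrict V
    (LinearMap.id - (LinearMap.toSpanSingleton ℂ _ ((Fintype.card ι : ℂ)⁻¹ • (1 : Matrix ι ι ℂ))) ∘ₗ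
      traceLinearMap ι ℂ ℂ) (fun X => by
      simp [V, trace_one, hn])
  have hπ : ∀ X : Matrix ι ι ℂ, X.trace = 0 → (π X : Matrix ι ι ℂ) = X := fun X hX => by
    simp [π, hX]
  let g : Fin 4 → Matrix ι ι ℂ → Matrix ι ι ℂ := fun j x => (1 + x) * r j * Ring.inverse (1 + x)
  let f : (Fin 4 → Matrix ι ι ℂ) → V := fun X => π (∑ j, c j • g j (X j))
  let f' : (Fin 4 → Matrix ι ι ℂ) →L[ℂ] V :=
    LinearMap.toContinuousLinearMap (π ∘ₗ sumComm c r)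
  have hf : HasStrictFDerivAt f f' 0 := by
    have h1 : HasStrictFDerivAt (fun X : Fin 4 → Matrix ι ι ℂ => ∑ j, c j • g j (X j)) _ 0 :=
      HasStrictFDerivAt.fun_sum fun j _ => HasStrictFDerivAt.fun_const_smul
        (HasStrictFDerivAt.comp (0 : Fin 4 → Matrix ι ι ℂ) (hasStrictFDerivAt_conj (r j))
          (hasStrictFDerivAt_apply j (0 : Fin 4 → Matrix ι ι ℂ))) (c j)
    have h2 := (LinearMap.toContinuousLinearMap π).hasStrictFDerivAt.comp
      (0 : Fin 4 → Matrix ι ι ℂ) h1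
    refine h2.congr_fderiv ?_
    refine ContinuousLinearMap.ext fun X => congrArg π ?_
    rw [ContinuousLinearMap.coe_coe, _root_.sum_apply]
    rfl
  have hrange : f'.range = ⊤ := by
    rw [eq_top_iff]
    rintro ⟨Y, hY⟩ -
    have h1 : Y ∈ LinearMap.ker (traceLinearMap ι ℂ ℂ) := hY
    rw [← range_sumComm_eq_ker_trace hc hb] at h1
    obtain ⟨X, hX⟩ := h1
    refine ⟨X, Subtype.ext ?_⟩
    change (π (sumComm c r X) : Matrix ι ι ℂ) = Y
    rw [hX, hπ Y hY]
  let X₀ : Fin 4 → Matrix ι ι ℂ := fun j => (2⁻¹ : ℂ) • (ρ j * r j)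
  have hX₀ : ∀ j, X₀ j * r j - r j * X₀ j = ρ j := fun j =>
    commutator_of_mem_anticomm (h.sq j) (hρ.1 j)
  have hker : f' X₀ = 0 := by
    change π (sumComm c r X₀) = 0
    rw [sumComm_apply]
    simp only [hX₀]
    rw [hρ.2, map_zero]
  obtain ⟨γ, hγ0, hγ, hγf⟩ := exists_curve_of_range_eq_top hf hrange hker
  have hγj : ∀ j, HasDerivAt (fun t => γ t j) (X₀ j) 0 := hasDerivAt_pi.1 hγ
  have hunit : ∀ᶠ t in 𝓝 0, ∀ j, IsUnit (1 + γ t j) := eventually_all.2 fun j =>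
    eventually_isUnit_one_add (hγj j).continuousAt (by rw [hγ0]; rfl)
  refine ⟨fun t j => g j (γ t j), ?_, fun j a b => ?_, ?_⟩
  · funext j
    simp [g, hγ0]
  · have h1 : HasDerivAt (fun t => g j (γ t j)) (ρ j) 0 := by
      have h2 := hasStrictFDerivAt_conj (r j)
      have h3 : γ 0 j = 0 := by rw [hγ0]; rfl
      rw [← h3] at h2
      have h4 := h2.hasFDerivAt.comp_hasDerivAt (0 : ℂ) (hγj j)
      rw [← hX₀ j]
      exact h4
    exact (LinearMap.toContinuousLinearMap (entryLinearMap ℂ ℂ a b)).hasFDerivAt.comp_hasDerivAt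
      (0 : ℂ) h1
  · filter_upwards [hunit, hγf] with t ht hft
    have hinv : ∀ j, Ring.inverse (1 + γ t j) * (1 + γ t j) = 1 := fun j =>
      Ring.inverse_mul_cancel _ (ht j)
    have htrj : ∀ j, (g j (γ t j)).trace = (r j).trace := fun j => by
      change ((1 + γ t j) * r j * Ring.inverse (1 + γ t j)).trace = _
      rw [trace_mul_comm, ← mul_assoc, hinv, one_mul]
    refine ⟨⟨fun j => ?_, ?_⟩, htrj⟩
    · calc g j (γ t j) * g j (γ t j) = (1 + γ t j) * r j *
          (Ring.inverse (1 + γ t j) * (1 + γ t j)) * r j * Ring.inverse (1 + γ t j) := by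
            simp only [g, mul_assoc]
        _ = 1 := by
          rw [hinv, mul_one, mul_assoc (1 + γ t j), h.sq, mul_one, Ring.mul_inverse_cancel _ (ht j)]
    · have htr : (∑ j, c j • g j (γ t j)).trace = 0 := by
        have h2 := congrArg trace h.sum
        rw [trace_sum, trace_zero] at h2
        rw [trace_sum, ← h2]
        simp only [trace_smul, htrj]
      rw [← hπ _ htr]
      have h3 : f (γ t) = 0 := by
        rw [hft]
        change π (∑ j, c j • g j 0) = 0
        simp [g, h.sum]
      exact congrArg Subtype.val h3

theorem hasDerivAt_of_entries {M : ℂ → Matrix ι ι ℂ} {M' : Matrix ι ι ℂ}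
    (h : ∀ a b, HasDerivAt (fun t => M t a b) (M' a b) 0) : HasDerivAt M M' 0 := by
  have h1 : HasDerivAt (fun t => ∑ a, ∑ b, M t a b • Matrix.single a b (1 : ℂ))
      (∑ a, ∑ b, M' a b • Matrix.single a b (1 : ℂ)) 0 :=
    HasDerivAt.fun_sum fun a _ => HasDerivAt.fun_sum fun b _ => (h a b).smul_const _
  have h2 : ∀ X : Matrix ι ι ℂ, ∑ a, ∑ b, X a b • Matrix.single a b (1 : ℂ) = X := fun X => by
    conv_rhs => rw [matrix_eq_sum_single X]
    simp
  simpa only [h2] using h1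

theorem hasDerivAt_linear_of_entries {M : ℂ → Matrix ι ι ℂ} {M' : Matrix ι ι ℂ}
    (h : ∀ a b, HasDerivAt (fun t => M t a b) (M' a b) 0) (L : Matrix ι ι ℂ →ₗ[ℂ] ℂ) :
    HasDerivAt (fun t => L (M t)) (L M') 0 :=
  (LinearMap.toContinuousLinearMap L).hasFDerivAt.comp_hasDerivAt (0 : ℂ) (hasDerivAt_of_entries h)

/-- Conjugating a curve by `1 + t • Y` adds the commutators with `Y` to the velocity. -/
theorem HasCurve.add_commutator {ρ : Fin 4 → Matrix ι ι ℂ} (h : HasCurve c r ρ)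
    (Y : Matrix ι ι ℂ) : HasCurve c r fun j => ρ j + (Y * r j - r j * Y) := by
  obtain ⟨R, hR0, hR, hR'⟩ := h
  have h1 : HasDerivAt (fun t : ℂ => t • Y) Y 0 := by
    have := (hasDerivAt_id (0 : ℂ)).smul_const Y
    rw [one_smul] at this
    exact this
  have h2 : HasDerivAt (fun t : ℂ => 1 + t • Y) Y 0 := h1.const_add 1
  have h3 : HasDerivAt (fun t : ℂ => Ring.inverse (1 + t • Y)) (-Y) 0 := by
    have h4 := hasFDerivAt_ringInverse (𝕜 := ℂ) (1 : (Matrix ι ι ℂ)ˣ)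
    have h5 : (((1 : (Matrix ι ι ℂ)ˣ)) : Matrix ι ι ℂ) = 1 + (0 : ℂ) • Y := by simp
    rw [h5] at h4
    have h6 := h4.comp_hasDerivAt (0 : ℂ) h2
    have h7 : -(Y : Matrix ι ι ℂ) = (-ContinuousLinearMap.mulLeftRight ℂ (Matrix ι ι ℂ)
      (((1 : (Matrix ι ι ℂ)ˣ)⁻¹ : (Matrix ι ι ℂ)ˣ) : Matrix ι ι ℂ)
      (((1 : (Matrix ι ι ℂ)ˣ)⁻¹ : (Matrix ι ι ℂ)ˣ) : Matrix ι ι ℂ)) Y := by simp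
    rw [h7]
    exact h6
  refine ⟨fun t j => (1 + t • Y) * R t j * Ring.inverse (1 + t • Y), ?_, fun j a b => ?_, ?_⟩
  · funext j
    simp [hR0]
  · have h4 := (h2.mul (hasDerivAt_of_entries (hR j))).mul h3
    have h5 : HasDerivAt (fun t => (1 + t • Y) * R t j * Ring.inverse (1 + t • Y))
        (ρ j + (Y * r j - r j * Y)) 0 := by
      have h6 : ρ j + (Y * r j - r j * Y) = (Y * R 0 j + (1 + (0 : ℂ) • Y) * ρ j) *
          Ring.inverse (1 + (0 : ℂ) • Y) + (1 + (0 : ℂ) • Y) * R 0 j * -Y := by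
        simp [hR0]
        abel
      rw [h6]
      exact h4
    exact (LinearMap.toContinuousLinearMap (entryLinearMap ℂ ℂ a b)).hasFDerivAt.comp_hasDerivAt
      (0 : ℂ) h5
  · filter_upwards [hR', eventually_isUnit_one_add h1.continuousAt (by simp)] with t ht hu
    have hsim : Similar (fun j => (1 + t • Y) * R t j * Ring.inverse (1 + t • Y)) (R t) :=
      ⟨1 + t • Y, Ring.inverse (1 + t • Y), Ring.mul_inverse_cancel _ hu,
        Ring.inverse_mul_cancel _ hu, fun j => by
          rw [mul_assoc, Ring.inverse_mul_cancel _ hu, mul_one]⟩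
    exact ⟨hsim.reflRel ht.1, fun j => (hsim.trace_eq j).trans (ht.2 j)⟩

end Matrix

section Transport

variable {ι κ : Type*} [Fintype ι] [DecidableEq ι] [Fintype κ] [DecidableEq κ] {c : Fin 4 → ℂ}

theorem HasCurve.conj {r' ρ' : Fin 4 → Matrix κ κ ℂ} (h : HasCurve c r' ρ') {P : Matrix ι κ ℂ}
    {Q : Matrix κ ι ℂ} (h1 : P * Q = 1) (h2 : Q * P = 1) :
    HasCurve c (fun j => P * r' j * Q) (fun j => P * ρ' j * Q) := by
  obtain ⟨R, hR0, hR, hR'⟩ := h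
  have hsim : ∀ r'' : Fin 4 → Matrix κ κ ℂ, Similar (fun j => P * r'' j * Q) r'' := fun r'' =>
    ⟨P, Q, h1, h2, fun j => by rw [Matrix.mul_assoc, h2, Matrix.mul_one]⟩
  refine ⟨fun t j => P * R t j * Q, by simp only [hR0], fun j a b => ?_, ?_⟩
  · exact hasDerivAt_linear_of_entries (hR j)
      (entryLinearMap ℂ ℂ a b ∘ₗ (conjAlg P Q h1 h2).toLinearMap)
  · filter_upwards [hR'] with t ht
    exact ⟨(hsim (R t)).reflRel ht.1, fun j => by
      rw [(hsim (R t)).trace_eq, ht.2, ← (hsim r').trace_eq]⟩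

/-- The property that all solutions of the linearized equations are velocities of curves is
invariant under equivalence. -/
theorem Similar.forall_hasCurve {r : Fin 4 → Matrix ι ι ℂ} {r' : Fin 4 → Matrix κ κ ℂ}
    (h : Similar r r') (h' : ∀ ρ' ∈ tangent c r', HasCurve c r' ρ') :
    ∀ ρ ∈ tangent c r, HasCurve c r ρ := by
  intro ρ hρ
  obtain ⟨P, Q, h1, h2, h3⟩ := h
  have e : ∀ X : Matrix ι ι ℂ, P * (Q * X * P) * Q = X := fun X => by
    calc P * (Q * X * P) * Q = (P * Q) * X * (P * Q) := by simp only [Matrix.mul_assoc]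
      _ = X := by rw [h1, Matrix.one_mul, Matrix.mul_one]
  have e' : ∀ j, r' j = Q * r j * P := fun j => by
    rw [Matrix.mul_assoc, h3, ← Matrix.mul_assoc, h2, Matrix.one_mul]
  have hmul : ∀ X Y : Matrix ι ι ℂ, (Q * X * P) * (Q * Y * P) = Q * (X * Y) * P := by
    intro X Y
    calc (Q * X * P) * (Q * Y * P) = Q * X * (P * Q) * Y * P := by simp only [Matrix.mul_assoc]
      _ = _ := by rw [h1, Matrix.mul_one]; simp only [Matrix.mul_assoc]
  have h4 : (fun j => Q * ρ j * P) ∈ tangent c r' := by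
    refine ⟨fun j => ?_, ?_⟩
    · rw [mem_anticomm, e', hmul, hmul, ← Matrix.add_mul, ← Matrix.mul_add,
        mem_anticomm.1 (hρ.1 j), Matrix.mul_zero, Matrix.zero_mul]
    · have : ∑ j, c j • (Q * ρ j * P) = Q * (∑ j, c j • ρ j) * P := by
        simp only [Matrix.mul_sum, Matrix.sum_mul, Matrix.mul_smul, Matrix.smul_mul]
      rw [this, hρ.2, Matrix.mul_zero, Matrix.zero_mul]
  have h5 := (h' _ h4).conj h1 h2
  simpa only [e, e'] using h5

end Transport

end Curves
end DSP

/-! ### Tangent vectors at a direct sum -/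

namespace DSP

open Matrix Filter Topology

section Decomposition

/-- The linearization of the fact that `centralElt p q r` commutes with the `r j`, obtained by
applying this fact over the dual numbers. -/
theorem exists_commutator_centralElt {ι : Type*} [Fintype ι] [DecidableEq ι] {c : Fin 4 → ℂ}
    {r ρ : Fin 4 → Matrix ι ι ℂ} (hc : ∀ j, c j ≠ 0) (h : ReflRel c r) (hρ : ρ ∈ tangent c r)
    (p : Fin 4 → Fin 4 → ℂ) (q : Fin 4 → Fin 4 → Fin 4 → ℂ) :
    ∃ w : Matrix ι ι ℂ, ∀ j, centralElt p q r * ρ j + w * r j = r j * w + ρ j * centralElt p q r := by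
  let r' : Fin 4 → DualNumber (Matrix ι ι ℂ) := fun j =>
    TrivSqZeroExt.inl (r j) + TrivSqZeroExt.inr (ρ j)
  have h1 : ReflRel c r' := by
    refine ⟨fun j => ?_, ?_⟩
    · refine TrivSqZeroExt.ext ?_ ?_
      · simp [r', h.sq]
      · simpa [r'] using mem_anticomm.1 (hρ.1 j)
    · refine TrivSqZeroExt.ext ?_ ?_
      · rw [TrivSqZeroExt.fst_sum]
        simpa [r'] using h.sum
      · rw [TrivSqZeroExt.snd_sum]
        simpa [r'] using hρ.2
  have h2 : (centralElt p q r').fst = centralElt p q r := by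
    have := map_centralElt (TrivSqZeroExt.fstHom ℂ (Matrix ι ι ℂ) (Matrix ι ι ℂ)) p q r'
    rw [TrivSqZeroExt.fstHom_apply] at this
    rw [this]
    simp [r']
  refine ⟨(centralElt p q r').snd, fun j => ?_⟩
  have h3 := congrArg TrivSqZeroExt.snd (h1.commute_centralElt hc p q j).eq
  rw [TrivSqZeroExt.snd_mul, TrivSqZeroExt.snd_mul, h2] at h3
  simpa [r'] using h3

variable {τ : Type*} [Fintype τ] [DecidableEq τ] {F : τ → Type*} [∀ t, Fintype (F t)]
  [∀ t, DecidableEq (F t)] {c : Fin 4 → ℂ}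

theorem mul_dsum_apply {τ : Type*} [Fintype τ] [DecidableEq τ] {F : τ → Type*} [∀ t, Fintype (F t)]
    (M : Matrix (Σ t, F t) (Σ t, F t) ℂ) (B : ∀ t, Fin 4 → Matrix (F t) (F t) ℂ)
    (j : Fin 4) (x : Σ t, F t) (t : τ) (y : F t) :
    (M * dsum B j) x ⟨t, y⟩ = ∑ u, M x ⟨t, u⟩ * B t j u y := by
  rw [Matrix.mul_apply, Fintype.sum_sigma, Finset.sum_eq_single t]
  · simp only [dsum, blockDiagonal'_apply_eq]
  · intro t' _ ht'
    simp [dsum, blockDiagonal'_apply_ne _ _ _ ht']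
  · simp

theorem dsum_mul_apply {τ : Type*} [Fintype τ] [DecidableEq τ] {F : τ → Type*} [∀ t, Fintype (F t)]
    (M : Matrix (Σ t, F t) (Σ t, F t) ℂ) (B : ∀ t, Fin 4 → Matrix (F t) (F t) ℂ)
    (j : Fin 4) (t : τ) (x : F t) (y : Σ t, F t) :
    (dsum B j * M) ⟨t, x⟩ y = ∑ u, B t j x u * M ⟨t, u⟩ y := by
  rw [Matrix.mul_apply, Fintype.sum_sigma, Finset.sum_eq_single t]
  · simp only [dsum, blockDiagonal'_apply_eq]
  · intro t' _ ht'
    simp [dsum, blockDiagonal'_apply_ne _ _ _ ht'.symm]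
  · simp

theorem commutator_mem_tangent {ι : Type*} [Fintype ι] [DecidableEq ι] {r : Fin 4 → Matrix ι ι ℂ}
    (h : ReflRel c r) (Y : Matrix ι ι ℂ) : (fun j => Y * r j - r j * Y) ∈ tangent c r := by
  refine ⟨fun j => commutator_mem_anticomm (h.sq j) Y, ?_⟩
  have : ∑ j, c j • (Y * r j - r j * Y) = Y * ∑ j, c j • r j - (∑ j, c j • r j) * Y := by
    simp only [Matrix.mul_sum, Matrix.sum_mul, Matrix.mul_smul, Matrix.smul_mul, smul_sub,
      Finset.sum_sub_distrib]
  rw [this, h.sum, Matrix.mul_zero, Matrix.zero_mul, sub_zero]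

/-- A solution of the linearized equations at a direct sum whose summands are told apart by a
central element is block-diagonal up to commutators. -/
theorem exists_eq_dsum_add_commutator {B : ∀ t, Fin 4 → Matrix (F t) (F t) ℂ} (hc : ∀ j, c j ≠ 0)
    (hB : ∀ t, ReflRel c (B t)) {p : Fin 4 → Fin 4 → ℂ} {q : Fin 4 → Fin 4 → Fin 4 → ℂ}
    {ζ : τ → ℂ} (hζ : Function.Injective ζ)
    (hz : centralElt p q (dsum B) = diagonal fun x => ζ x.1)
    {ρ : Fin 4 → Matrix (Σ t, F t) (Σ t, F t) ℂ} (hρ : ρ ∈ tangent c (dsum B)) :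
    ∃ (Y : Matrix (Σ t, F t) (Σ t, F t) ℂ) (ρ' : ∀ t, Fin 4 → Matrix (F t) (F t) ℂ),
      (∀ t, ρ' t ∈ tangent c (B t)) ∧
        ρ = fun j => dsum ρ' j + (Y * dsum B j - dsum B j * Y) := by
  have hR : ReflRel c (dsum B) := reflRel_dsum_iff.2 hB
  obtain ⟨w, hw⟩ := exists_commutator_centralElt hc hR hρ p q
  let Y : Matrix (Σ t, F t) (Σ t, F t) ℂ := of fun x y => (ζ y.1 - ζ x.1)⁻¹ * w x y
  have hent : ∀ j t x t' y, t ≠ t' → ρ j ⟨t, x⟩ ⟨t', y⟩ =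
      (Y * dsum B j - dsum B j * Y) ⟨t, x⟩ ⟨t', y⟩ := by
    intro j t x t' y ht
    have h1 := congrFun (congrFun (hw j) ⟨t, x⟩) ⟨t', y⟩
    rw [hz, Matrix.add_apply, Matrix.add_apply, diagonal_mul, mul_diagonal, mul_dsum_apply,
      dsum_mul_apply] at h1
    rw [Matrix.sub_apply, mul_dsum_apply, dsum_mul_apply]
    simp only [Y, of_apply]
    have h2 : ζ t' - ζ t ≠ 0 := sub_ne_zero.2 (hζ.ne ht.symm)
    have h3 : ∀ u, B t j x u * ((ζ t' - ζ t)⁻¹ * w ⟨t, u⟩ ⟨t', y⟩) =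
      (ζ t' - ζ t)⁻¹ * (B t j x u * w ⟨t, u⟩ ⟨t', y⟩) := fun u => by ring
    simp only [h3, mul_assoc, ← Finset.mul_sum]
    rw [← mul_sub, eq_inv_mul_iff_mul_eq₀ h2]
    linear_combination -h1
  let ρ' : ∀ t, Fin 4 → Matrix (F t) (F t) ℂ := fun t j =>
    of fun x y => (ρ j - (Y * dsum B j - dsum B j * Y)) ⟨t, x⟩ ⟨t, y⟩
  have hρ' : ∀ j, dsum ρ' j = ρ j - (Y * dsum B j - dsum B j * Y) := by
    intro j
    ext ⟨t, x⟩ ⟨t', y⟩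
    by_cases ht : t = t'
    · subst ht
      rw [dsum, blockDiagonal'_apply_eq]
      rfl
    · rw [dsum, blockDiagonal'_apply_ne _ _ _ ht, Matrix.sub_apply, hent j t x t' y ht, sub_self]
  have h4 : dsum ρ' ∈ tangent c (dsum B) := by
    rw [funext hρ']
    exact Submodule.sub_mem _ hρ (commutator_mem_tangent hR Y)
  refine ⟨Y, ρ', fun t => ⟨fun j => ?_, ?_⟩, funext fun j => by rw [hρ', sub_add_cancel]⟩
  · have h5 := h4.1 j
    rw [mem_anticomm, dsum, dsum, ← blockDiagonal'_mul, ← blockDiagonal'_mul, ← blockDiagonal'_add,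
      ← blockDiagonal'_zero, blockDiagonal'_inj] at h5
    exact congrFun h5 t
  · have h5 := h4.2
    have e : ∑ j, c j • dsum ρ' j = blockDiagonal' (∑ j, c j • fun t => ρ' t j) := by
      rw [← blockDiagonalHom_apply, map_sum]
      simp only [map_smul]
      rfl
    rw [e, ← blockDiagonal'_zero, blockDiagonal'_inj] at h5
    simpa using congrFun h5 t

theorem HasCurve.dsum {B ρ : ∀ t, Fin 4 → Matrix (F t) (F t) ℂ} (h : ∀ t, HasCurve c (B t) (ρ t)) :
    HasCurve c (dsum B) (dsum ρ) := by
  choose R hR0 hR hR' using h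
  refine ⟨fun z => DSP.dsum fun t => R t z, ?_, ?_, ?_⟩
  · simp only [hR0]
  · rintro j ⟨t, x⟩ ⟨t', y⟩
    by_cases ht : t = t'
    · subst ht
      simp only [DSP.dsum, blockDiagonal'_apply_eq]
      exact hR t j x y
    · simp only [DSP.dsum, blockDiagonal'_apply_ne _ _ _ ht]
      exact hasDerivAt_const _ _
  · filter_upwards [eventually_all.2 hR'] with z hz
    refine ⟨reflRel_dsum_iff.2 fun t => (hz t).1, fun j => ?_⟩
    rw [trace_dsum, trace_dsum]
    exact Finset.sum_congr rfl fun t _ => (hz t).2 j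

/-- At the points of a stratum, all solutions of the linearized equations are velocities of
curves of solutions. -/
theorem IsHB.hasCurve {ι : Type*} [Fintype ι] [DecidableEq ι] {m s : ℕ} [Nonempty (Fin m)] {ε : ℂ}
    (hc : NoSubsum c) {h : Fin 4 → Matrix (Fin m) (Fin m) ℂ} (hh : IsUnipotent c ε h)
    {r : Fin 4 → Matrix ι ι ℂ} (hr : IsHB c s h r) : ∀ ρ ∈ tangent c r, HasCurve c r ρ := by
  obtain ⟨b, hb, hbb, hsim⟩ := hr
  obtain ⟨p, q, ζ, hζ, hz⟩ := exists_centralElt_blocks hc hb hbb hh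
  have hne' : ∀ t : Option (Fin s), Nonempty (Fin (blockSize m t)) := nonempty_blocks
  have hR := reflRel_blocks (fun i => (hb i).1) hh.reflRel
  refine hsim.forall_hasCurve fun ρ hρ => ?_
  obtain ⟨Y, ρ', hρ', rfl⟩ := exists_eq_dsum_add_commutator hc.ne_zero hR hζ hz hρ
  exact HasCurve.add_commutator (HasCurve.dsum fun t =>
    (brick_blocks (fun i => (hb i).2) hh.brick t).hasCurve hc.ne_zero (hR t) (hρ' t)) Y

end Decomposition
end DSP

/-! ### Local smoothness of the strata -/

namespace DSP

open Matrix MvPolynomial Filter Topology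

section LocalSmoothness

variable {lam mu : Fin 4 → ℂ} {n : ℕ}

/-- The equations of the variety, as polynomials in the matrix entries: the squares of the
involutions, their weighted sum, and their traces. -/
noncomputable def equation (lam mu : Fin 4 → ℂ) (n : ℕ) :
    (Fin 4 × Fin n × Fin n) ⊕ (Fin n × Fin n) ⊕ Fin 4 → MvPolynomial (Fin 4 × Fin n × Fin n) ℂ
  | Sum.inl x => (toRefl lam mu (genericQuad n) x.1 * toRefl lam mu (genericQuad n) x.1 - 1)
      x.2.1 x.2.2
  | Sum.inr (Sum.inl x) => (∑ j, (mu j - lam j) • toRefl lam mu (genericQuad n) j) x.1 x.2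
  | Sum.inr (Sum.inr j) => (toRefl lam mu (genericQuad n) j).trace + 1

theorem evalQuad_toRefl (A : Quad n) (j : Fin 4) :
    evalQuad A (toRefl lam mu (genericQuad n) j) = toRefl lam mu A j := by
  rw [map_toRefl]
  simp only [evalQuad_genericQuad]

theorem eval_equation_inl (A : Quad n) (j : Fin 4) (a b : Fin n) :
    eval (coords A) (equation lam mu n (Sum.inl (j, a, b))) =
      (toRefl lam mu A j * toRefl lam mu A j - 1) a b := by
  rw [← evalQuad_toRefl, ← map_mul, ← map_one (evalQuad A), ← map_sub]
  rfl

theorem eval_equation_inr_inl (A : Quad n) (a b : Fin n) :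
    eval (coords A) (equation lam mu n (Sum.inr (Sum.inl (a, b)))) =
      (∑ j, (mu j - lam j) • toRefl lam mu A j) a b := by
  simp only [← evalQuad_toRefl, ← map_smul, ← map_sum]
  rfl

theorem eval_equation_inr_inr (A : Quad n) (j : Fin 4) :
    eval (coords A) (equation lam mu n (Sum.inr (Sum.inr j))) =
      (toRefl lam mu A j).trace + 1 := by
  rw [← evalQuad_toRefl]
  change eval (coords A) (_ + 1) = _
  rw [map_add, map_one]
  congr 1
  exact AddMonoidHom.map_trace (eval (coords A)).toAddMonoidHom _

theorem eval_equation_eq_zero_iff {A : Quad n} :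
    (∀ x, eval (coords A) (equation lam mu n x) = 0) ↔
      ReflRel (fun j => mu j - lam j) (toRefl lam mu A) ∧
        ∀ j, (toRefl lam mu A j).trace = -1 := by
  constructor
  · intro h
    refine ⟨⟨fun j => ?_, ?_⟩, fun j => ?_⟩
    · rw [← sub_eq_zero]
      ext a b
      rw [← eval_equation_inl, h]
      rfl
    · ext a b
      rw [← eval_equation_inr_inl, h]
      rfl
    · rw [eq_neg_iff_add_eq_zero, ← eval_equation_inr_inr, h]
  · rintro ⟨h, htr⟩ (⟨j, a, b⟩ | ⟨a, b⟩ | j)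
    · rw [eval_equation_inl, h.sq, sub_self]
      rfl
    · rw [eval_equation_inr_inl, h.sum]
      rfl
    · rw [eval_equation_inr_inr, htr, neg_add_cancel]

/-- The variation of the involutions that corresponds to a variation of the coordinates. -/
noncomputable def variation (hne : ∀ j, lam j ≠ mu j) (n : ℕ) :
    (Fin 4 × Fin n × Fin n → ℂ) ≃ₗ[ℂ] (Fin 4 → Matrix (Fin n) (Fin n) ℂ) where
  toFun v j := of fun a b => (mu j - lam j)⁻¹ * (2 * v (j, a, b))
  invFun ρ x := 2⁻¹ * ((mu x.1 - lam x.1) * ρ x.1 x.2.1 x.2.2)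
  map_add' v w := by
    funext j
    ext a b
    simp only [Pi.add_apply, of_apply, Matrix.add_apply]
    ring
  map_smul' x v := by
    funext j
    ext a b
    simp only [Pi.smul_apply, of_apply, Matrix.smul_apply, smul_eq_mul, RingHom.id_apply]
    ring
  left_inv v := by
    funext x
    simp only [of_apply]
    rw [mul_inv_cancel_left₀ (sub_ne_zero.2 (hne x.1).symm), inv_mul_cancel_left₀ two_ne_zero]
  right_inv ρ := by
    funext j
    ext a b
    simp only [of_apply]
    rw [mul_inv_cancel_left₀ two_ne_zero, inv_mul_cancel_left₀ (sub_ne_zero.2 (hne j).symm)]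

theorem trace_eq_zero_of_mem_anticomm {ι : Type*} [Fintype ι] [DecidableEq ι] {M X : Matrix ι ι ℂ}
    (h : M * M = 1) (hX : X ∈ anticomm M) : X.trace = 0 := by
  rw [← commutator_of_mem_anticomm h hX, trace_sub, trace_mul_comm, sub_self]

theorem hasDerivAt_quadratic (α β γ : ℂ) :
    HasDerivAt (fun t : ℂ => α + t * β + t * (t * γ)) β 0 := by
  have h1 := (hasDerivAt_id (0 : ℂ)).mul_const β
  have h2 := (hasDerivAt_id (0 : ℂ)).mul ((hasDerivAt_id (0 : ℂ)).mul_const γ)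
  have h3 := (h1.const_add α).add h2
  exact h3.congr_deriv (by simp)

/-- The common zeros of the differentials of the equations are the solutions of the linearized
equations. -/
theorem pdiff_equation_eq_zero_iff (hne : ∀ j, lam j ≠ mu j) {A : Quad n}
    (hA : ReflRel (fun j => mu j - lam j) (toRefl lam mu A)) (v : Fin 4 × Fin n × Fin n → ℂ) :
    (∀ x, pdiff (coords A) (equation lam mu n x) v = 0) ↔
      variation hne n v ∈ tangent (fun j => mu j - lam j) (toRefl lam mu A) := by
  set ρ := variation hne n v with hρ
  let V : Quad n := fun j => of fun a b => v (j, a, b)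
  let φ : ℂ → Fin 4 × Fin n × Fin n → ℂ := fun t => coords (A + t • V)
  have hφ : HasDerivAt φ v 0 := by
    rw [hasDerivAt_pi]
    rintro ⟨j, a, b⟩
    have := ((hasDerivAt_id (0 : ℂ)).mul_const (v (j, a, b))).const_add (A j a b)
    simpa [φ, coords, V] using this
  have hr : ∀ t : ℂ, toRefl lam mu (A + t • V) = fun j => toRefl lam mu A j + t • ρ j := by
    intro t
    funext j
    ext a b
    simp only [toRefl, hρ, variation, V, LinearEquiv.coe_mk, LinearMap.coe_mk, AddHom.coe_mk,
      Matrix.smul_apply, Matrix.sub_apply, Matrix.add_apply, Pi.add_apply, Pi.smul_apply, of_apply,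
      smul_eq_mul]
    ring
  have key : ∀ (x : _) (β : ℂ), HasDerivAt (fun t => eval (φ t) (equation lam mu n x)) β 0 →
      pdiff (coords A) (equation lam mu n x) v = β := by
    intro x β h
    have h1 := hasDerivAt_eval hφ (equation lam mu n x)
    have h2 : φ 0 = coords A := by simp [φ]
    rw [h2] at h1
    exact h1.unique h
  have h1 : ∀ j a b, pdiff (coords A) (equation lam mu n (Sum.inl (j, a, b))) v =
      (toRefl lam mu A j * ρ j + ρ j * toRefl lam mu A j) a b := by
    intro j a b
    refine key _ _ ?_
    simp only [φ, eval_equation_inl, hr]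
    convert hasDerivAt_quadratic ((toRefl lam mu A j * toRefl lam mu A j - 1) a b)
      ((toRefl lam mu A j * ρ j + ρ j * toRefl lam mu A j) a b) ((ρ j * ρ j) a b) using 2 with t
    simp only [Matrix.add_mul, Matrix.mul_add, Matrix.smul_mul, Matrix.mul_smul, Matrix.sub_apply,
      Matrix.add_apply, Matrix.smul_apply, smul_eq_mul]
    ring
  have h2 : ∀ a b, pdiff (coords A) (equation lam mu n (Sum.inr (Sum.inl (a, b)))) v =
      (∑ j, (mu j - lam j) • ρ j) a b := by
    intro a b
    refine key _ _ ?_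
    simp only [φ, eval_equation_inr_inl, hr]
    convert hasDerivAt_quadratic ((∑ j, (mu j - lam j) • toRefl lam mu A j) a b)
      ((∑ j, (mu j - lam j) • ρ j) a b) 0 using 2 with t
    simp only [smul_add, Finset.sum_add_distrib, Matrix.add_apply, mul_zero, add_zero]
    congr 1
    simp only [smul_comm _ t, ← Finset.smul_sum, Matrix.smul_apply, smul_eq_mul]
  have h3 : ∀ j, pdiff (coords A) (equation lam mu n (Sum.inr (Sum.inr j))) v = (ρ j).trace := by
    intro j
    refine key _ _ ?_
    simp only [φ, eval_equation_inr_inr, hr]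
    convert hasDerivAt_quadratic ((toRefl lam mu A j).trace + 1) ((ρ j).trace) 0 using 2 with t
    simp only [trace_add, trace_smul, smul_eq_mul]
    ring
  constructor
  · intro h
    refine ⟨fun j => ?_, ?_⟩
    · ext a b
      rw [← h1, h]
      rfl
    · ext a b
      rw [← h2, h]
      rfl
  · rintro ⟨h, h'⟩ (⟨j, a, b⟩ | ⟨a, b⟩ | j)
    · rw [h1, mem_anticomm.1 (h j)]
      rfl
    · rw [h2, h']
      rfl
    · rw [h3, trace_eq_zero_of_mem_anticomm (hA.sq j) (h j)]

/-- The strata are locally smooth varieties. -/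
theorem isLocallySmoothVariety_of_isHB {k s : ℕ} {ε : ℂ} (hs : s ≤ k) (hne : ∀ j, lam j ≠ mu j)
    (hc : NoSubsum fun j => mu j - lam j)
    {h : Fin 4 → Matrix (Fin (2 * (k - s) + 1)) (Fin (2 * (k - s) + 1)) ℂ}
    (hh : IsUnipotent (fun j => mu j - lam j) ε h) {S : Set (Quad (2 * k + 1))}
    (hS : ∀ A, A ∈ S ↔ IsHB (fun j => mu j - lam j) s h (toRefl lam mu A)) :
    IsLocallySmoothVariety (coords '' S) ((2 * k + 1) ^ 2 + s - 1) := by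
  rintro _ ⟨A, hAS, rfl⟩
  have hA := (hS A).1 hAS
  have hrel : ∀ B ∈ S, ReflRel (fun j => mu j - lam j) (toRefl lam mu B) ∧
      ∀ j, (toRefl lam mu B j).trace = -1 := by
    intro B hB
    obtain ⟨b, hb, -, hsim⟩ := (hS B).1 hB
    refine ⟨hsim.reflRel (reflRel_dsum_iff.2 (reflRel_blocks (fun i => (hb i).1) hh.reflRel)),
      fun j => ?_⟩
    rw [hsim.trace_eq, trace_dsum, Fintype.sum_option, Finset.sum_eq_zero fun i _ =>
      show (blocks b h (some i) j).trace = 0 from (hb i).2.trace_eq_zero (hb i).1 hc j, add_zero]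
    exact hh.trace j
  obtain ⟨hR, htr⟩ := hrel A hAS
  have hd : Module.finrank ℂ (⨅ x, LinearMap.ker (pdiff (coords A) (equation lam mu _ x)) :
      Submodule ℂ (Fin 4 × Fin (2 * k + 1) × Fin (2 * k + 1) → ℂ)) =
      (2 * k + 1) ^ 2 + s - 1 := by
    have e : tangent (fun j => mu j - lam j) (toRefl lam mu A) =
        (⨅ x, LinearMap.ker (pdiff (coords A) (equation lam mu _ x))).map
          (variation hne (2 * k + 1)).toLinearMap := by
      ext ρ
      rw [Submodule.mem_map]
      constructor
      · intro hρ
        refine ⟨(variation hne _).symm ρ, ?_, LinearEquiv.apply_symm_apply _ ρ⟩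
        rw [Submodule.mem_iInf]
        refine (pdiff_equation_eq_zero_iff hne hR _).2 ?_
        rwa [LinearEquiv.apply_symm_apply]
      · rintro ⟨v, hv, rfl⟩
        rw [Submodule.mem_iInf] at hv
        exact (pdiff_equation_eq_zero_iff hne hR v).1 hv
    have h1 := finrank_tangent hc.ne_zero hR (Fintype.card_fin _) htr
    rw [finrank_cent_of_isHB hc hh hA, e, LinearEquiv.finrank_map_eq] at h1
    have h2 : (2 * k + 1) ^ 2 * 2 = 8 * (k * (k + 1)) + 2 := by ring
    omega
  obtain ⟨d, f₀, f, hdim, hf₀, hf, hind⟩ := exists_local_equations (equation lam mu (2 * k + 1))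
    (coords A) (eval_equation_eq_zero_iff.2 ⟨hR, htr⟩) hd (fun v hv => by
      obtain ⟨R, hR0, hR1, hR2⟩ :=
        IsHB.hasCurve hc hh hA _ ((pdiff_equation_eq_zero_iff hne hR v).1 hv)
      refine ⟨fun t => coords (ofRefl lam mu (R t)), ?_, ?_, ?_⟩
      · simp only [hR0, ofRefl_toRefl hne]
      · rw [hasDerivAt_pi]
        rintro ⟨j, a, b⟩
        have h1 := ((((hR1 j a b).const_mul (mu j - lam j)).const_add
          ((lam j + mu j) * (1 : Matrix (Fin (2 * k + 1)) (Fin (2 * k + 1)) ℂ) a b))).const_mul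
          (2⁻¹ : ℂ)
        have h2 : v (j, a, b) = 2⁻¹ * ((mu j - lam j) * variation hne _ v j a b) :=
          (congrFun ((variation hne _).symm_apply_apply v) (j, a, b)).symm
        rw [h2]
        exact h1
      · refine nhdsWithin_le_nhds ?_
        filter_upwards [hR2] with t ht
        refine eval_equation_eq_zero_iff.2 ?_
        rw [toRefl_ofRefl hne]
        exact ⟨ht.1, fun j => (ht.2 j).trans (htr j)⟩)
  obtain ⟨f₁, hf₁, hf₁'⟩ := exists_forall_isHB hs hne hc hh hA
  refine ⟨d, f₀ * f₁, f, hdim, ?_, fun y hy => ?_, hind⟩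
  · rw [map_mul]
    exact mul_ne_zero hf₀ hf₁
  · rw [map_mul] at hy
    obtain ⟨B, rfl⟩ : ∃ B : Quad (2 * k + 1), coords B = y :=
      ⟨fun j => of fun a b => y (j, a, b), rfl⟩
    rw [← hf _ (left_ne_zero_of_mul hy), eval_equation_eq_zero_iff,
      coords_injective.mem_set_image]
    exact ⟨hrel B, fun h => (hS B).2 (hf₁' B (right_ne_zero_of_mul hy) h.1 h.2)⟩

end LocalSmoothness
end DSP

/-! ### Coordinates on the generic two-dimensional families -/

namespace DSP

open Matrix Filter Topology

section Chart

variable {c : Fin 4 → ℂ}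

/-- The square of `c 0 • r 0 + c 1 • r 1`. -/
def pairSq {ι : Type*} [Fintype ι] (c : Fin 4 → ℂ) (r : Fin 4 → Matrix ι ι ℂ) : Matrix ι ι ℂ :=
  (c 0 • r 0 + c 1 • r 1) * (c 0 • r 0 + c 1 • r 1)

theorem Similar.pairSq_eq {ι κ : Type*} [Fintype ι] [DecidableEq ι] [Fintype κ] [DecidableEq κ]
    {r : Fin 4 → Matrix ι ι ℂ} {r' : Fin 4 → Matrix κ κ ℂ} (h : Similar r r') {x : ℂ}
    (hx : pairSq c r' = x • 1) : pairSq c r = x • 1 := by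
  obtain ⟨f, hf⟩ := h.exists_algEquiv
  have := congrArg f hx
  simpa [pairSq, hf] using this

theorem HasChar.pairSq_eq {ι : Type*} [Fintype ι] [DecidableEq ι] {r : Fin 4 → Matrix ι ι ℂ}
    {σ : Fin 4 → Fin 4 → ℂ} {ω : Fin 4 → Fin 4 → Fin 4 → ℂ} (hχ : HasChar r σ ω)
    (h : ReflRel c r) : pairSq c r = (c 0 ^ 2 + c 1 ^ 2 + 2 * c 0 * c 1 * σ 0 1) • 1 := by
  have e : pairSq c r = (c 0 * c 0) • (r 0 * r 0) + (c 1 * c 1) • (r 1 * r 1) +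
      (c 0 * c 1) • acomm r 0 1 := by
    simp only [pairSq, acomm, Matrix.add_mul, Matrix.mul_add, Matrix.smul_mul, Matrix.mul_smul,
      smul_smul, smul_add]
    rw [mul_comm (c 1) (c 0)]
    abel
  rw [e, h.sq, h.sq, hχ.acomm_eq, smul_smul, ← add_smul, ← add_smul]
  congr 1
  ring

/-- Families of involutions for which `c 0 • r 0 + c 1 • r 1` is diagonal, with eigenvalues `τ` and
`-τ`. Up to conjugation by diagonal matrices these are the general ones. -/
noncomputable def chart (c : Fin 4 → ℂ) (τ q : ℂ) : Fin 4 → Matrix (Fin 2) (Fin 2) ℂ :=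
  let p := (τ ^ 2 + c 0 ^ 2 - c 1 ^ 2) / (2 * τ * c 0)
  let p' := (c 3 ^ 2 - c 2 ^ 2 - τ ^ 2) / (2 * τ * c 2)
  ![!![p, 1; 1 - p ^ 2, -p],
    !![(c 1)⁻¹ * (τ - c 0 * p), -((c 1)⁻¹ * c 0);
      -((c 1)⁻¹ * (c 0 * (1 - p ^ 2))), (c 1)⁻¹ * (c 0 * p - τ)],
    !![p', q; (1 - p' ^ 2) / q, -p'],
    !![-((c 3)⁻¹ * (τ + c 2 * p')), -((c 3)⁻¹ * (c 2 * q));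
      -((c 3)⁻¹ * (c 2 * ((1 - p' ^ 2) / q))), (c 3)⁻¹ * (τ + c 2 * p')]]

variable {τ q : ℂ}

theorem chart_zero_add_one (hc : ∀ j, c j ≠ 0) :
    c 0 • chart c τ q 0 + c 1 • chart c τ q 1 = !![τ, 0; 0, -τ] := by
  have h1 := hc 1
  ext a b
  fin_cases a <;> fin_cases b <;> simp [chart, mul_inv_cancel_left₀ h1]
  ring

theorem chart_two_add_three (hc : ∀ j, c j ≠ 0) :
    c 2 • chart c τ q 2 + c 3 • chart c τ q 3 = !![-τ, 0; 0, τ] := by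
  have h3 := hc 3
  ext a b
  fin_cases a <;> fin_cases b <;> simp [chart, mul_inv_cancel_left₀ h3]

theorem pairSq_chart (hc : ∀ j, c j ≠ 0) : pairSq c (chart c τ q) = τ ^ 2 • 1 := by
  rw [pairSq, chart_zero_add_one hc]
  ext a b
  fin_cases a <;> fin_cases b <;> simp [Matrix.mul_apply] <;> ring

theorem reflRel_chart (hc : ∀ j, c j ≠ 0) (hτ : τ ≠ 0) (hq : q ≠ 0) : ReflRel c (chart c τ q) := by
  have h0 := hc 0
  have h1 := hc 1
  have h2 := hc 2
  have h3 := hc 3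
  refine ⟨fun j => ?_, ?_⟩
  · simp only [chart]
    have hp : 2 * τ * c 0 * ((τ ^ 2 + c 0 ^ 2 - c 1 ^ 2) / (2 * τ * c 0)) =
        τ ^ 2 + c 0 ^ 2 - c 1 ^ 2 := by field_simp
    have hp' : 2 * τ * c 2 * ((c 3 ^ 2 - c 2 ^ 2 - τ ^ 2) / (2 * τ * c 2)) =
        c 3 ^ 2 - c 2 ^ 2 - τ ^ 2 := by field_simp
    generalize (τ ^ 2 + c 0 ^ 2 - c 1 ^ 2) / (2 * τ * c 0) = p at hp
    generalize (c 3 ^ 2 - c 2 ^ 2 - τ ^ 2) / (2 * τ * c 2) = p' at hp'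
    fin_cases j
    · ext a b
      fin_cases a <;> fin_cases b <;> simp [Matrix.mul_apply] <;> ring
    · have e : c 1 ^ 2 = τ ^ 2 + c 0 ^ 2 - 2 * τ * c 0 * p := by rw [hp]; ring
      ext a b
      fin_cases a <;> fin_cases b <;> simp [Matrix.mul_apply] <;> field_simp <;>
        first | ring1 | linear_combination -e
    · ext a b
      fin_cases a <;> fin_cases b <;> simp [Matrix.mul_apply] <;> field_simp <;> ring
    · have e : c 3 ^ 2 = τ ^ 2 + c 2 ^ 2 + 2 * τ * c 2 * p' := by rw [hp']; ring
      ext a b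
      fin_cases a <;> fin_cases b <;> simp [Matrix.mul_apply] <;> field_simp <;>
        first | ring1 | linear_combination -e
  · rw [Fin.sum_univ_four, add_assoc, chart_zero_add_one hc, chart_two_add_three hc]
    ext a b
    fin_cases a <;> fin_cases b <;> simp

theorem brick_chart (hc : ∀ j, c j ≠ 0) (hτ : τ ≠ 0) : Brick (chart c τ q) := by
  intro Z hZ
  have h1 : Commute Z (!![τ, 0; 0, -τ] : Matrix (Fin 2) (Fin 2) ℂ) := by
    rw [← chart_zero_add_one (q := q) hc]
    exact ((hZ 0).smul_right _).add_right ((hZ 1).smul_right _)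
  have e1 := congrFun (congrFun h1.eq 0) 1
  have e2 := congrFun (congrFun h1.eq 1) 0
  have e3 := congrFun (congrFun (hZ 0).eq 0) 1
  simp [Matrix.mul_apply] at e1 e2
  have hZ01 : Z 0 1 = 0 := by
    have : (2 * τ) * Z 0 1 = 0 := by linear_combination -e1
    exact (mul_eq_zero.1 this).resolve_left (mul_ne_zero two_ne_zero hτ)
  have hZ10 : Z 1 0 = 0 := by
    have : (2 * τ) * Z 1 0 = 0 := by linear_combination e2
    exact (mul_eq_zero.1 this).resolve_left (mul_ne_zero two_ne_zero hτ)
  simp [Matrix.mul_apply, chart, hZ01] at e3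
  refine ⟨Z 0 0, ?_⟩
  ext a b
  fin_cases a <;> fin_cases b <;> simp [hZ01, hZ10, e3]

theorem irred_chart (hc : ∀ j, c j ≠ 0) (hτ : τ ≠ 0) (hq : q ≠ 0) (h1 : τ ^ 2 ≠ (c 0 + c 1) ^ 2)
    (h2 : τ ^ 2 ≠ (c 0 - c 1) ^ 2) : Irred (chart c τ q) := by
  have hR := reflRel_chart hc hτ hq
  obtain ⟨σ, ω, hχ⟩ := (brick_chart (q := q) hc hτ).exists_hasChar hR hc
  have h3 := smul_one_injective ((hχ.pairSq_eq hR).symm.trans (pairSq_chart hc))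
  refine hχ.irred hR (by simp) (i := 0) (j := 1) fun h => ?_
  have h4 : (σ 0 1 - 1) * (σ 0 1 + 1) = 0 := by linear_combination h
  rcases mul_eq_zero.1 h4 with h5 | h5
  · exact h1 (by linear_combination -h3 + 2 * c 0 * c 1 * h5)
  · exact h2 (by linear_combination -h3 + 2 * c 0 * c 1 * h5)

end Chart
end DSP

/-! ### Recognition and deformation of two-dimensional families -/

namespace DSP

open Matrix Filter Topology

section Recognition

variable {c : Fin 4 → ℂ} {τ : ℂ}

theorem exists_similar_chart_of_diagonal {C : Fin 4 → Matrix (Fin 2) (Fin 2) ℂ}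
    (hc : ∀ j, c j ≠ 0) (h : ReflRel c C) (htr : ∀ j, (C j).trace = 0) (hτ : τ ≠ 0)
    (hC : c 0 • C 0 + c 1 • C 1 = !![τ, 0; 0, -τ]) (h1 : τ ^ 2 ≠ (c 0 + c 1) ^ 2)
    (h2 : τ ^ 2 ≠ (c 0 - c 1) ^ 2) (h3 : τ ^ 2 ≠ (c 2 + c 3) ^ 2) (h4 : τ ^ 2 ≠ (c 2 - c 3) ^ 2) :
    ∃ q, q ≠ 0 ∧ Similar C (chart c τ q) := by
  have hc0 := hc 0
  have hc1 := hc 1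
  have hc2 := hc 2
  have hc3 := hc 3
  have hC' : c 2 • C 2 + c 3 • C 3 = !![-τ, 0; 0, τ] := by
    have h5 := h.sum
    rw [Fin.sum_univ_four, add_assoc, hC] at h5
    rw [eq_neg_of_add_eq_zero_right h5]
    ext x y
    fin_cases x <;> fin_cases y <;> simp
  have ent : ∀ j, C j 1 1 = -C j 0 0 ∧ C j 0 0 ^ 2 + C j 0 1 * C j 1 0 = 1 := fun j => by
    have e1 := htr j
    rw [Matrix.trace_fin_two] at e1
    have e2 := congrFun (congrFun (h.sq j) 0) 0
    simp [Matrix.mul_apply] at e2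
    exact ⟨eq_neg_of_add_eq_zero_right e1, by rw [← e2]; ring⟩
  have a00 := congrFun (congrFun hC 0) 0
  have a01 := congrFun (congrFun hC 0) 1
  have a10 := congrFun (congrFun hC 1) 0
  have b00 := congrFun (congrFun hC' 0) 0
  have b01 := congrFun (congrFun hC' 0) 1
  have b10 := congrFun (congrFun hC' 1) 0
  simp at a00 a01 a10 b00 b01 b10
  have hp : 2 * τ * c 0 * C 0 0 0 = τ ^ 2 + c 0 ^ 2 - c 1 ^ 2 := by
    linear_combination (c 1 * C 1 0 0 + τ - c 0 * C 0 0 0) * a00 + c 0 ^ 2 * (ent 0).2 -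
      c 1 ^ 2 * (ent 1).2 + (c 1 * C 1 1 0) * a01 - (c 0 * C 0 0 1) * a10
  have hp' : 2 * τ * c 2 * C 2 0 0 = c 3 ^ 2 - c 2 ^ 2 - τ ^ 2 := by
    linear_combination (τ + c 2 * C 2 0 0 - c 3 * C 3 0 0) * b00 - c 2 ^ 2 * (ent 2).2 +
      c 3 ^ 2 * (ent 3).2 - (c 3 * C 3 1 0) * b01 + (c 2 * C 2 0 1) * b10
  have hu : C 0 0 1 ≠ 0 := fun e => by
    have e1 := (ent 0).2
    rw [e, zero_mul, add_zero] at e1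
    have e2 : (τ ^ 2 - (c 0 + c 1) ^ 2) * (τ ^ 2 - (c 0 - c 1) ^ 2) = 0 := by
      linear_combination (4 * τ ^ 2 * c 0 ^ 2) * e1 -
        (2 * τ * c 0 * C 0 0 0 + (τ ^ 2 + c 0 ^ 2 - c 1 ^ 2)) * hp
    exact (mul_ne_zero (sub_ne_zero.2 h1) (sub_ne_zero.2 h2)) e2
  have hq : C 2 0 1 ≠ 0 := fun e => by
    have e1 := (ent 2).2
    rw [e, zero_mul, add_zero] at e1
    have e2 : (τ ^ 2 - (c 2 + c 3) ^ 2) * (τ ^ 2 - (c 2 - c 3) ^ 2) = 0 := by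
      linear_combination (4 * τ ^ 2 * c 2 ^ 2) * e1 -
        (2 * τ * c 2 * C 2 0 0 + (c 3 ^ 2 - c 2 ^ 2 - τ ^ 2)) * hp'
    exact (mul_ne_zero (sub_ne_zero.2 h3) (sub_ne_zero.2 h4)) e2
  have hP : C 0 0 0 = (τ ^ 2 + c 0 ^ 2 - c 1 ^ 2) / (2 * τ * c 0) := by
    rw [← hp]; field_simp
  have hP' : C 2 0 0 = (c 3 ^ 2 - c 2 ^ 2 - τ ^ 2) / (2 * τ * c 2) := by
    rw [← hp']; field_simp
  refine ⟨C 2 0 1 / C 0 0 1, div_ne_zero hq hu, ?_⟩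
  -- conjugation by `D` makes the upper right entry of `C 0` equal to `1`
  set D : Matrix (Fin 2) (Fin 2) ℂ := !![C 0 0 1, 0; 0, 1] with hD
  have hD' : ∀ x y : ℂ, (!![x, 0; 0, y] : Matrix (Fin 2) (Fin 2) ℂ) * D =
      D * (!![x, 0; 0, y] : Matrix (Fin 2) (Fin 2) ℂ) := fun x y => by
    ext a b
    fin_cases a <;> fin_cases b <;> simp [hD, Matrix.mul_apply, mul_comm]
  have e0 : C 0 * D = D * chart c τ (C 2 0 1 / C 0 0 1) 0 := by
    ext a b
    fin_cases a <;> fin_cases b <;> simp [hD, Matrix.mul_apply, chart, ← hP, (ent 0).1]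
    · ring
    · linear_combination (ent 0).2
  have e2 : C 2 * D = D * chart c τ (C 2 0 1 / C 0 0 1) 2 := by
    ext a b
    fin_cases a <;> fin_cases b <;> simp [hD, Matrix.mul_apply, chart, ← hP', (ent 2).1]
    · ring
    · field_simp
    · field_simp
      linear_combination (ent 2).2
  have e1 : C 1 * D = D * chart c τ (C 2 0 1 / C 0 0 1) 1 := by
    have e := hD' τ (-τ)
    nth_rw 1 [← hC] at e
    rw [← chart_zero_add_one (q := C 2 0 1 / C 0 0 1) hc, Matrix.add_mul, Matrix.mul_add,
      Matrix.smul_mul, Matrix.smul_mul, Matrix.mul_smul,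
      Matrix.mul_smul, e0] at e
    exact smul_right_injective _ hc1 (add_left_cancel e)
  have e3 : C 3 * D = D * chart c τ (C 2 0 1 / C 0 0 1) 3 := by
    have e := hD' (-τ) τ
    nth_rw 1 [← hC'] at e
    rw [← chart_two_add_three (q := C 2 0 1 / C 0 0 1) hc, Matrix.add_mul, Matrix.mul_add,
      Matrix.smul_mul, Matrix.smul_mul, Matrix.mul_smul,
      Matrix.mul_smul, e2] at e
    exact smul_right_injective _ hc3 (add_left_cancel e)
  refine ⟨D, !![(C 0 0 1)⁻¹, 0; 0, 1], ?_, ?_, fun j => ?_⟩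
  · ext a b
    fin_cases a <;> fin_cases b <;> simp [hD, Matrix.mul_apply, hu]
  · ext a b
    fin_cases a <;> fin_cases b <;> simp [hD, Matrix.mul_apply, hu]
  · fin_cases j
    · exact e0
    · exact e1
    · exact e2
    · exact e3

theorem exists_similar_chart {B : Fin 4 → Matrix (Fin 2) (Fin 2) ℂ} (hc : ∀ j, c j ≠ 0)
    (h : ReflRel c B) (htr : ∀ j, (B j).trace = 0) {y : ℂ} (hy : pairSq c B = y • 1) (h0 : y ≠ 0)
    (h1 : y ≠ (c 0 + c 1) ^ 2) (h2 : y ≠ (c 0 - c 1) ^ 2) (h3 : y ≠ (c 2 + c 3) ^ 2)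
    (h4 : y ≠ (c 2 - c 3) ^ 2) :
    ∃ τ q, τ ^ 2 = y ∧ q ≠ 0 ∧ Similar B (chart c τ q) := by
  obtain ⟨τ, rfl⟩ := IsAlgClosed.exists_pow_nat_eq y (n := 2) two_pos
  have hτ : τ ≠ 0 := fun e => h0 (by rw [e]; norm_num)
  set M := τ⁻¹ • (c 0 • B 0 + c 1 • B 1) with hM
  have hMM : M * M = 1 := by
    rw [hM, Matrix.smul_mul, Matrix.mul_smul, smul_smul]
    change (τ⁻¹ * τ⁻¹) • pairSq c B = 1
    rw [hy, smul_smul]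
    convert one_smul ℂ _
    field_simp
  have hMt : M.trace = 0 := by simp [hM, htr]
  obtain ⟨P, Q, d, hPQ, hQP, hMP, hd⟩ := exists_diagonalization_of_sq_eq_one hMM
  have hd1 : d 1 = -d 0 := by
    have e : M = P * diagonal d * Q := by rw [← hMP, Matrix.mul_assoc, hPQ, Matrix.mul_one]
    rw [e, Matrix.trace_mul_comm, ← Matrix.mul_assoc, hQP, Matrix.one_mul, trace_diagonal,
      Fin.sum_univ_two] at hMt
    exact eq_neg_of_add_eq_zero_right hMt
  have hd2 : d 0 ^ 2 = 1 := by rcases hd 0 with e | e <;> rw [e] <;> norm_num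
  -- the square root of `y` is chosen so that the first diagonal entry is `τ`, not `-τ`
  have hsq : (τ * d 0) ^ 2 = τ ^ 2 := by rw [mul_pow, hd2, mul_one]
  have hsim : Similar (fun j => Q * B j * P) B :=
    ⟨Q, P, hQP, hPQ, fun j => by rw [Matrix.mul_assoc, hPQ, Matrix.mul_one]⟩
  obtain ⟨q, hq, hs⟩ := exists_similar_chart_of_diagonal (τ := τ * d 0) hc (hsim.reflRel h)
    (fun j => by rw [hsim.trace_eq, htr])
    (fun e => by rw [e] at hsq; exact h0 (by rw [← hsq]; norm_num))
    (by
      have e : c 0 • (Q * B 0 * P) + c 1 • (Q * B 1 * P) = τ • (Q * (M * P)) := by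
        rw [hM, Matrix.smul_mul, Matrix.mul_smul, smul_inv_smul₀ hτ, ← Matrix.mul_assoc,
          Matrix.mul_add, Matrix.add_mul, Matrix.mul_smul, Matrix.mul_smul, Matrix.smul_mul,
          Matrix.smul_mul]
      rw [e, hMP, ← Matrix.mul_assoc, hQP, Matrix.one_mul]
      ext a b
      fin_cases a <;> fin_cases b <;> simp [hd1])
    (by rwa [hsq]) (by rwa [hsq]) (by rwa [hsq]) (by rwa [hsq])
  exact ⟨τ * d 0, q, hsq, hq, hsim.symm.trans hs⟩

end Recognition

section Deformation

variable {c : Fin 4 → ℂ} {s s' : Fin 4 → Fin 4 → ℂ} {w w' : Fin 4 → Fin 4 → Fin 4 → ℂ}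
  {i j k : Fin 4}

theorem normalForm_fst : normalForm c s w i j k i = !![1, 0; 0, -1] := by simp [normalForm]

theorem normalForm_snd (hij : i ≠ j) : normalForm c s w i j k j =
    !![s i j, 2 * (s i j ^ 2 - 1); -2⁻¹, -s i j] := by
  simp only [normalForm]
  rw [if_neg hij.symm, if_pos trivial]
  ext a b
  fin_cases a <;> fin_cases b <;> simp
  ring

theorem normalForm_trd (hik : i ≠ k) (hjk : j ≠ k) (hs : s i j ^ 2 ≠ 1) :
    normalForm c s w i j k k =
      !![s i k, w i j k - 2 * s j k + 2 * s i k * s i j;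
        (4 * (s i j ^ 2 - 1))⁻¹ * (w i j k + 2 * s j k - 2 * s i k * s i j), -s i k] := by
  have h : s i j ^ 2 - 1 ≠ 0 := sub_ne_zero.2 hs
  simp only [normalForm]
  rw [if_neg hik.symm, if_neg hjk.symm, if_pos trivial]
  ext a b
  fin_cases a <;> fin_cases b <;> simp [Matrix.one_fin_two] <;> field_simp
  ring

theorem normalForm_of_ne {l : Fin 4} (hij : i ≠ j) (hik : i ≠ k) (hjk : j ≠ k) (hil : i ≠ l)
    (hjl : j ≠ l) (hkl : k ≠ l) :
    normalForm c s w i j k l = -(c l)⁻¹ • (c i • normalForm c s w i j k i +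
        c j • normalForm c s w i j k j + c k • normalForm c s w i j k k) := by
  simp [normalForm, hij.symm, hik.symm, hjk.symm, hil.symm, hjl.symm, hkl.symm]

theorem reflRel_normalForm (hc : ∀ x, c x ≠ 0) {l : Fin 4} (hij : i ≠ j) (hik : i ≠ k) (hjk : j ≠ k)
    (hil : i ≠ l) (hjl : j ≠ l) (hkl : k ≠ l) (hx : ∀ x, x = i ∨ x = j ∨ x = k ∨ x = l)
    (hs : s i j ^ 2 ≠ 1)
    (h1 : w i j k ^ 2 = 4 * (s i j ^ 2 + s i k ^ 2 + s j k ^ 2 - 2 * s i j * s i k * s j k - 1))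
    (h2 : c l ^ 2 = c i ^ 2 + c j ^ 2 + c k ^ 2 + 2 * c i * c j * s i j + 2 * c i * c k * s i k +
      2 * c j * c k * s j k) : ReflRel c (normalForm c s w i j k) := by
  have hne : s i j ^ 2 - 1 ≠ 0 := sub_ne_zero.2 hs
  have hl := normalForm_of_ne (c := c) (s := s) (w := w) hij hik hjk hil hjl hkl
  have hcl := hc l
  refine ⟨fun x => ?_, ?_⟩
  · rcases hx x with rfl | rfl | rfl | rfl
    · rw [normalForm_fst]
      ext a b
      fin_cases a <;> fin_cases b <;> simp [Matrix.mul_apply]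
    · rw [normalForm_snd hij]
      ext a b
      fin_cases a <;> fin_cases b <;> simp [Matrix.mul_apply] <;> ring
    · rw [normalForm_trd hik hjk hs]
      ext a b
      fin_cases a <;> fin_cases b <;> simp [Matrix.mul_apply] <;> field_simp <;>
        first | ring1 | linear_combination h1
    · rw [hl, normalForm_fst, normalForm_snd hij, normalForm_trd hik hjk hs]
      ext a b
      fin_cases a <;> fin_cases b <;> simp [Matrix.mul_apply] <;> field_simp <;>
        first
        | ring1
        | linear_combination 2 * (c k ^ 2 * h1 - 4 * (s i j ^ 2 - 1) * h2)
  · rw [sum_eq_of_distinct _ hij hik hil hjk hjl hkl, hl, smul_smul, mul_neg,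
      mul_inv_cancel₀ hcl, neg_smul, one_smul, add_neg_cancel]

theorem sq_add_normalForm_fst_snd (hij : i ≠ j) :
    (c i • normalForm c s w i j k i + c j • normalForm c s w i j k j) *
      (c i • normalForm c s w i j k i + c j • normalForm c s w i j k j) =
      (c i ^ 2 + c j ^ 2 + 2 * c i * c j * s i j) • 1 := by
  rw [normalForm_fst, normalForm_snd hij]
  ext a b
  fin_cases a <;> fin_cases b <;> simp [Matrix.mul_apply] <;> ring

theorem sq_add_normalForm_fst_trd (hik : i ≠ k) (hjk : j ≠ k) (hs : s i j ^ 2 ≠ 1)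
    (h1 : w i j k ^ 2 = 4 * (s i j ^ 2 + s i k ^ 2 + s j k ^ 2 - 2 * s i j * s i k * s j k - 1)) :
    (c i • normalForm c s w i j k i + c k • normalForm c s w i j k k) *
      (c i • normalForm c s w i j k i + c k • normalForm c s w i j k k) =
      (c i ^ 2 + c k ^ 2 + 2 * c i * c k * s i k) • 1 := by
  have hne : s i j ^ 2 - 1 ≠ 0 := sub_ne_zero.2 hs
  rw [normalForm_fst, normalForm_trd hik hjk hs]
  ext a b
  fin_cases a <;> fin_cases b <;> simp [Matrix.mul_apply] <;> field_simp <;>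
    first
    | ring1
    | linear_combination c k ^ 2 * h1

theorem sq_eq_of_reflRel_normalForm (hik : i ≠ k) (hjk : j ≠ k) (hs : s i j ^ 2 ≠ 1)
    (h : ReflRel c (normalForm c s w i j k)) :
    w i j k ^ 2 = 4 * (s i j ^ 2 + s i k ^ 2 + s j k ^ 2 - 2 * s i j * s i k * s j k - 1) := by
  have hne : s i j ^ 2 - 1 ≠ 0 := sub_ne_zero.2 hs
  have e := congrFun (congrFun (h.sq k) 0) 0
  rw [normalForm_trd hik hjk hs] at e
  simp [Matrix.mul_apply] at e
  field_simp at e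
  linear_combination e

theorem HasChar.sq_eq {ι : Type*} [Fintype ι] [DecidableEq ι] [Nonempty ι]
    {r : Fin 4 → Matrix ι ι ℂ} {l : Fin 4} (hχ : HasChar r s w) (h : ReflRel c r) (hij : i ≠ j)
    (hik : i ≠ k) (hjk : j ≠ k) (hil : i ≠ l) (hjl : j ≠ l) (hkl : k ≠ l) :
    c l ^ 2 = c i ^ 2 + c j ^ 2 + c k ^ 2 + 2 * c i * c j * s i j + 2 * c i * c k * s i k +
      2 * c j * c k * s j k := by
  have e := fun x => hχ.sum_eq_zero h x
  simp only [sum_eq_of_distinct _ hij hik hil hjk hjl hkl] at e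
  have ei := e i
  have ej := e j
  have ek := e k
  have el := e l
  rw [hχ.self_eq_one h] at ei ej ek el
  rw [hχ.symm j i] at ej
  rw [hχ.symm k i, hχ.symm k j] at ek
  rw [hχ.symm l i, hχ.symm l j, hχ.symm l k] at el
  linear_combination c l * el - c i * ei - c j * ej - c k * ek

theorem ReflRel.pairSq_eq {ι : Type*} [Fintype ι] [DecidableEq ι] {r : Fin 4 → Matrix ι ι ℂ}
    (h : ReflRel c r) (hp : (i = 0 ∧ j = 1) ∨ (i = 1 ∧ j = 0) ∨ (i = 2 ∧ j = 3) ∨ (i = 3 ∧ j = 2)) :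
    pairSq c r = (c i • r i + c j • r j) * (c i • r i + c j • r j) := by
  have e : c 2 • r 2 + c 3 • r 3 = -(c 0 • r 0 + c 1 • r 1) := by
    have h1 := h.sum
    rw [Fin.sum_univ_four, add_assoc] at h1
    exact eq_neg_of_add_eq_zero_right h1
  rcases hp with ⟨rfl, rfl⟩ | ⟨rfl, rfl⟩ | ⟨rfl, rfl⟩ | ⟨rfl, rfl⟩
  · rfl
  · rw [add_comm, pairSq]
  · rw [e, neg_mul_neg, pairSq]
  · rw [add_comm, e, neg_mul_neg, pairSq]

/-- A square root of a function can be chosen close to a given value. -/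
theorem exists_tendsto_sq_eq {a : ℂ → ℂ} {y : ℂ} (h : Tendsto a (𝓝 0) (𝓝 (y ^ 2))) :
    ∃ f : ℂ → ℂ, (∀ t, f t ^ 2 = a t) ∧ Tendsto f (𝓝 0) (𝓝 y) := by
  have h1 : ∀ t, ∃ z, z ^ 2 = a t ∧ ‖z - y‖ ^ 2 ≤ ‖a t - y ^ 2‖ := by
    intro t
    obtain ⟨z, hz⟩ := IsAlgClosed.exists_pow_nat_eq (a t) (n := 2) two_pos
    have e : ‖a t - y ^ 2‖ = ‖z - y‖ * ‖z + y‖ := by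
      rw [← norm_mul, ← hz]
      congr 1
      ring
    rcases le_total ‖z - y‖ ‖z + y‖ with h2 | h2
    · exact ⟨z, hz, by rw [e, pow_two]; gcongr⟩
    · refine ⟨-z, by rw [neg_sq, hz], ?_⟩
      rw [e, pow_two, ← neg_add', norm_neg]
      gcongr
  choose f hf hf' using h1
  refine ⟨f, hf, tendsto_iff_norm_sub_tendsto_zero.2 ?_⟩
  have h2 : Tendsto (fun t => √‖a t - y ^ 2‖) (𝓝 0) (𝓝 0) := by
    have h3 := (tendsto_iff_norm_sub_tendsto_zero.1 h).sqrt
    rwa [Real.sqrt_zero] at h3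
  exact squeeze_zero (fun t => norm_nonneg _) (fun t => Real.le_sqrt_of_sq_le (hf' t)) h2

theorem tendsto_matrix_fin_two {f₁ f₂ f₃ f₄ : ℂ → ℂ} {a₁ a₂ a₃ a₄ : ℂ}
    (h₁ : Tendsto f₁ (𝓝 0) (𝓝 a₁)) (h₂ : Tendsto f₂ (𝓝 0) (𝓝 a₂)) (h₃ : Tendsto f₃ (𝓝 0) (𝓝 a₃))
    (h₄ : Tendsto f₄ (𝓝 0) (𝓝 a₄)) :
    Tendsto (fun t => (!![f₁ t, f₂ t; f₃ t, f₄ t] : Matrix (Fin 2) (Fin 2) ℂ)) (𝓝 0)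
      (𝓝 !![a₁, a₂; a₃, a₄]) := by
  refine tendsto_pi_nhds.2 fun a => tendsto_pi_nhds.2 fun b => ?_
  fin_cases a <;> fin_cases b <;> assumption

theorem tendsto_normalForm {S : ℂ → Fin 4 → Fin 4 → ℂ} {W : ℂ → Fin 4 → Fin 4 → Fin 4 → ℂ}
    (hij : i ≠ j) (hik : i ≠ k) (hjk : j ≠ k) (hs : s i j ^ 2 ≠ 1)
    (hS : ∀ x y, Tendsto (fun t => S t x y) (𝓝 0) (𝓝 (s x y)))
    (hW : Tendsto (fun t => W t i j k) (𝓝 0) (𝓝 (w i j k))) (x : Fin 4) :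
    Tendsto (fun t => normalForm c (S t) (W t) i j k x) (𝓝 0) (𝓝 (normalForm c s w i j k x)) := by
  obtain ⟨l, hil, hjl, hkl, hx⟩ := exists_fourth hij hik hjk
  have hne : ∀ᶠ t in 𝓝 0, S t i j ^ 2 ≠ 1 := ((hS i j).pow 2).eventually_ne hs
  have hi : Tendsto (fun t => normalForm c (S t) (W t) i j k i) (𝓝 0)
      (𝓝 (normalForm c s w i j k i)) := by
    simp only [normalForm_fst]
    exact tendsto_const_nhds
  have hj : Tendsto (fun t => normalForm c (S t) (W t) i j k j) (𝓝 0)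
      (𝓝 (normalForm c s w i j k j)) := by
    simp only [normalForm_snd hij]
    exact tendsto_matrix_fin_two (hS i j) ((((hS i j).pow 2).sub_const 1).const_mul 2)
      tendsto_const_nhds (hS i j).neg
  have hk : Tendsto (fun t => normalForm c (S t) (W t) i j k k) (𝓝 0)
      (𝓝 (normalForm c s w i j k k)) := by
    rw [normalForm_trd hik hjk hs]
    refine Tendsto.congr' (f₁ := fun t => !![S t i k, W t i j k - 2 * S t j k + 2 * S t i k * S t i j;
        (4 * (S t i j ^ 2 - 1))⁻¹ * (W t i j k + 2 * S t j k - 2 * S t i k * S t i j), -S t i k])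
      (hne.mono fun t ht => (normalForm_trd hik hjk ht).symm) ?_
    refine tendsto_matrix_fin_two (hS i k) ?_ ?_ (hS i k).neg
    · exact (hW.sub ((hS j k).const_mul 2)).add (((hS i k).const_mul 2).mul (hS i j))
    · refine ((((hS i j).pow 2).sub_const 1).const_mul 4 |>.inv₀
        (mul_ne_zero (by norm_num) (sub_ne_zero.2 hs))).mul ?_
      exact (hW.add ((hS j k).const_mul 2)).sub (((hS i k).const_mul 2).mul (hS i j))
  rcases hx x with rfl | rfl | rfl | rfl
  · exact hi
  · exact hj
  · exact hk
  · simp only [normalForm_of_ne hij hik hjk hil hjl hkl]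
    exact (((hi.const_smul _).add (hj.const_smul _)).add (hk.const_smul _)).const_smul _

/-- An irreducible family deforms in such a way that two given anticommutators change with arbitrary
velocities. The third anticommutator is adjusted to keep the weighted sum zero, and `w i j k`
is a square root of an expression in the anticommutators. -/
theorem exists_deformation_of_hasChar (hc : ∀ x, c x ≠ 0) {b : Fin 4 → Matrix (Fin 2) (Fin 2) ℂ}
    (h : ReflRel c b) (hχ : HasChar b s w) (hij : i ≠ j) (hik : i ≠ k) (hjk : j ≠ k)
    (hs : s i j ^ 2 ≠ 1) (u v : ℂ) :
    ∃ B : ℂ → Fin 4 → Matrix (Fin 2) (Fin 2) ℂ, (∀ x, Tendsto (fun t => B t x) (𝓝 0) (𝓝 (b x))) ∧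
      ∀ᶠ t in 𝓝 0, ReflRel c (B t) ∧ (∀ x, (B t x).trace = 0) ∧
        (c i • B t i + c j • B t j) * (c i • B t i + c j • B t j) =
          (c i ^ 2 + c j ^ 2 + 2 * c i * c j * (s i j + t * u)) • 1 ∧
        (c i • B t i + c k • B t k) * (c i • B t i + c k • B t k) =
          (c i ^ 2 + c k ^ 2 + 2 * c i * c k * (s i k + t * v)) • 1 := by
  obtain ⟨l, hil, hjl, hkl, hx⟩ := exists_fourth hij hik hjk
  have hsim := hχ.similar_normalForm h hc (Or.inr (by simp)) hij hik hjk hs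
  have h1 := sq_eq_of_reflRel_normalForm hik hjk hs (hsim.symm.reflRel h)
  have h2 := hχ.sq_eq h hij hik hjk hil hjl hkl
  let S : ℂ → Fin 4 → Fin 4 → ℂ := fun t x y => s x y +
    t * if x = i ∧ y = j then u else if x = i ∧ y = k then v else
      -(c i * c j * u + c i * c k * v) / (c j * c k)
  have hS : ∀ x y, Tendsto (fun t => S t x y) (𝓝 0) (𝓝 (s x y)) := fun x y => by
    have : Continuous fun t => S t x y := by fun_prop
    simpa [S] using this.tendsto 0
  have hSij : ∀ t, S t i j = s i j + t * u := fun t => by simp [S]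
  have hSik : ∀ t, S t i k = s i k + t * v := fun t => by simp [S, hjk.symm]
  have hSjk : ∀ t, S t j k = s j k + t * (-(c i * c j * u + c i * c k * v) / (c j * c k)) :=
    fun t => by simp [S, hij.symm]
  obtain ⟨f, hf, hf'⟩ := exists_tendsto_sq_eq (y := w i j k) (a := fun t =>
    4 * (S t i j ^ 2 + S t i k ^ 2 + S t j k ^ 2 - 2 * S t i j * S t i k * S t j k - 1)) (by
      rw [h1]
      exact ((((((hS i j).pow 2).add ((hS i k).pow 2)).add ((hS j k).pow 2)).sub
        ((((hS i j).const_mul 2).mul (hS i k)).mul (hS j k))).sub_const 1).const_mul 4)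
  obtain ⟨P, Q, hPQ, hQP, hP⟩ := hsim
  have hsim' : ∀ t, Similar (fun x => P * normalForm c (S t) (fun _ _ _ => f t) i j k x * Q)
      (normalForm c (S t) (fun _ _ _ => f t) i j k) := fun t =>
    ⟨P, Q, hPQ, hQP, fun x => by rw [Matrix.mul_assoc, hQP, Matrix.mul_one]⟩
  refine ⟨fun t x => P * normalForm c (S t) (fun _ _ _ => f t) i j k x * Q, fun x => ?_, ?_⟩
  · have h3 : Continuous fun M : Matrix (Fin 2) (Fin 2) ℂ => P * M * Q :=
      (continuous_const.matrix_mul continuous_id).matrix_mul continuous_const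
    rw [Similar.eq_mul hPQ hP]
    exact (h3.tendsto _).comp (tendsto_normalForm hij hik hjk hs hS hf' x)
  · have hne : ∀ᶠ t in 𝓝 0, S t i j ^ 2 ≠ 1 := ((hS i j).pow 2).eventually_ne hs
    filter_upwards [hne] with t ht
    have hR : ReflRel c (normalForm c (S t) (fun _ _ _ => f t) i j k) :=
      reflRel_normalForm hc hij hik hjk hil hjl hkl hx ht (hf t) (by
        have hcj := hc j
        have hck := hc k
        rw [hSij, hSik, hSjk, h2]
        field_simp
        ring)
    have hmul : ∀ {x y : Fin 4} {N : Fin 4 → Matrix (Fin 2) (Fin 2) ℂ} {z : ℂ},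
        (c x • N x + c y • N y) * (c x • N x + c y • N y) = z • 1 →
        (c x • (P * N x * Q) + c y • (P * N y * Q)) * (c x • (P * N x * Q) + c y • (P * N y * Q)) =
          z • 1 := fun {x y N z} hN => by
      have := congrArg (conjAlg P Q hPQ hQP) hN
      simpa only [map_mul, map_add, map_smul, map_one, conjAlg_apply] using this
    refine ⟨(hsim' t).reflRel hR, fun x => ?_, ?_, ?_⟩
    · rw [(hsim' t).trace_eq, trace_normalForm]
    · rw [← hSij]
      exact hmul (sq_add_normalForm_fst_snd hij)
    · rw [← hSik]
      exact hmul (sq_add_normalForm_fst_trd hik hjk ht (hf t))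

/-- The square of `c 0 • r 0 + c 1 • r 1` can be given an arbitrary velocity. -/
theorem Irred.exists_deformation (hc : NoSubsum c) {b : Fin 4 → Matrix (Fin 2) (Fin 2) ℂ}
    (h : ReflRel c b) (hi : Irred b) (m : ℂ) :
    ∃ (x : ℂ) (B : ℂ → Fin 4 → Matrix (Fin 2) (Fin 2) ℂ),
      (∀ x, Tendsto (fun t => B t x) (𝓝 0) (𝓝 (b x))) ∧
      ∀ᶠ t in 𝓝 0, ReflRel c (B t) ∧ (∀ x, (B t x).trace = 0) ∧
        pairSq c (B t) = (x + t * m) • 1 := by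
  have hc' := hc.ne_zero
  obtain ⟨σ, ω, hχ, i, j, -, hij, -, -, hs⟩ := hi.exists_hasChar h hc
  -- it suffices to move one of the anticommutators `{0, 1}` and `{2, 3}`, since
  -- `c 2 • r 2 + c 3 • r 3 = -(c 0 • r 0 + c 1 • r 1)`
  have key : ∀ i j : Fin 4, i ≠ j →
      ((i = 0 ∧ j = 1) ∨ (i = 1 ∧ j = 0) ∨ (i = 2 ∧ j = 3) ∨ (i = 3 ∧ j = 2)) ∨
      ∃ k, i ≠ k ∧ j ≠ k ∧
        ((i = 0 ∧ k = 1) ∨ (i = 1 ∧ k = 0) ∨ (i = 2 ∧ k = 3) ∨ (i = 3 ∧ k = 2)) := by decide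
  have key' : ∀ i j : Fin 4, ∃ k, i ≠ k ∧ j ≠ k := by decide
  have hci := hc' i
  rcases key i j hij with hp | ⟨k, hik, hjk, hp⟩
  · obtain ⟨k, hik, hjk⟩ := key' i j
    have hcj := hc' j
    obtain ⟨B, hB, hB'⟩ := exists_deformation_of_hasChar hc' h hχ hij hik hjk hs
      (m / (2 * c i * c j)) 0
    refine ⟨c i ^ 2 + c j ^ 2 + 2 * c i * c j * σ i j, B, hB, hB'.mono fun t ht =>
      ⟨ht.1, ht.2.1, ?_⟩⟩
    rw [ht.1.pairSq_eq hp, ht.2.2.1]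
    congr 1
    field_simp
    ring
  · have hck := hc' k
    obtain ⟨B, hB, hB'⟩ := exists_deformation_of_hasChar hc' h hχ hij hik hjk hs
      0 (m / (2 * c i * c k))
    refine ⟨c i ^ 2 + c k ^ 2 + 2 * c i * c k * σ i k, B, hB, hB'.mono fun t ht =>
      ⟨ht.1, ht.2.1, ?_⟩⟩
    rw [ht.1.pairSq_eq hp, ht.2.2.2]
    congr 1
    field_simp
    ring

end Deformation
end DSP

/-! ### Connectedness of the strata -/

namespace DSP

open Matrix Filter Topology

section Lines

/-- The restrictions of the function to complex lines are polynomial. -/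
def PolynomialOnLines {V : Type*} [AddCommGroup V] [Module ℂ V] (f : V → ℂ) : Prop :=
  ∀ x y : V, ∃ p : Polynomial ℂ, ∀ t : ℂ, f (x + t • y) = p.eval t

variable {V : Type*} [AddCommGroup V] [Module ℂ V] {f g : V → ℂ}

theorem PolynomialOnLines.const (a : ℂ) : PolynomialOnLines fun _ : V => a :=
  fun _ _ => ⟨Polynomial.C a, fun _ => by simp⟩

theorem PolynomialOnLines.linear (h : IsLinearMap ℂ f) : PolynomialOnLines f :=
  fun x y => ⟨Polynomial.C (f x) + Polynomial.C (f y) * Polynomial.X, fun t => by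
    simp only [h.map_add, h.map_smul, Polynomial.eval_add, Polynomial.eval_mul, Polynomial.eval_C,
      Polynomial.eval_X, smul_eq_mul, mul_comm t]⟩

theorem PolynomialOnLines.mul (hf : PolynomialOnLines f) (hg : PolynomialOnLines g) :
    PolynomialOnLines fun x => f x * g x := fun x y => by
  obtain ⟨p, hp⟩ := hf x y
  obtain ⟨q, hq⟩ := hg x y
  exact ⟨p * q, fun t => by simp only [hp, hq, Polynomial.eval_mul]⟩

theorem PolynomialOnLines.sub (hf : PolynomialOnLines f) (hg : PolynomialOnLines g) :
    PolynomialOnLines fun x => f x - g x := fun x y => by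
  obtain ⟨p, hp⟩ := hf x y
  obtain ⟨q, hq⟩ := hg x y
  exact ⟨p - q, fun t => by simp only [hp, hq, Polynomial.eval_sub]⟩

theorem PolynomialOnLines.pow (hf : PolynomialOnLines f) (n : ℕ) :
    PolynomialOnLines fun x => f x ^ n := fun x y => by
  obtain ⟨p, hp⟩ := hf x y
  exact ⟨p ^ n, fun t => by simp only [hp, Polynomial.eval_pow]⟩

theorem PolynomialOnLines.prod {α : Type*} {f : α → V → ℂ} (s : Finset α)
    (hf : ∀ i, PolynomialOnLines (f i)) : PolynomialOnLines fun x => ∏ i ∈ s, f i x := fun x y => by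
  choose p hp using fun i => hf i x y
  exact ⟨∏ i ∈ s, p i, fun t => by
    rw [Polynomial.eval_prod]; exact Finset.prod_congr rfl fun i _ => hp i t⟩

theorem PolynomialOnLines.det {ι : Type*} [Fintype ι] [DecidableEq ι] (M : V →ₗ[ℂ] Matrix ι ι ℂ) :
    PolynomialOnLines fun x => (M x).det := fun x y => by
  refine ⟨((M x).map Polynomial.C + (Polynomial.X : Polynomial ℂ) • (M y).map Polynomial.C).det,
    fun t => ?_⟩
  rw [← Polynomial.coe_evalRingHom, RingHom.map_det]
  refine congrArg Matrix.det ?_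
  ext a b
  simp only [map_add, map_smul, Matrix.add_apply, Matrix.smul_apply, Matrix.map_apply,
    RingHom.mapMatrix_apply, smul_eq_mul, Polynomial.coe_evalRingHom,
    Polynomial.eval_mul, Polynomial.eval_C, Polynomial.eval_X]

/-- The complement of the zero set of a polynomial in a complex vector space is connected: two of
its points lie on a complex line, which meets the zero set in finitely many points. -/
theorem PolynomialOnLines.isPreconnected [TopologicalSpace V] [ContinuousAdd V]
    [ContinuousSMul ℂ V] (hf : PolynomialOnLines f) : IsPreconnected {x | f x ≠ 0} := by
  refine isPreconnected_of_forall_pair fun x hx y hy => ?_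
  obtain ⟨p, hp⟩ := hf x (y - x)
  have hx' : p.eval 0 ≠ 0 := by rw [← hp]; simpa using hx
  have hy' : p.eval 1 ≠ 0 := by rw [← hp]; simpa using hy
  have hp0 : p ≠ 0 := by rintro rfl; simp at hx'
  have h1 : IsPreconnected ({t : ℂ | p.IsRoot t}ᶜ) :=
    (Set.Countable.isPathConnected_compl_of_one_lt_rank (by
      rw [Complex.rank_real_complex]; exact Nat.one_lt_ofNat)
      (p.finite_setOfPred_isRoot hp0).countable).isConnected.isPreconnected
  refine ⟨(fun t : ℂ => x + t • (y - x)) '' {t : ℂ | p.IsRoot t}ᶜ, ?_, ⟨0, hx', by simp⟩,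
    ⟨1, hy', by simp⟩, h1.image _ (by fun_prop)⟩
  rintro _ ⟨t, ht, rfl⟩
  change f _ ≠ 0
  rw [hp]
  exact ht

end Lines

section Charts

variable {c : Fin 4 → ℂ} {ι : Type*} [Fintype ι] [DecidableEq ι] {m s : ℕ}

/-- A polynomial whose roots are the exceptional values of the square of `c 0 • r 0 + c 1 • r 1`. -/
def discr (c : Fin 4 → ℂ) (y : ℂ) : ℂ :=
  y * (y - (c 0 + c 1) ^ 2) * (y - (c 0 - c 1) ^ 2) * (y - (c 2 + c 3) ^ 2) * (y - (c 2 - c 3) ^ 2)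

theorem discr_ne_zero_iff {y : ℂ} : discr c y ≠ 0 ↔ y ≠ 0 ∧ y ≠ (c 0 + c 1) ^ 2 ∧
    y ≠ (c 0 - c 1) ^ 2 ∧ y ≠ (c 2 + c 3) ^ 2 ∧ y ≠ (c 2 - c 3) ^ 2 := by
  simp only [discr, mul_ne_zero_iff, sub_ne_zero, and_assoc]

/-- The function of a transition matrix and of parameters of `chart` that detects whether these
give a point of the stratum. -/
noncomputable def chartDiscr (c : Fin 4 → ℂ) (x : Matrix ι ι ℂ × (Fin s → ℂ) × (Fin s → ℂ)) : ℂ :=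
  x.1.det * (∏ i, discr c (x.2.1 i ^ 2) * x.2.2 i) *
    ∏ i, ∏ j ∈ Finset.univ.erase i, (x.2.1 i ^ 2 - x.2.1 j ^ 2)

theorem chartDiscr_ne_zero_iff {x : Matrix ι ι ℂ × (Fin s → ℂ) × (Fin s → ℂ)} :
    chartDiscr c x ≠ 0 ↔ x.1.det ≠ 0 ∧ (∀ i, discr c (x.2.1 i ^ 2) ≠ 0 ∧ x.2.2 i ≠ 0) ∧
      ∀ i j, j ≠ i → x.2.1 i ^ 2 ≠ x.2.1 j ^ 2 := by
  simp [chartDiscr, Finset.prod_ne_zero_iff, sub_ne_zero, and_assoc]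

theorem PolynomialOnLines.discr {V : Type*} [AddCommGroup V] [Module ℂ V] {f : V → ℂ}
    (hf : PolynomialOnLines f) : PolynomialOnLines fun x => discr c (f x) := by
  have h (a : ℂ) : PolynomialOnLines fun x => f x - a := hf.sub (PolynomialOnLines.const a)
  exact (((hf.mul (h _)).mul (h _)).mul (h _)).mul (h _)

theorem polynomialOnLines_chartDiscr :
    PolynomialOnLines (chartDiscr c : Matrix ι ι ℂ × (Fin s → ℂ) × (Fin s → ℂ) → ℂ) := by
  have h0 : PolynomialOnLines fun x : Matrix ι ι ℂ × (Fin s → ℂ) × (Fin s → ℂ) => x.1.det :=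
    PolynomialOnLines.det (LinearMap.fst ℂ (Matrix ι ι ℂ) ((Fin s → ℂ) × (Fin s → ℂ)))
  have h1 (i : Fin s) : PolynomialOnLines
      fun x : Matrix ι ι ℂ × (Fin s → ℂ) × (Fin s → ℂ) => x.2.1 i ^ 2 :=
    PolynomialOnLines.pow (PolynomialOnLines.linear ⟨fun _ _ => rfl, fun _ _ => rfl⟩) 2
  have h2 (i : Fin s) : PolynomialOnLines
      fun x : Matrix ι ι ℂ × (Fin s → ℂ) × (Fin s → ℂ) => x.2.2 i :=
    PolynomialOnLines.linear ⟨fun _ _ => rfl, fun _ _ => rfl⟩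
  have h3 := PolynomialOnLines.prod Finset.univ fun i => ((h1 i).discr (c := c)).mul (h2 i)
  have h4 := PolynomialOnLines.prod Finset.univ fun i =>
    PolynomialOnLines.prod (Finset.univ.erase i) fun j => (h1 i).sub (h1 j)
  unfold chartDiscr
  exact (h0.mul h3).mul h4

theorem continuous_dsum_blocks (h : Fin 4 → Matrix (Fin m) (Fin m) ℂ) (j : Fin 4) :
    Continuous fun b : Fin s → Fin 4 → Matrix (Fin 2) (Fin 2) ℂ => dsum (blocks b h) j := by
  refine Continuous.matrix_blockDiagonal' (continuous_pi fun t => ?_)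
  rcases t with _ | i
  · exact continuous_const
  · exact (continuous_apply j).comp (continuous_apply i)

theorem continuous_chart {X : Type*} [TopologicalSpace X] (hc : ∀ j, c j ≠ 0) {τ q : X → ℂ}
    (hτ : Continuous τ) (hq : Continuous q) (hτ0 : ∀ x, τ x ≠ 0) (hq0 : ∀ x, q x ≠ 0) (j : Fin 4) :
    Continuous fun x => chart c (τ x) (q x) j := by
  have h0 : ∀ x, 2 * τ x * c 0 ≠ 0 := fun x => mul_ne_zero (mul_ne_zero two_ne_zero (hτ0 x)) (hc 0)
  have h2 : ∀ x, 2 * τ x * c 2 ≠ 0 := fun x => mul_ne_zero (mul_ne_zero two_ne_zero (hτ0 x)) (hc 2)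
  refine continuous_pi fun a => continuous_pi fun b => ?_
  fin_cases j <;> fin_cases a <;> fin_cases b <;> simp [chart] <;> fun_prop (disch := assumption)

/-- The points of the stratum with prescribed parameters. -/
noncomputable def chartPoint (c : Fin 4 → ℂ) (h : Fin 4 → Matrix (Fin m) (Fin m) ℂ)
    (e : (Σ t : Option (Fin s), Fin (blockSize m t)) ≃ ι)
    (x : Matrix ι ι ℂ × (Fin s → ℂ) × (Fin s → ℂ)) : Fin 4 → Matrix ι ι ℂ :=
  fun j => x.1 * reindex e e (dsum (blocks (fun i => chart c (x.2.1 i) (x.2.2 i)) h) j) * x.1⁻¹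

variable {h : Fin 4 → Matrix (Fin m) (Fin m) ℂ}
  {e : (Σ t : Option (Fin s), Fin (blockSize m t)) ≃ ι}

theorem continuous_chartPoint {X : Type*} [TopologicalSpace X] (hc : ∀ j, c j ≠ 0)
    {M : X → Matrix ι ι ℂ} {τ q : X → Fin s → ℂ} (hM : Continuous M) (hτ : Continuous τ)
    (hq : Continuous q) (hx : ∀ x, chartDiscr c (M x, τ x, q x) ≠ 0) :
    Continuous fun x => chartPoint c h e (M x, τ x, q x) := by
  have hx' := fun x => chartDiscr_ne_zero_iff.1 (hx x)
  have hb : Continuous fun x i => chart c (τ x i) (q x i) := by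
    refine continuous_pi fun i => continuous_pi (continuous_chart hc (τ := fun x => τ x i)
      (q := fun x => q x i) (by fun_prop) (by fun_prop) (fun x h0 => ?_)
      fun x => ((hx' x).2.1 i).2)
    exact (discr_ne_zero_iff.1 ((hx' x).2.1 i).1).1 (by
      simp only [h0]
      norm_num)
  refine continuous_pi fun j => Continuous.matrix_mul (hM.matrix_mul ?_) ?_
  · exact ((continuous_dsum_blocks h j).comp hb).matrix_reindex e e
  · simp only [Matrix.inv_def, Ring.inverse_eq_inv']
    exact (hM.matrix_det.inv₀ fun x => (hx' x).1).smul hM.matrix_adjugate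

theorem isPreconnected_image_chartPoint (hc : ∀ j, c j ≠ 0) :
    IsPreconnected (chartPoint c h e '' {x | chartDiscr c x ≠ 0}) := by
  refine polynomialOnLines_chartDiscr.isPreconnected.image _ ?_
  rw [continuousOn_iff_continuous_domRestrict]
  change Continuous fun x : {x | chartDiscr c x ≠ 0} =>
    chartPoint c h e (x.val.1, x.val.2.1, x.val.2.2)
  exact continuous_chartPoint hc (by fun_prop) (by fun_prop) (by fun_prop) fun x => x.2

theorem similar_chartPoint {x : Matrix ι ι ℂ × (Fin s → ℂ) × (Fin s → ℂ)} (hx : x.1.det ≠ 0) :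
    Similar (chartPoint c h e x) (dsum (blocks (fun i => chart c (x.2.1 i) (x.2.2 i)) h)) := by
  have hu : IsUnit x.1.det := isUnit_iff_ne_zero.2 hx
  refine Similar.trans ⟨x.1, x.1⁻¹, Matrix.mul_nonsing_inv _ hu, Matrix.nonsing_inv_mul _ hu,
    fun j => ?_⟩ (Similar.reindex _ e).symm
  rw [chartPoint, Matrix.mul_assoc, Matrix.nonsing_inv_mul _ hu, Matrix.mul_one]

theorem isHB_chartPoint (hc : ∀ j, c j ≠ 0) {x : Matrix ι ι ℂ × (Fin s → ℂ) × (Fin s → ℂ)}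
    (hx : chartDiscr c x ≠ 0) : IsHB c s h (chartPoint c h e x) := by
  rw [chartDiscr_ne_zero_iff] at hx
  refine ⟨fun i => chart c (x.2.1 i) (x.2.2 i), fun i => ?_, fun i j hij hsim => ?_,
    similar_chartPoint hx.1⟩
  · have h1 := discr_ne_zero_iff.1 (hx.2.1 i).1
    have h2 : x.2.1 i ≠ 0 := fun h0 => h1.1 (by rw [h0]; norm_num)
    exact ⟨reflRel_chart hc h2 (hx.2.1 i).2, irred_chart hc h2 (hx.2.1 i).2 h1.2.1 h1.2.2.1⟩
  · exact hx.2.2 i j hij.symm (smul_one_injective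
      ((pairSq_chart hc).symm.trans (hsim.pairSq_eq (pairSq_chart hc))))

theorem mem_image_chartPoint (hc : ∀ j, c j ≠ 0) {r : Fin 4 → Matrix ι ι ℂ}
    {B : Fin s → Fin 4 → Matrix (Fin 2) (Fin 2) ℂ} {y : Fin s → ℂ} (hB : ∀ i, ReflRel c (B i))
    (htr : ∀ i j, (B i j).trace = 0) (hy : ∀ i, pairSq c (B i) = y i • 1)
    (hd : ∀ i, discr c (y i) ≠ 0) (hinj : Function.Injective y)
    (hr : Similar r (dsum (blocks B h))) :
    r ∈ chartPoint c h e '' {x | chartDiscr c x ≠ 0} := by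
  have h1 := fun i => discr_ne_zero_iff.1 (hd i)
  choose τ q hτ hq hsim using fun i => exists_similar_chart hc (hB i) (htr i) (hy i) (h1 i).1
    (h1 i).2.1 (h1 i).2.2.1 (h1 i).2.2.2.1 (h1 i).2.2.2.2
  have h2 : Similar (dsum (blocks B h)) (dsum (blocks (fun i => chart c (τ i) (q i)) h)) :=
    Similar.dsum fun t => by
      rcases t with _ | i
      · exact Similar.refl h
      · exact hsim i
  obtain ⟨P, Q, hPQ, hQP, hP⟩ := (hr.trans h2).trans (Similar.reindex _ e)
  have hdet : P.det ≠ 0 := fun h0 => by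
    have := congrArg det hPQ
    rw [det_mul, h0, zero_mul, det_one] at this
    exact zero_ne_one this
  refine ⟨(P, τ, q), chartDiscr_ne_zero_iff.2 ⟨hdet, fun i => ⟨by rw [hτ]; exact hd i, hq i⟩,
    fun i j hij => ?_⟩, ?_⟩
  · simp only [hτ]
    exact fun h0 => hij (hinj h0).symm
  · funext j
    rw [chartPoint, Similar.eq_mul hPQ hP, Matrix.inv_eq_right_inv hPQ]

theorem eventually_add_mul_ne {x m y : ℂ} (hm : m ≠ 0) : ∀ᶠ t in 𝓝[≠] (0 : ℂ), x + t * m ≠ y := by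
  by_cases h0 : (y - x) / m = 0
  · filter_upwards [self_mem_nhdsWithin] with t ht h1
    refine ht ?_
    rw [Set.mem_singleton_iff, ← h0, ← h1]
    field_simp
    ring
  · filter_upwards [(eventually_ne_nhds (Ne.symm h0)).filter_mono nhdsWithin_le_nhds] with t ht h1
    refine ht ?_
    rw [← h1]
    field_simp
    ring

theorem subset_closure_image_chartPoint (hc : NoSubsum c) :
    {r | IsHB c s h r} ⊆ closure (chartPoint c h e '' {x | chartDiscr c x ≠ 0}) := by
  rintro r ⟨b, hb, -, P, Q, hPQ, hQP, hP⟩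
  -- the velocities are different, so that the values become different
  choose x B hB hB' using fun i => (hb i).2.exists_deformation hc (hb i).1 (i.val + 1)
  have hm : ∀ i : Fin s, (i.val + 1 : ℂ) ≠ 0 := fun i => Nat.cast_add_one_ne_zero _
  refine mem_closure_of_tendsto (b := 𝓝[≠] (0 : ℂ))
    (f := fun t j => P * dsum (blocks (fun i => B i t) h) j * Q) ?_ ?_
  · refine tendsto_pi_nhds.2 fun j => Tendsto.mono_left ?_ nhdsWithin_le_nhds
    rw [Similar.eq_mul hPQ hP]
    have h1 : Continuous fun b : Fin s → Fin 4 → Matrix (Fin 2) (Fin 2) ℂ =>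
        P * dsum (blocks b h) j * Q :=
      (continuous_const.matrix_mul (continuous_dsum_blocks h j)).matrix_mul continuous_const
    exact (h1.tendsto b).comp (tendsto_pi_nhds.2 fun i => tendsto_pi_nhds.2 (hB i))
  · have h1 : ∀ᶠ t in 𝓝[≠] (0 : ℂ), ∀ i, discr c (x i + t * (i.val + 1)) ≠ 0 := by
      refine eventually_all.2 fun i => ?_
      filter_upwards [eventually_add_mul_ne (x := x i) (y := 0) (hm i),
        eventually_add_mul_ne (x := x i) (y := (c 0 + c 1) ^ 2) (hm i),
        eventually_add_mul_ne (x := x i) (y := (c 0 - c 1) ^ 2) (hm i),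
        eventually_add_mul_ne (x := x i) (y := (c 2 + c 3) ^ 2) (hm i),
        eventually_add_mul_ne (x := x i) (y := (c 2 - c 3) ^ 2) (hm i)] with t h1 h2 h3 h4 h5
      exact discr_ne_zero_iff.2 ⟨h1, h2, h3, h4, h5⟩
    have h2 : ∀ᶠ t in 𝓝[≠] (0 : ℂ), ∀ i j : Fin s, i ≠ j →
        x i + t * (i.val + 1) ≠ x j + t * (j.val + 1) := by
      refine eventually_all.2 fun i => eventually_all.2 fun j => ?_
      by_cases hij : i = j
      · exact Eventually.of_forall fun _ h0 => absurd hij h0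
      · have : (i.val : ℂ) - j.val ≠ 0 := by
          rw [sub_ne_zero]
          exact fun h0 => hij (Fin.ext (Nat.cast_injective h0))
        filter_upwards [eventually_add_mul_ne (x := x i) (y := x j) this] with t ht _ h0
        exact ht (by linear_combination h0)
    have h3 : ∀ᶠ t in 𝓝[≠] (0 : ℂ), ∀ i, _ :=
      eventually_all.2 fun i => (hB' i).filter_mono nhdsWithin_le_nhds
    filter_upwards [h1, h2, h3] with t h1 h2 h3
    refine mem_image_chartPoint (B := fun i => B i t) hc.ne_zero (fun i => (h3 i).1)
      (fun i => (h3 i).2.1) (fun i => (h3 i).2.2) h1 (fun i j hij => ?_)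
      ⟨P, Q, hPQ, hQP, fun j => by rw [Matrix.mul_assoc, hQP, Matrix.mul_one]⟩
    by_contra h0
    exact h2 i j h0 hij

/-- A stratum is connected: the points given by `chart` form a connected subset, which is dense
by the existence of deformations. -/
theorem isPreconnected_setOf_isHB (hc : NoSubsum c)
    (e : (Σ t : Option (Fin s), Fin (blockSize m t)) ≃ ι) :
    IsPreconnected {r : Fin 4 → Matrix ι ι ℂ | IsHB c s h r} := by
  refine (isPreconnected_image_chartPoint (h := h) (e := e) hc.ne_zero).subset_closure ?_
    (subset_closure_image_chartPoint hc)
  rintro _ ⟨x, hx, rfl⟩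
  exact isHB_chartPoint hc.ne_zero hx

/-- The stratum contains points for which the parameters `τ i` of `chart` are natural numbers. -/
theorem nonempty_setOf_isHB (hc : ∀ j, c j ≠ 0)
    (e : (Σ t : Option (Fin s), Fin (blockSize m t)) ≃ ι) :
    {r : Fin 4 → Matrix ι ι ℂ | IsHB c s h r}.Nonempty := by
  have h1 : {y : ℂ | discr c y = 0}.Finite := by
    refine Set.Finite.subset (Set.toFinite {0, (c 0 + c 1) ^ 2, (c 0 - c 1) ^ 2, (c 2 + c 3) ^ 2,
      (c 2 - c 3) ^ 2}) fun y hy => ?_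
    by_contra h0
    simp only [Set.mem_insert_iff, Set.mem_singleton_iff, not_or] at h0
    exact discr_ne_zero_iff.2 h0 hy
  have h0 : Function.Injective fun n : ℕ => (n : ℂ) ^ 2 := fun a b hab => by
    have h3 : (a : ℂ) ^ 2 = (b : ℂ) ^ 2 := hab
    rw [← Nat.cast_pow, ← Nat.cast_pow] at h3
    exact Nat.pow_left_injective two_ne_zero (Nat.cast_injective h3)
  have h2 : {n : ℕ | discr c ((n : ℂ) ^ 2) ≠ 0}.Infinite := (h1.preimage h0.injOn).infinite_compl
  let f : Fin s ↪ {n : ℕ | discr c ((n : ℂ) ^ 2) ≠ 0} :=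
    Fin.valEmbedding.trans (h2.natEmbedding _)
  refine ⟨chartPoint c h e (1, fun i => (f i).val, 1), isHB_chartPoint hc ?_⟩
  refine chartDiscr_ne_zero_iff.2 ⟨by simp, fun i => ⟨(f i).2, one_ne_zero⟩, fun i j hij h4 => hij ?_⟩
  exact (f.injective (Subtype.ext (h0 h4))).symm

end Charts
end DSP

/-! ### Existence of quadruples of type `H`, and the expected dimension -/

namespace DSP

open Matrix

section Existence

variable {c lam mu : Fin 4 → ℂ}

theorem mul_stdE_apply {l : ℕ} (X : Matrix (Fin (l + 1)) (Fin (l + 1)) ℂ) (a : Fin (l + 1))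
    (b : Fin l) : (X * stdE l) a b = X a b.castSucc := by
  simp [stdE, Matrix.mul_apply]

theorem mul_stdF_apply {l : ℕ} (X : Matrix (Fin (l + 1)) (Fin (l + 1)) ℂ) (a : Fin (l + 1))
    (b : Fin l) : (X * stdF l) a b = X a b.succ := by
  simp [stdF, Matrix.mul_apply]

theorem stdE_mul_apply_castSucc {l : ℕ} (Y : Matrix (Fin l) (Fin l) ℂ) (a b : Fin l) :
    (stdE l * Y) a.castSucc b = Y a b := by
  simp [stdE, Matrix.mul_apply]

theorem stdE_mul_apply_last {l : ℕ} (Y : Matrix (Fin l) (Fin l) ℂ) (b : Fin l) :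
    (stdE l * Y) (Fin.last l) b = 0 := by
  simp [stdE, Matrix.mul_apply, (Fin.castSucc_lt_last _).ne']

theorem stdF_mul_apply_succ {l : ℕ} (Y : Matrix (Fin l) (Fin l) ℂ) (a b : Fin l) :
    (stdF l * Y) a.succ b = Y a b := by
  simp [stdF, Matrix.mul_apply]

theorem stdF_mul_apply_zero {l : ℕ} (Y : Matrix (Fin l) (Fin l) ℂ) (b : Fin l) :
    (stdF l * Y) 0 b = 0 := by
  simp [stdF, Matrix.mul_apply, (Fin.succ_ne_zero _).symm]

/-- The endomorphisms of the standard pair are scalar: they are given by Toeplitz matrices whose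
entries outside the diagonal vanish, as they do in the first and in the last row. -/
theorem eq_smul_one_of_std {l : ℕ} {X : Matrix (Fin (l + 1)) (Fin (l + 1)) ℂ}
    {Y : Matrix (Fin l) (Fin l) ℂ} (hE : X * stdE l = stdE l * Y) (hF : X * stdF l = stdF l * Y) :
    X = X 0 0 • (1 : Matrix (Fin (l + 1)) (Fin (l + 1)) ℂ) ∧
      Y = X 0 0 • (1 : Matrix (Fin l) (Fin l) ℂ) := by
  have hY : ∀ a b : Fin l, X a.castSucc b.castSucc = Y a b := fun a b => by
    rw [← mul_stdE_apply X, hE, stdE_mul_apply_castSucc]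
  have hY' : ∀ a b : Fin l, X a.succ b.succ = Y a b := fun a b => by
    rw [← mul_stdF_apply X, hF, stdF_mul_apply_succ]
  have hlast : ∀ b : Fin l, X (Fin.last l) b.castSucc = 0 := fun b => by
    rw [← mul_stdE_apply X, hE, stdE_mul_apply_last]
  have hzero : ∀ b : Fin l, X 0 b.succ = 0 := fun b => by
    rw [← mul_stdF_apply X, hF, stdF_mul_apply_zero]
  have hlt : ∀ a b, a < b → X a b = 0 := fun a => by
    induction a using Fin.induction with
    | zero =>
      intro b hb
      obtain ⟨b, rfl⟩ := Fin.exists_succ_eq.2 hb.ne'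
      exact hzero b
    | succ a ih =>
      intro b hb
      obtain ⟨b, rfl⟩ := Fin.exists_succ_eq.2 (Fin.ne_zero_of_lt hb)
      rw [hY', ← hY]
      exact ih _ (Fin.castSucc_lt_castSucc_iff.2 (Fin.succ_lt_succ_iff.1 hb))
  have hgt : ∀ a b, b < a → X a b = 0 := fun a => by
    induction a using Fin.reverseInduction with
    | last =>
      intro b hb
      obtain ⟨b, rfl⟩ := Fin.exists_castSucc_eq.2 hb.ne
      exact hlast b
    | cast a ih =>
      intro b hb
      obtain ⟨b, rfl⟩ := Fin.exists_castSucc_eq.2 (hb.trans (Fin.castSucc_lt_last a)).ne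
      rw [hY, ← hY']
      exact ih _ (Fin.succ_lt_succ_iff.2 (Fin.castSucc_lt_castSucc_iff.1 hb))
  have hdiag : ∀ a, X a a = X 0 0 := fun a => by
    induction a using Fin.induction with
    | zero => rfl
    | succ a ih => rw [hY', ← hY, ih]
  have hX : X = X 0 0 • (1 : Matrix (Fin (l + 1)) (Fin (l + 1)) ℂ) := by
    ext a b
    rcases lt_trichotomy a b with h | rfl | h
    · simp [hlt a b h, h.ne]
    · simp [hdiag a]
    · simp [hgt a b h, h.ne']
  refine ⟨hX, ?_⟩
  ext a b
  rw [← hY, hX]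
  simp [Matrix.one_apply]

theorem brick_stdFamily (c : Fin 4 → ℂ) (l : ℕ) : Brick (stdFamily c l) := by
  intro Z hZ
  have h := fun j => (hZ j).eq
  rw [← Matrix.fromBlocks_toBlocks Z] at h ⊢
  generalize Z.toBlocks₁₁ = X at h ⊢
  generalize Z.toBlocks₁₂ = U at h ⊢
  generalize Z.toBlocks₂₁ = V at h ⊢
  generalize Z.toBlocks₂₂ = Y at h ⊢
  simp only [stdFamily, Matrix.fromBlocks_multiply, Matrix.fromBlocks_inj, Matrix.mul_neg,
    Matrix.mul_one, Matrix.mul_zero, add_zero, Matrix.neg_mul, Matrix.one_mul, Matrix.zero_mul,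
    zero_add] at h
  have hU : U = 0 := by
    have h0 := (h 0).2.1
    simp only [stdBlock, Matrix.cons_val_zero, Matrix.mul_zero, Matrix.zero_mul, zero_add,
      add_zero] at h0
    ext x y
    exact self_eq_neg.1 (congrFun (congrFun h0 x) y)
  have hV : V = 0 := by
    ext x y
    exact neg_eq_self.1 (congrFun (congrFun (h 0).2.2.1 x) y)
  have hXY : ∀ j, X * stdBlock c l j = stdBlock c l j * Y := fun j => by
    have := (h j).2.1
    rwa [hU, neg_zero, zero_add, add_zero] at this
  obtain ⟨hX, hY⟩ := eq_smul_one_of_std (hXY 1) (hXY 2)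
  refine ⟨X 0 0, ?_⟩
  rw [hU, hV, hY, ← Matrix.fromBlocks_one, Matrix.fromBlocks_smul, smul_zero, smul_zero, ← hX]

theorem reflRel_stdFamily (hc : c 3 ≠ 0) (hsum : ∑ j, c j = 0) (l : ℕ) :
    ReflRel c (stdFamily c l) := by
  refine ⟨fun j => ?_, ?_⟩
  · rw [stdFamily, Matrix.fromBlocks_multiply]
    simp
  · have h1 : ∑ j, c j • stdBlock c l j = 0 := by
      rw [Fin.sum_univ_four]
      simp [stdBlock, hc]
      abel
    rw [Fin.sum_univ_four] at h1 hsum ⊢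
    simp only [stdFamily, Matrix.fromBlocks_smul, Matrix.fromBlocks_add, h1, smul_zero, add_zero,
      ← add_smul, hsum, zero_smul, Matrix.fromBlocks_zero]

theorem trace_stdFamily (c : Fin 4 → ℂ) (l : ℕ) (j : Fin 4) : (stdFamily c l j).trace = -1 := by
  simp [stdFamily, Matrix.trace]

/-- Quadruples of type `H` exist: the standard family is upper triangular. -/
theorem exists_isTypeH (hne : ∀ j, lam j ≠ mu j) (hlam : ∑ j, lam j = 0) (hmu : ∑ j, mu j = 0)
    (l : ℕ) : ∃ o H, IsTypeH lam mu l o H := by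
  set c : Fin 4 → ℂ := fun j => mu j - lam j with hc
  have hc3 : c 3 ≠ 0 := sub_ne_zero.2 (hne 3).symm
  have hsum : ∑ j, c j = 0 := by rw [hc, Finset.sum_sub_distrib, hlam, hmu, sub_zero]
  have hn : l + 1 + l = 2 * l + 1 := by ring
  let e : Fin (l + 1) ⊕ Fin l ≃ Fin (2 * l + 1) := finSumFinEquiv.trans (finCongr hn)
  have hel : ∀ a, (e (Sum.inl a)).val = a.val := fun a => by simp [e]
  have her : ∀ a, (e (Sum.inr a)).val = l + 1 + a.val := fun a => by simp [e]
  let r : Fin 4 → Matrix (Fin (2 * l + 1)) (Fin (2 * l + 1)) ℂ :=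
    fun j => reindex e e (stdFamily c l j)
  have hr : ∀ j x y, r j (e x) (e y) = stdFamily c l j x y := fun j x y => by simp [r]
  have hsim : Similar r (stdFamily c l) := (Similar.reindex _ e).symm
  have hR : ReflRel c r := hsim.reflRel (reflRel_stdFamily hc3 hsum l)
  refine ⟨fun i => decide (i.val < l + 1), ofRefl lam mu r, ?_, fun j => ?_, fun Z hZ => ?_,
    fun j i => ?_⟩
  · rw [mem_variety_iff hn hne hlam hmu, toRefl_ofRefl hne]
    refine ⟨hR, fun j => ?_⟩
    rw [hsim.trace_eq, trace_stdFamily]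
    push_cast
    ring
  · intro x y hxy
    obtain ⟨x, rfl⟩ := e.surjective x
    obtain ⟨y, rfl⟩ := e.surjective y
    have hxy' : (e y).val < (e x).val := hxy
    have hne' : e x ≠ e y := fun h => hxy'.ne (by rw [h])
    have h1 : stdFamily c l j x y = 0 := by
      rcases x with x | x <;> rcases y with y | y
      · have : x ≠ y := fun h => hne' (by rw [h])
        simp [stdFamily, this]
      · rw [hel, her] at hxy'
        omega
      · simp [stdFamily]
      · have : x ≠ y := fun h => hne' (by rw [h])
        simp [stdFamily, this]
    rw [ofRefl, Matrix.smul_apply, Matrix.add_apply, Matrix.smul_apply, Matrix.smul_apply, hr, h1,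
      Matrix.one_apply_ne hne', smul_zero, smul_zero, add_zero, smul_zero]
  · have h1 : Z ∈ cent r := by
      rw [← toRefl_ofRefl hne r, cent_toRefl hne]
      exact hZ
    exact hsim.brick (brick_stdFamily c l) Z h1
  · obtain ⟨x, rfl⟩ := e.surjective i
    rw [ofRefl, Matrix.smul_apply, Matrix.add_apply, Matrix.smul_apply, Matrix.smul_apply, hr,
      Matrix.one_apply_eq]
    rcases x with x | x
    · rw [if_pos (by rw [decide_eq_true_eq, hel]; exact x.2)]
      simp [stdFamily]
      ring
    · rw [if_neg (by rw [decide_eq_true_eq, her]; omega)]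
      simp [stdFamily]
      ring

end Existence

section Dimension

variable {lam mu : Fin 4 → ℂ}

theorem classDim_eq {n a b : ℕ} (hn : a + b = n) {α β : ℂ} (hne : α ≠ β)
    {A r : Matrix (Fin n) (Fin n) ℂ} (hA : A = (2⁻¹ : ℂ) • ((α + β) • 1 + (β - α) • r))
    (hr : r * r = 1) (htr : r.trace = (b : ℂ) - a) : classDim A = 2 * (a * b) := by
  rw [← finrank_anticomm hr (by simpa using hn.symm) htr, classDim]
  have h0 : β - α ≠ 0 := sub_ne_zero.2 hne.symm
  have h1 : ∀ X, A * X - X * A = ((2⁻¹ : ℂ) * (β - α)) • (r * X - X * r) := fun X => by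
    rw [hA, Matrix.smul_mul, Matrix.mul_smul, Matrix.add_mul, Matrix.mul_add, Matrix.smul_mul,
      Matrix.smul_mul, Matrix.mul_smul, Matrix.mul_smul, Matrix.one_mul, Matrix.mul_one,
      ← smul_sub, add_sub_add_left_eq_sub, ← smul_sub, smul_smul]
  suffices H : LinearMap.range (LinearMap.mulLeft ℂ A - LinearMap.mulRight ℂ A) = anticomm r by
    rw [H]
  ext X
  constructor
  · rintro ⟨Y, rfl⟩
    change A * Y - Y * A ∈ _
    rw [h1, ← neg_sub (Y * r)]
    exact Submodule.smul_mem _ _ (Submodule.neg_mem _ (commutator_mem_anticomm hr Y))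
  · intro hX
    refine ⟨((2⁻¹ : ℂ) * (β - α))⁻¹ • -((2⁻¹ : ℂ) • (X * r)), ?_⟩
    change A * _ - _ * A = _
    rw [h1, Matrix.mul_smul, Matrix.smul_mul, ← smul_sub, smul_smul,
      mul_inv_cancel₀ (mul_ne_zero (inv_ne_zero two_ne_zero) h0), one_smul, Matrix.mul_neg,
      Matrix.neg_mul, sub_neg_eq_add, neg_add_eq_sub]
    exact commutator_of_mem_anticomm hr hX

theorem expectedDim_eq {k : ℕ} (hne : ∀ j, lam j ≠ mu j) (hlam : ∑ j, lam j = 0)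
    (hmu : ∑ j, mu j = 0) {A : Quad (2 * k + 1)} (hA : A ∈ variety (2 * k + 1) (k + 1) k lam mu) :
    expectedDim A = (2 * k + 1 : ℤ) ^ 2 - 1 := by
  have hn : k + 1 + k = 2 * k + 1 := by ring
  rw [mem_variety_iff hn hne hlam hmu] at hA
  have h1 : ∀ j, classDim (A j) = 2 * ((k + 1) * k) := fun j =>
    classDim_eq hn (hne j) (congrFun (ofRefl_toRefl hne A) j).symm (hA.1.sq j) (hA.2 j)
  simp only [expectedDim, rigidityIndex, h1]
  simp
  ring

end Dimension

theorem continuous_ofRefl {ι : Type*} [Fintype ι] [DecidableEq ι] (lam mu : Fin 4 → ℂ) :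
    Continuous fun r : Fin 4 → Matrix ι ι ℂ => ofRefl lam mu r :=
  continuous_pi fun j => by
    have h1 : Continuous fun r : Fin 4 → Matrix ι ι ℂ => r j := continuous_apply j
    exact (continuous_const.add (h1.const_smul (mu j - lam j))).const_smul (2⁻¹ : ℂ)

end DSP

theorem proposition4 (k s : ℕ) (hk : 1 ≤ k) (hs : s ≤ k) (lam mu : Fin 4 → ℂ)
    (hne : ∀ j, lam j ≠ mu j)
    (htr : ((k : ℂ) + 1) * ∑ j, lam j + (k : ℂ) * ∑ j, mu j = 0)
    (hrel : DSP.OnlyRelation k lam mu) :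
    (∃ S : Set (DSP.Quad (2 * k + 1)), DSP.IsStratumHB k s lam mu S) ∧
    ∀ S : Set (DSP.Quad (2 * k + 1)), DSP.IsStratumHB k s lam mu S →
      DSP.IsLocallySmoothVariety (DSP.coords '' S) ((2 * k + 1) ^ 2 + s - 1) ∧
      (∀ A ∈ S, (((2 * k + 1) ^ 2 + s - 1 : ℕ) : ℤ) = DSP.expectedDim A + s) ∧
      IsConnected S := by
  have hlam := hrel.1
  have hmu := hrel.sum_mu_eq_zero hk htr
  have hc := hrel.noSubsum hk htr
  have e : (Σ t : Option (Fin s), Fin (DSP.blockSize (2 * (k - s) + 1) t)) ≃ Fin (2 * k + 1) :=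
    (DSP.blockEquiv (2 * (k - s) + 1) s).symm.trans (Fintype.equivFinOfCardEq (by
      simp only [Fintype.card_sum, Fintype.card_prod, Fintype.card_fin]
      omega))
  constructor
  · obtain ⟨o, H, hH⟩ := DSP.exists_isTypeH hne hlam hmu (k - s)
    obtain ⟨r, hr⟩ := DSP.nonempty_setOf_isHB (h := DSP.toRefl lam mu H) hc.ne_zero e
    refine ⟨DSP.setHB k s lam mu o, ⟨DSP.ofRefl lam mu r, ?_⟩, o, rfl⟩
    rw [DSP.mem_setHB_iff hs hne hlam hmu hc hH, DSP.toRefl_ofRefl hne]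
    exact hr
  · rintro S ⟨hS, o, rfl⟩
    obtain ⟨A, hA⟩ := id hS
    obtain ⟨B, H, -, -, -, -, hH, -⟩ := hA.2
    have hmem := fun A => DSP.mem_setHB_iff (A := A) hs hne hlam hmu hc hH
    refine ⟨DSP.isLocallySmoothVariety_of_isHB hs hne hc
      (hH.isUnipotent hne hlam hmu hc) hmem, fun A hA => ?_, hS, ?_⟩
    · rw [DSP.expectedDim_eq hne hlam hmu hA.1, Nat.cast_sub (by nlinarith)]
      push_cast
      ring
    · have himage : DSP.setHB k s lam mu o = (fun r => DSP.ofRefl lam mu r) ''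
          {r | DSP.IsHB (fun j => mu j - lam j) s (DSP.toRefl lam mu H) r} := by
        ext A
        constructor
        · exact fun hA => ⟨DSP.toRefl lam mu A, (hmem A).1 hA, DSP.ofRefl_toRefl hne A⟩
        · rintro ⟨r, hr, rfl⟩
          refine (hmem _).2 ?_
          simp only [DSP.toRefl_ofRefl hne]
          exact hr
      rw [himage]
      exact (DSP.isPreconnected_setOf_isHB hc e).image _ (DSP.continuous_ofRefl lam mu).continuousOn
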